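/- **Setting.** There are $N\ge 1$ nodes, $x\in\mathbb R^d$, $y\in\mathbb R^p$ with $p\ge1$. Node $i$ has the losses $f_i(x,y)=\mathbb E_{\xi\sim\mathcal D_{f_i}}[F(x,y;\xi)]$ and $g_i(x,y)=\mathbb E_{\zeta\sim\mathcal D_{g_i}}[G(x,y;\zeta)]$. Put $f=\frac1N\sum_i f_i$, $g=\frac1N\sum_i g_i$, $y^\star(x)=\arg\min_y g(x,y)$, $\Phi(x)=f(x,y^\star(x))$ and $z^\star(x)=[\nabla^2_{22}g(x,y^\star(x))]^{-1}\nabla_2f(x,y^\star(x))$. A bar denotes the average over the nodes. **Assumptions.** 1. There are constants $L_f,L_{\nabla f},L_{\nabla g},L_{\nabla^2g},\mu_g>0$ such that $\nabla f_i,\nabla g_i,\nabla^2g_i$ are Lipschitz with constants $L_{\nabla f},L_{\nabla g},L_{\nabla^2g}$, $\|\nabla_2f_i(x,y^\star(x))\|\le L_f$ for all $x$, and each $g_i(x,\cdot)$ is $\mu_g$-strongly convex. Put $L=\max\{L_f,L_{\nabla f},L_{\nabla g},L_{\nabla^2g}\}$ and $\kappa=L/\mu_g$. 2. There are $b_1,b_2\ge0$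 such that, for all $(x,y)$, $\frac1N\sum_i\|\nabla_kf_i-\nabla_kf\|^2\le b_1^2$ for $k=1,2$, and the same averages for $\nabla_2g_i$, $\nabla^2_{12}g_i$, $\nabla^2_{22}g_i$ are at most $b_2^2$. 3. $F$ is differentiable and $G$ twice differentiable in $(x,y)$. At every $(x,y)$ and for every node, $\nabla_1F,\nabla_2F,\nabla_2G,\nabla^2_{12}G,\nabla^2_{22}G$ are unbiased estimates of the corresponding derivatives of $f_i,g_i$ with variance at most $\sigma^2$. 4. $W\in\mathbb R^{N\times N}$ satisfies $\mathbf 1^\top W=\mathbf 1^\top$, $W\mathbf 1=\mathbf 1$, and $\rho:=\|W-\mathbf 1\mathbf 1^\top/N\|_2\in[0,1)$. **Algorithm (D-SOBA).** From a deterministic start $(x_i^{(0)},y_i^{(0)},z_i^{(0)},h_i^{(0)})$, at each iteration $t$ all nodes draw independent samples $\xi_i^{(t)}\sim\mathcal D_{f_i}$, $\zeta_i^{(t)}\sim\mathcal D_{g_i}$, also independent of the past, and set $$x_i^{(t+1)}=\sum_jw_{ij}(x_j^{(t)}-\tau\alpha h_j^{(t)}),\qquad y_i^{(t+1)}=\sum_jw_{ij}\big(y_j^{(t)}-\beta\nabla_2G(x_j^{(t)},y_j^{(t)};\zeta_j^{(t)})\big),$$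 $$z_i^{(t+1)}=\sum_jw_{ij}\big(z_j^{(t)}-\gamma(p_{H,j}^{(t)}-\nabla_2F(x_j^{(t)},y_j^{(t)};\xi_j^{(t)}))\big),\qquad h_i^{(t+1)}=(1-\theta)h_i^{(t)}+\theta\big(\nabla_1F(x_i^{(t)},y_i^{(t)};\xi_i^{(t)})-p_{J,i}^{(t)}\big).$$ In the second-order variant $p_{H,i}^{(t)}=\nabla^2_{22}G(x_i^{(t)},y_i^{(t)};\zeta_i^{(t)})z_i^{(t)}$ and $p_{J,i}^{(t)}=\nabla^2_{12}G(x_i^{(t)},y_i^{(t)};\zeta_i^{(t)})z_i^{(t)}$. In the first-order variant $p_{H,i}^{(t)}=\frac1{2\delta_t}\big(\nabla_2G(x_i^{(t)},y_i^{(t)}+\delta_tz_i^{(t)};\zeta_i^{(t)})-\nabla_2G(x_i^{(t)},y_i^{(t)}-\delta_tz_i^{(t)};\zeta_i^{(t)})\big)$, and $p_{J,i}^{(t)}$ is the same expression with $\nabla_1G$ in place of $\nabla_2G$. **Theorem.** Let $L>0$, $\sigma\ge0$, $R\in\mathbb R$ and $0<\underline\tau\le\overline\tau$. There are constants $c_1,c_2,c_3,\underline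 a,\overline a,C>0$, depending only on $L,\sigma,R,\underline\tau,\overline\tau$, with the following property. For all $N$, $L_f,L_{\nabla f},L_{\nabla g},L_{\nabla^2g}$ (with maximum $L$), $\mu_g$, $\rho$, $b_1$, $b_2$ there is $T_0$ such that for every $T\ge1$ there are a step size $\alpha>0$ and a threshold $\varepsilon>0$ with $$\alpha\le\overline a\sqrt{N/T},\qquad \alpha\ge\underline a\sqrt{N/T}\ \text{ if } T\ge T_0 ,$$ such that the following holds for every problem, mixing matrix and start that satisfy Assumptions 1–4 with these constants and whose initial quantities $\Phi(\bar x^{(0)})-\inf\Phi$, $\|\bar y^{(0)}-y^\star(\bar x^{(0)})\|^2$, $\|\bar z^{(0)}-z^\star(\bar x^{(0)})\|^2$, $\|\bar h^{(0)}-\nabla\Phi(\bar x^{(0)})\|^2$, $\kappa^2\sum_i(\|x_i^{(0)}-\bar x^{(0)}\|^2+\|y_i^{(0)}-\bar y^{(0)}\|^2)+\sum_i\|z_i^{(0)}-\bar z^{(0)}\|^2$ and $\sum_i\|h_i^{(0)}-\bar h^{(0)}\|^2$ are all at most $R$. Run D-SOBA with any $\tau\in[\underline\tau\kappa^{-4},\overline\tau\kappa^{-4}]$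 and $\beta=c_1\alpha$, $\gamma=c_2\alpha$, $\theta=c_3\alpha$, either in the second-order variant, or in the first-order variant with any $\delta_t>0$ that is a function of the samples drawn before iteration $t$ and satisfies, almost surely, $\delta_t\|z_i^{(t)}\|^2\le\varepsilon$ for all $i$ and all $t<T$. Then $\Phi$ is differentiable, $\|\nabla\Phi(\bar x^{(t)})\|^2$ is integrable for all $t<T$, and $$\frac1T\sum_{t=0}^{T-1}\mathbb E\|\nabla\Phi(\bar x^{(t)})\|^2\le C\Big(\frac{\kappa^5}{\sqrt{NT}}+\frac{\rho^{2/3}\kappa^6}{(1-\rho)^{1/3}T^{2/3}}+\frac{\rho^{2/3}(b_1^{2/3}\kappa^{16/3}+b_2^{2/3}\kappa^6)}{(1-\rho)^{2/3}T^{2/3}}+\frac{\rho\kappa^6}{(1-\rho)T}+\frac{\kappa^4}{(1-\rho)NT}+\frac{\kappa^{13}}T+\frac{\kappa^7}{NT}\Big).$$ -/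

import Mathlib

open MeasureTheory ProbabilityTheory

noncomputable section

namespace DSOBA

/-- The Euclidean space `ℝⁿ`. -/
abbrev Vec (n : ℕ) : Type := EuclideanSpace ℝ (Fin n)

section Calculus

variable {d p : ℕ}

/-- `φ(x, y)` as a function of the concatenated vector `u = (x, y) ∈ ℝᵈ × ℝᵖ`, with the Euclidean
norm `(‖x‖² + ‖y‖²)^{1/2}`. -/
def joint (φ : Vec d → Vec p → ℝ) : EuclideanSpace ℝ (Fin d ⊕ Fin p) → ℝ :=
  fun u => φ (WithLp.toLp 2 fun i => u (Sum.inl i)) (WithLp.toLp 2 fun j => u (Sum.inr j))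

/-- The partial gradient `∇₁φ(x, y)`. -/
def grad1 (φ : Vec d → Vec p → ℝ) (x : Vec d) (y : Vec p) : Vec d :=
  gradient (fun x' => φ x' y) x

/-- The partial gradient `∇₂φ(x, y)`. -/
def grad2 (φ : Vec d → Vec p → ℝ) (x : Vec d) (y : Vec p) : Vec p :=
  gradient (fun y' => φ x y') y

/-- The `d × p` block `∇²₁₂φ(x, y)`, as a linear map `ℝᵖ → ℝᵈ` with the spectral norm. -/
def hess12 (φ : Vec d → Vec p → ℝ) (x : Vec d) (y : Vec p) : Vec p →L[ℝ] Vec d :=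
  fderiv ℝ (fun y' => grad1 φ x y') y

/-- The `p × p` block `∇²₂₂φ(x, y)`, as a linear map with the spectral norm. -/
def hess22 (φ : Vec d → Vec p → ℝ) (x : Vec d) (y : Vec p) : Vec p →L[ℝ] Vec p :=
  fderiv ℝ (fun y' => grad2 φ x y') y

end Calculus

/-- The average over the nodes. -/
def avg {N : ℕ} {E : Type*} [AddCommGroup E] [Module ℝ E] (v : Fin N → E) : E :=
  (N : ℝ)⁻¹ • ∑ i, v i

/-- The squared Frobenius distance of the stacked local variables to their average. -/
def spread {N : ℕ} {n : ℕ} (v : Fin N → Vec n) : ℝ :=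
  ∑ i, ‖v i - avg v‖ ^ 2

/-- The data of a decentralized stochastic bilevel problem with `N` nodes: the sample losses
`F(x, y; ξ)` and `G(x, y; ζ)` and the local sample distributions of every node. -/
structure Problem (N d p : ℕ) (Ξ Z : Type*) [MeasurableSpace Ξ] [MeasurableSpace Z] where
  /-- upper-level sample loss -/
  F : Vec d → Vec p → Ξ → ℝ
  /-- lower-level sample loss -/
  G : Vec d → Vec p → Z → ℝ
  /-- local upper-level distributions -/
  Df : Fin N → Measure Ξ
  /-- local lower-level distributions -/
  Dg : Fin N → Measure Z

namespace Problem

variable {N d p : ℕ} {Ξ Z : Type*} [MeasurableSpace Ξ] [MeasurableSpace Z]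

/-- The upper-level sample loss with the sample `ξ` frozen. -/
def Fat (P : Problem N d p Ξ Z) (ξ : Ξ) : Vec d → Vec p → ℝ := fun x y => P.F x y ξ

/-- The lower-level sample loss with the sample `ζ` frozen. -/
def Gat (P : Problem N d p Ξ Z) (ζ : Z) : Vec d → Vec p → ℝ := fun x y => P.G x y ζ

/-- The local upper-level loss `fᵢ(x, y) = 𝔼[F(x, y; ξᵢ)]`. -/
def f (P : Problem N d p Ξ Z) (i : Fin N) (x : Vec d) (y : Vec p) : ℝ :=
  ∫ ξ, P.F x y ξ ∂(P.Df i)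

/-- The local lower-level loss `gᵢ(x, y) = 𝔼[G(x, y; ζᵢ)]`. -/
def g (P : Problem N d p Ξ Z) (i : Fin N) (x : Vec d) (y : Vec p) : ℝ :=
  ∫ ζ, P.G x y ζ ∂(P.Dg i)

/-- The global upper-level loss `f = (1/N) ∑ᵢ fᵢ`. -/
def fbar (P : Problem N d p Ξ Z) (x : Vec d) (y : Vec p) : ℝ := avg fun i => P.f i x y

/-- The global lower-level loss `g = (1/N) ∑ᵢ gᵢ`. -/
def gbar (P : Problem N d p Ξ Z) (x : Vec d) (y : Vec p) : ℝ := avg fun i => P.g i x y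

/-- The lower-level solution: a minimizer of `g(x, ·)` (it exists and is unique when the
`gᵢ(x, ·)` are differentiable and strongly convex). -/
def ystar (P : Problem N d p Ξ Z) (x : Vec d) : Vec p :=
  Classical.epsilon fun y => IsMinOn (P.gbar x) Set.univ y

/-- The bilevel objective `Φ(x) = f(x, y⋆(x))`. -/
def Phi (P : Problem N d p Ξ Z) (x : Vec d) : ℝ := P.fbar x (P.ystar x)

/-- `z⋆(x) = [∇²₂₂g(x, y⋆(x))]⁻¹ ∇₂f(x, y⋆(x))`. -/
def zstar (P : Problem N d p Ξ Z) (x : Vec d) : Vec p :=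
  (hess22 P.gbar x (P.ystar x)).inverse (grad2 P.fbar x (P.ystar x))

end Problem

section Assumptions

variable {N d p : ℕ} {Ξ Z : Type*} [MeasurableSpace Ξ] [MeasurableSpace Z]

/-- Smoothness of the local losses, boundedness of `∇₂fᵢ` along `y⋆`, and strong convexity of the
local lower-level losses. -/
structure Smooth (P : Problem N d p Ξ Z) (Lf Lgradf Lgradg Lhessg μ : ℝ) : Prop where
  diff_f : ∀ i, Differentiable ℝ (joint (P.f i))
  lip_grad_f : ∀ i u v,
    ‖gradient (joint (P.f i)) u - gradient (joint (P.f i)) v‖ ≤ Lgradf * ‖u - v‖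
  diff_g : ∀ i, Differentiable ℝ (joint (P.g i))
  lip_grad_g : ∀ i u v,
    ‖gradient (joint (P.g i)) u - gradient (joint (P.g i)) v‖ ≤ Lgradg * ‖u - v‖
  diff_grad_g : ∀ i, Differentiable ℝ (gradient (joint (P.g i)))
  lip_hess_g : ∀ i u v,
    ‖fderiv ℝ (gradient (joint (P.g i))) u - fderiv ℝ (gradient (joint (P.g i))) v‖
      ≤ Lhessg * ‖u - v‖
  bound_f : ∀ i x, ‖grad2 (P.f i) x (P.ystar x)‖ ≤ Lf
  strong_convex : ∀ i x, StrongConvexOn Set.univ μ (P.g i x)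

/-- Bounded gradient dissimilarity between the nodes. -/
structure Dissimilarity (P : Problem N d p Ξ Z) (b₁ b₂ : ℝ) : Prop where
  f1 : ∀ x y, avg (fun i => ‖grad1 (P.f i) x y - grad1 P.fbar x y‖ ^ 2) ≤ b₁ ^ 2
  f2 : ∀ x y, avg (fun i => ‖grad2 (P.f i) x y - grad2 P.fbar x y‖ ^ 2) ≤ b₁ ^ 2
  g2 : ∀ x y, avg (fun i => ‖grad2 (P.g i) x y - grad2 P.gbar x y‖ ^ 2) ≤ b₂ ^ 2
  g12 : ∀ x y, avg (fun i => ‖hess12 (P.g i) x y - hess12 P.gbar x y‖ ^ 2) ≤ b₂ ^ 2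
  g22 : ∀ x y, avg (fun i => ‖hess22 (P.g i) x y - hess22 P.gbar x y‖ ^ 2) ≤ b₂ ^ 2

/-- Under the distribution `D`, the random element `V` has mean `m` and variance at most `σ²`. -/
def UnbiasedOracle {S E : Type*} [MeasurableSpace S] [NormedAddCommGroup E] [NormedSpace ℝ E]
    (D : Measure S) (V : S → E) (m : E) (σ : ℝ) : Prop :=
  MemLp V 2 D ∧ ∫ s, V s ∂D = m ∧ ∫ s, ‖V s - m‖ ^ 2 ∂D ≤ σ ^ 2

/-- The stochastic oracles: the sample losses are measurable in the sample, `F` is differentiable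
and `G` twice differentiable in `(x, y)`, the expectations defining `fᵢ`, `gᵢ` exist, and the sampled
gradients, Jacobians and Hessians are unbiased with variance at most `σ²`. -/
structure Stochastic (P : Problem N d p Ξ Z) (σ : ℝ) : Prop where
  prob_f : ∀ i, IsProbabilityMeasure (P.Df i)
  prob_g : ∀ i, IsProbabilityMeasure (P.Dg i)
  meas_F : ∀ x y, Measurable (P.F x y)
  meas_G : ∀ x y, Measurable (P.G x y)
  int_F : ∀ i x y, Integrable (P.F x y) (P.Df i)
  int_G : ∀ i x y, Integrable (P.G x y) (P.Dg i)
  diff_F : ∀ ξ, Differentiable ℝ (joint (P.Fat ξ))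
  diff_G : ∀ ζ, Differentiable ℝ (joint (P.Gat ζ))
  diff_grad_G : ∀ ζ, Differentiable ℝ (gradient (joint (P.Gat ζ)))
  F1 : ∀ i x y, UnbiasedOracle (P.Df i) (fun ξ => grad1 (P.Fat ξ) x y) (grad1 (P.f i) x y) σ
  F2 : ∀ i x y, UnbiasedOracle (P.Df i) (fun ξ => grad2 (P.Fat ξ) x y) (grad2 (P.f i) x y) σ
  G2 : ∀ i x y, UnbiasedOracle (P.Dg i) (fun ζ => grad2 (P.Gat ζ) x y) (grad2 (P.g i) x y) σ
  G12 : ∀ i x y, UnbiasedOracle (P.Dg i) (fun ζ => hess12 (P.Gat ζ) x y) (hess12 (P.g i) x y) σ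
  G22 : ∀ i x y, UnbiasedOracle (P.Dg i) (fun ζ => hess22 (P.Gat ζ) x y) (hess22 (P.g i) x y) σ

/-- `‖W - 𝟙𝟙ᵀ/N‖₂` (spectral norm). -/
def mixingRate (W : Matrix (Fin N) (Fin N) ℝ) : ℝ :=
  ‖Matrix.toEuclideanCLM (n := Fin N) (𝕜 := ℝ) (W - (N : ℝ)⁻¹ • Matrix.vecMulVec 1 1)‖

/-- `W` is doubly stochastic (`𝟙ᵀW = 𝟙ᵀ`, `W𝟙 = 𝟙`) and `‖W - 𝟙𝟙ᵀ/N‖₂ = ρ`. -/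
structure Mixing (W : Matrix (Fin N) (Fin N) ℝ) (ρ : ℝ) : Prop where
  col_sum : Matrix.vecMul 1 W = 1
  row_sum : Matrix.mulVec W 1 = 1
  rate : mixingRate W = ρ

end Assumptions

/-- The two variants of the algorithm: second-order and first-order. -/
inductive Variant
  | SO
  | FO

/-- The local variables of all nodes. -/
structure State (N d p : ℕ) where
  /-- upper-level variables -/
  x : Fin N → Vec d
  /-- lower-level variables -/
  y : Fin N → Vec p
  /-- auxiliary variables -/
  z : Fin N → Vec p
  /-- moving averages of the hypergradient estimates -/
  h : Fin N → Vec d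

section Algorithm

variable {N d p : ℕ} {Ξ Z : Type*} [MeasurableSpace Ξ] [MeasurableSpace Z]

/-- The estimate `p_H` of the Hessian-vector product `∇²₂₂g(x, y) z` from the sample `ζ`. -/
def pH (P : Problem N d p Ξ Z) (v : Variant) (δ : ℝ) (ζ : Z)
    (x : Vec d) (y z : Vec p) : Vec p :=
  match v with
  | .SO => hess22 (P.Gat ζ) x y z
  | .FO => (2 * δ)⁻¹ • (grad2 (P.Gat ζ) x (y + δ • z) - grad2 (P.Gat ζ) x (y - δ • z))

/-- The estimate `p_J` of the Jacobian-vector product `∇²₁₂g(x, y) z` from the sample `ζ`. -/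
def pJ (P : Problem N d p Ξ Z) (v : Variant) (δ : ℝ) (ζ : Z)
    (x : Vec d) (y z : Vec p) : Vec d :=
  match v with
  | .SO => hess12 (P.Gat ζ) x y z
  | .FO => (2 * δ)⁻¹ • (grad1 (P.Gat ζ) x (y + δ • z) - grad1 (P.Gat ζ) x (y - δ • z))

/-- One iteration. The weights vanish off the edges of the network, so that the sums over the
neighbours are sums over all nodes. -/
def step (P : Problem N d p Ξ Z) (v : Variant) (W : Matrix (Fin N) (Fin N) ℝ)
    (τ α β γ θ δ : ℝ) (ξ : Fin N → Ξ) (ζ : Fin N → Z) (s : State N d p) : State N d p where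
  x i := ∑ j, W i j • (s.x j - (τ * α) • s.h j)
  y i := ∑ j, W i j • (s.y j - β • grad2 (P.Gat (ζ j)) (s.x j) (s.y j))
  z i := ∑ j, W i j • (s.z j - γ •
    (pH P v δ (ζ j) (s.x j) (s.y j) (s.z j) - grad2 (P.Fat (ξ j)) (s.x j) (s.y j)))
  h i := (1 - θ) • s.h i + θ •
    (grad1 (P.Fat (ξ i)) (s.x i) (s.y i) - pJ P v δ (ζ i) (s.x i) (s.y i) (s.z i))

/-- The iterates of D-SOBA along a sample path, from the initial state `s₀`. -/
def iterates (P : Problem N d p Ξ Z) (v : Variant) (W : Matrix (Fin N) (Fin N) ℝ)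
    (τ : ℝ) (α β γ θ δ : ℕ → ℝ) (ξ : ℕ → Fin N → Ξ) (ζ : ℕ → Fin N → Z) (s₀ : State N d p) :
    ℕ → State N d p
  | 0 => s₀
  | t + 1 => step P v W τ (α t) (β t) (γ t) (θ t) (δ t) (ξ t) (ζ t)
      (iterates P v W τ α β γ θ δ ξ ζ s₀ t)

/-- All samples `ξᵢ⁽ᵗ⁾ ∼ D_{fᵢ}` and `ζᵢ⁽ᵗ⁾ ∼ D_{gᵢ}` are drawn independently. -/
structure Sampling {Ω : Type*} [MeasurableSpace Ω] (Pr : Measure Ω) (P : Problem N d p Ξ Z)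
    (ξ : ℕ → Fin N → Ω → Ξ) (ζ : ℕ → Fin N → Ω → Z) : Prop where
  meas_ξ : ∀ t i, Measurable (ξ t i)
  meas_ζ : ∀ t i, Measurable (ζ t i)
  law : ∀ t i, Pr.map (fun ω => (ξ t i ω, ζ t i ω)) = (P.Df i).prod (P.Dg i)
  indep : iIndepFun (fun (k : ℕ × Fin N) ω => (ξ k.1 k.2 ω, ζ k.1 k.2 ω)) Pr

/-- The `σ`-algebra of the samples drawn before iteration `t`. -/
@[reducible] def past {Ω : Type*} (ξ : ℕ → Fin N → Ω → Ξ) (ζ : ℕ → Fin N → Ω → Z) (t : ℕ) :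
    MeasurableSpace Ω :=
  ⨆ (s : ℕ) (_ : s < t) (i : Fin N),
    MeasurableSpace.comap (fun ω => (ξ s i ω, ζ s i ω)) inferInstance

/-- Bounds by `R` on the initial errors: the optimality gap `Φ(x̄⁽⁰⁾) - inf Φ`, the errors of
`ȳ⁽⁰⁾`, `z̄⁽⁰⁾`, `h̄⁽⁰⁾`, and the consensus errors. -/
structure InitBound (P : Problem N d p Ξ Z) (s₀ : State N d p) (κ R : ℝ) : Prop where
  gap : ∀ x, P.Phi (avg s₀.x) - P.Phi x ≤ R
  y_err : ‖avg s₀.y - P.ystar (avg s₀.x)‖ ^ 2 ≤ R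
  z_err : ‖avg s₀.z - P.zstar (avg s₀.x)‖ ^ 2 ≤ R
  h_err : ‖avg s₀.h - gradient P.Phi (avg s₀.x)‖ ^ 2 ≤ R
  consensus : κ ^ 2 * (spread s₀.x + spread s₀.y) + spread s₀.z ≤ R
  h_consensus : spread s₀.h ≤ R

end Algorithm

/-- The condition number `κ`. -/
def condNumber (Lf Lgradf Lgradg Lhessg μ : ℝ) : ℝ :=
  max (max Lf Lgradf) (max Lgradg Lhessg) / μ

/-- The convergence rate: the asymptotic term and the extra overhead. -/
def rateBound (N T : ℕ) (κ ρ b₁ b₂ : ℝ) : ℝ :=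
  κ ^ 5 / √(N * T)
    + ρ ^ (2 / 3 : ℝ) * κ ^ 6 / ((1 - ρ) ^ (1 / 3 : ℝ) * (T : ℝ) ^ (2 / 3 : ℝ))
    + ρ ^ (2 / 3 : ℝ) * (b₁ ^ (2 / 3 : ℝ) * κ ^ (16 / 3 : ℝ) + b₂ ^ (2 / 3 : ℝ) * κ ^ 6)
        / ((1 - ρ) ^ (2 / 3 : ℝ) * (T : ℝ) ^ (2 / 3 : ℝ))
    + ρ * κ ^ 6 / ((1 - ρ) * T)
    + κ ^ 4 / ((1 - ρ) * (N * T))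
    + κ ^ 13 / T
    + κ ^ 7 / (N * T)

end DSOBA

end

/-! The proof is a Lyapunov descent that couples the averaged iterates with the consensus errors.
With the normalised step `a` (so `β = γ = a / L`, `θ = a`, `τ α = r / L`, `r = t a`), all errors are
measured relative to the reference point given by x̄, y⋆(x̄), z⋆(x̄) and ∇Φ(x̄).

Regularity. Strong convexity makes y⋆ `κ`-Lipschitz and z⋆ bounded by `κ` and `3κ³`-Lipschitz
(`ystar_lip`, `norm_zstar_le`, `zstar_lip`). The function Φ has a second-order Taylor bound with a
constant of order `L κ³` (`phi_taylor`). No implicit function theorem enters: ∇₂g vanishes at (x,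
y⋆(x)) and at (x', y⋆(x')), and testing this against z⋆(x) eliminates the increment of y⋆.

Oracles. Conditionally on the past, every sampled direction is an unbiased estimate of a mean that
lies within `L ε` of the exact direction; the variance of the z and h directions is proportional to
`1 + ‖z‖²`. This covers both variants: a central difference is the average over a segment of sampled
Hessian-vector products, so by Jensen and Fubini its variance is no larger than that of the exact
product (`oracle_increment`, `oracle_difference`).

One step. The averages ȳ, z̄ contract towards their moving targets at a rate of order `a / κ`, h̄ at
rate `a`, and the consensus errors of x, y, z contract by `ρ`. Independent noise in an average has
variance of order `a² / N`, which is where the linear speedup comes from; the noise in the consensus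
errors survives only with the factor `ρ²`. The targets move with x̄, by an amount proportional to `r
‖h̄‖`. Since `t` is of order `κ⁻⁴`, these drifts are absorbed by the term in `-‖h̄‖²` which the
descent of Φ provides (`phi_next`).

Weights. The errors feed each other in a cascade: h̄ is disturbed by z̄, both are disturbed by ȳ,
all of them by the consensus errors, and the consensus error of x by that of h. The weights in
`lyapunov` grow along this chain so that each negative term dominates what the earlier links need;
`drift_le` checks this, and `StepSetting.lyapunov_next` turns it into a descent of the conditional
expectation.

Rate. Summing over a run (`sum_sizeG_le`) bounds the average gradient by the initial Lyapunov value
over `r T` plus `stepError`. The step is `a = 1 / stepDenom`: the denominator contains one summand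
for each stability condition and one for each error term to be balanced, so that both contributions
are bounded by `rateBound` (`initial_rate_le`, `stepError_le`). -/

noncomputable section

namespace DSOBA

/-! ### Averages, deviations from the average, and contraction by the mixing matrix -/

section Averages

variable {N : ℕ}

theorem avg_sub {E : Type*} [AddCommGroup E] [Module ℝ E] (v w : Fin N → E) :
    avg (fun i => v i - w i) = avg v - avg w := by
  simp [avg, Finset.sum_sub_distrib, smul_sub]

theorem avg_add {E : Type*} [AddCommGroup E] [Module ℝ E] (v w : Fin N → E) :
    avg (fun i => v i + w i) = avg v + avg w := by
  simp [avg, Finset.sum_add_distrib, smul_add]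

theorem avg_smul {E : Type*} [AddCommGroup E] [Module ℝ E] (c : ℝ) (v : Fin N → E) :
    avg (fun i => c • v i) = c • avg v := by
  simp only [avg, ← Finset.smul_sum]
  rw [smul_comm]

theorem avg_const {E : Type*} [AddCommGroup E] [Module ℝ E] (hN : 1 ≤ N) (c : E) :
    avg (fun _ : Fin N => c) = c := by
  have : (N : ℝ) ≠ 0 := by positivity
  simp only [avg, Finset.sum_const, Finset.card_univ, Fintype.card_fin]
  rw [← Nat.cast_smul_eq_nsmul ℝ, smul_smul, inv_mul_cancel₀ this, one_smul]

theorem avg_map {E E' : Type*} [AddCommGroup E] [Module ℝ E] [AddCommGroup E'] [Module ℝ E']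
    (A : E →ₗ[ℝ] E') (v : Fin N → E) : A (avg v) = avg (fun i => A (v i)) := by
  simp [avg, map_sum]

theorem avg_mono {v w : Fin N → ℝ} (h : ∀ i, v i ≤ w i) : avg v ≤ avg w := by
  simp only [avg, smul_eq_mul]
  gcongr with i
  exact h i

theorem sum_eq_card_smul_avg {E : Type*} [AddCommGroup E] [Module ℝ E] (hN : 1 ≤ N)
    (v : Fin N → E) : ∑ i, v i = (N : ℝ) • avg v := by
  have : (N : ℝ) ≠ 0 := by positivity
  rw [avg, smul_smul, mul_inv_cancel₀ this, one_smul]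

theorem norm_avg_le {E : Type*} [NormedAddCommGroup E] [NormedSpace ℝ E] (v : Fin N → E) :
    ‖avg v‖ ≤ avg (fun i => ‖v i‖) := by
  simp only [avg, smul_eq_mul, norm_smul, norm_inv, RCLike.norm_natCast]
  gcongr
  exact norm_sum_le _ _

theorem sq_avg_le (v : Fin N → ℝ) : avg v ^ 2 ≤ avg (fun i => v i ^ 2) := by
  rcases Nat.eq_zero_or_pos N with rfl | hN
  · simp [avg]
  have h : (0 : ℝ) < N := by positivity
  simp only [avg, smul_eq_mul]
  have := @sq_sum_le_card_mul_sum_sq (Fin N) ℝ _ _ _ _ Finset.univ v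
  simp only [Finset.card_univ, Fintype.card_fin] at this
  rw [mul_pow, inv_pow]
  calc ((N : ℝ) ^ 2)⁻¹ * (∑ i, v i) ^ 2 ≤ ((N : ℝ) ^ 2)⁻¹ * (N * ∑ i, v i ^ 2) := by gcongr
    _ = _ := by field_simp

theorem norm_avg_sq_le {E : Type*} [NormedAddCommGroup E] [NormedSpace ℝ E] (v : Fin N → E) :
    ‖avg v‖ ^ 2 ≤ avg (fun i => ‖v i‖ ^ 2) :=
  (pow_le_pow_left₀ (norm_nonneg _) (norm_avg_le v) 2).trans (sq_avg_le _)

/-- The bias-variance decomposition over the nodes. -/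
theorem sum_sq_eq_spread_add (hN : 1 ≤ N) {n : ℕ} (v : Fin N → Vec n) (c : Vec n) :
    ∑ i, ‖v i - c‖ ^ 2 = spread v + N * ‖avg v - c‖ ^ 2 := by
  have h1 : ∀ i, ‖v i - c‖ ^ 2 =
      ‖v i - avg v‖ ^ 2 + 2 * inner ℝ (v i - avg v) (avg v - c) + ‖avg v - c‖ ^ 2 := by
    intro i
    rw [← norm_add_sq_real]
    congr 2
    abel
  have h2 : ∑ i, inner ℝ (v i - avg v) (avg v - c) = (0 : ℝ) := by
    rw [← sum_inner, Finset.sum_sub_distrib, sum_eq_card_smul_avg hN]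
    simp [← Nat.cast_smul_eq_nsmul ℝ]
  simp only [h1, Finset.sum_add_distrib, ← Finset.mul_sum, h2]
  simp [spread]

theorem avg_sq_eq_spread_add (hN : 1 ≤ N) {n : ℕ} (v : Fin N → Vec n) (c : Vec n) :
    avg (fun i => ‖v i - c‖ ^ 2) = spread v / N + ‖avg v - c‖ ^ 2 := by
  have : (N : ℝ) ≠ 0 := by positivity
  rw [avg, sum_sq_eq_spread_add hN, smul_eq_mul, mul_add, inv_mul_cancel_left₀ this]
  ring

theorem spread_nonneg {n : ℕ} (v : Fin N → Vec n) : 0 ≤ spread v :=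
  Finset.sum_nonneg fun _ _ => by positivity

theorem spread_le (hN : 1 ≤ N) {n : ℕ} (v : Fin N → Vec n) (c : Vec n) :
    spread v ≤ ∑ i, ‖v i - c‖ ^ 2 := by
  rw [sum_sq_eq_spread_add hN]
  have : 0 ≤ (N : ℝ) * ‖avg v - c‖ ^ 2 := by positivity
  linarith

theorem spread_le_avg (hN : 1 ≤ N) {n : ℕ} (v : Fin N → Vec n) (c : Vec n) :
    spread v / N ≤ avg (fun i => ‖v i - c‖ ^ 2) := by
  rw [avg_sq_eq_spread_add hN]
  have : 0 ≤ ‖avg v - c‖ ^ 2 := by positivity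
  linarith

/-- Young's inequality for the squared norm. -/
theorem norm_add_sq_le_young {E : Type*} [NormedAddCommGroup E] [InnerProductSpace ℝ E]
    {s : ℝ} (hs : 0 < s) (a b : E) :
    ‖a + b‖ ^ 2 ≤ (1 + s) * ‖a‖ ^ 2 + (1 + 1 / s) * ‖b‖ ^ 2 := by
  have h := norm_add_le a b
  have h2 : ‖a + b‖ ^ 2 ≤ (‖a‖ + ‖b‖) ^ 2 := by gcongr
  have h3 : 0 ≤ (s * ‖a‖ - ‖b‖) ^ 2 / s := by positivity
  have h4 : (s * ‖a‖ - ‖b‖) ^ 2 / s = s * ‖a‖ ^ 2 - 2 * ‖a‖ * ‖b‖ + 1 / s * ‖b‖ ^ 2 := by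
    field_simp
    ring
  nlinarith

/-- Convexity of the squared norm. -/
theorem norm_convex_sq_le {E : Type*} [NormedAddCommGroup E] [InnerProductSpace ℝ E]
    {s : ℝ} (hs : 0 ≤ s) (hs1 : s ≤ 1) (a b : E) :
    ‖(1 - s) • a + s • b‖ ^ 2 ≤ (1 - s) * ‖a‖ ^ 2 + s * ‖b‖ ^ 2 := by
  have h : ‖(1 - s) • a + s • b‖ ≤ (1 - s) * ‖a‖ + s * ‖b‖ := by
    refine (norm_add_le _ _).trans (le_of_eq ?_)
    rw [norm_smul, norm_smul, Real.norm_of_nonneg hs, Real.norm_of_nonneg (by linarith)]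
  have h2 : ‖(1 - s) • a + s • b‖ ^ 2 ≤ ((1 - s) * ‖a‖ + s * ‖b‖) ^ 2 := by gcongr
  nlinarith [mul_nonneg (mul_nonneg hs (sub_nonneg.2 hs1)) (sq_nonneg (‖a‖ - ‖b‖))]

theorem norm_add_sq_le_two {E : Type*} [NormedAddCommGroup E] (a b : E) :
    ‖a + b‖ ^ 2 ≤ 2 * ‖a‖ ^ 2 + 2 * ‖b‖ ^ 2 := by
  have h2 : ‖a + b‖ ^ 2 ≤ (‖a‖ + ‖b‖) ^ 2 := by gcongr; exact norm_add_le a b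
  nlinarith [sq_nonneg (‖a‖ - ‖b‖)]

theorem spread_smul_sub {n : ℕ} (v w : Fin N → Vec n) (c : ℝ) (i : Fin N) :
    (v i - c • w i) - avg (fun i => v i - c • w i) = (v i - avg v) + (-c) • (w i - avg w) := by
  rw [avg_sub, avg_smul]
  module

/-- Young's inequality with parameter `(1 - ρ) / ρ` has weights `1 / ρ` and `1 / (1 - ρ)`. One
factor `ρ` of `ρ²` is thus spent to separate the update `c w` from `v`, and the other remains as the
contraction. -/
theorem contracted_spread_le {n : ℕ} {ρ : ℝ} (h0 : 0 ≤ ρ) (h1 : ρ < 1) (v w : Fin N → Vec n)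
    (c : ℝ) : ρ ^ 2 * spread (fun i => v i - c • w i) ≤
      ρ * spread v + ρ ^ 2 / (1 - ρ) * (c ^ 2 * spread w) := by
  rcases h0.eq_or_lt with rfl | hρ
  · simp
  have h1' : 0 < 1 - ρ := by linarith
  have key : ∀ i, ‖(v i - c • w i) - avg (fun i => v i - c • w i)‖ ^ 2 ≤
      1 / ρ * ‖v i - avg v‖ ^ 2 + 1 / (1 - ρ) * (c ^ 2 * ‖w i - avg w‖ ^ 2) := by
    intro i
    rw [spread_smul_sub]
    refine (norm_add_sq_le_young (s := (1 - ρ) / ρ) (by positivity) _ _).trans (le_of_eq ?_)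
    rw [norm_smul, mul_pow, norm_neg, Real.norm_eq_abs, sq_abs]
    congr 2 <;> field_simp <;> ring
  have : spread (fun i => v i - c • w i) ≤
      1 / ρ * spread v + 1 / (1 - ρ) * (c ^ 2 * spread w) := by
    simp only [spread, Finset.mul_sum, ← Finset.sum_add_distrib]
    exact Finset.sum_le_sum fun i _ => by simpa [Finset.mul_sum] using key i
  calc _ ≤ ρ ^ 2 * (1 / ρ * spread v + 1 / (1 - ρ) * (c ^ 2 * spread w)) := by gcongr
    _ = _ := by field_simp

variable {W : Matrix (Fin N) (Fin N) ℝ} {ρ : ℝ}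

theorem avg_mix (hW : Mixing W ρ) {n : ℕ} (v : Fin N → Vec n) :
    avg (fun i => ∑ j, W i j • v j) = avg v := by
  simp only [avg]
  congr 1
  rw [Finset.sum_comm]
  refine Finset.sum_congr rfl fun j _ => ?_
  rw [← Finset.sum_smul]
  have := congrFun hW.col_sum j
  simp only [Matrix.vecMul, dotProduct, Pi.one_apply, one_mul] at this
  rw [this, one_smul]

theorem vec_norm_sq {n : ℕ} (v : Vec n) : ‖v‖ ^ 2 = ∑ k, v k ^ 2 := by
  rw [EuclideanSpace.norm_sq_eq]
  simp

/-- The deviations from the average sum to zero and the rows of `W` sum to one, so on each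
coordinate of the deviations `W` acts as `W - 𝟙𝟙ᵀ/N`, whose operator norm is `ρ`. -/
theorem spread_mix_le (hN : 1 ≤ N) (hW : Mixing W ρ) {n : ℕ} (v : Fin N → Vec n) :
    spread (fun i => ∑ j, W i j • v j) ≤ ρ ^ 2 * spread v := by
  have hN0 : (N : ℝ) ≠ 0 := by positivity
  simp only [spread, avg_mix hW, vec_norm_sq]
  rw [Finset.sum_comm, Finset.sum_comm (s := Finset.univ (α := Fin N)), Finset.mul_sum]
  refine Finset.sum_le_sum fun k _ => ?_
  set m := avg v k with hm
  let w : Vec N := WithLp.toLp 2 fun i => v i k - m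
  set A := W - (N : ℝ)⁻¹ • Matrix.vecMulVec 1 1 with hA
  have hsum : ∑ j, (v j k - m) = 0 := by
    have h1 := congrArg (fun u : Vec n => u k) (sum_eq_card_smul_avg hN v)
    simp only [WithLp.ofLp_sum, Finset.sum_apply, PiLp.smul_apply, smul_eq_mul] at h1
    rw [Finset.sum_sub_distrib, h1]
    simp [m]
  have hAw : ∀ i, (Matrix.toEuclideanCLM (n := Fin N) (𝕜 := ℝ) A w) i =
      (∑ j, W i j • v j) k - m := by
    intro i
    have hrow := congrFun hW.row_sum i
    simp only [Matrix.mulVec, dotProduct, Pi.one_apply, mul_one] at hrow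
    have h0 : (Matrix.toEuclideanCLM (n := Fin N) (𝕜 := ℝ) A w) i
        = ∑ j, A i j * (v j k - m) := by
      simp [w, Matrix.mulVec, dotProduct]
    rw [h0]
    simp only [hA, Matrix.sub_apply, Matrix.smul_apply, Matrix.vecMulVec_apply, Pi.one_apply,
      mul_one, smul_eq_mul, sub_mul, Finset.sum_sub_distrib, ← Finset.mul_sum, hsum]
    simp [mul_sub, Finset.sum_sub_distrib, ← Finset.sum_mul, hrow]
  have h := (Matrix.toEuclideanCLM (n := Fin N) (𝕜 := ℝ) A).le_opNorm w
  have hr : ‖Matrix.toEuclideanCLM (n := Fin N) (𝕜 := ℝ) A‖ = ρ := hW.rate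
  rw [hr] at h
  have h2 := pow_le_pow_left₀ (norm_nonneg _) h 2
  rw [mul_pow, vec_norm_sq, vec_norm_sq] at h2
  simp only [hAw] at h2
  simpa [w] using h2

end Averages

end DSOBA

end

noncomputable section

namespace DSOBA

/-! ### Partial gradients and Hessian blocks as blocks of the joint derivatives -/

section Blocks

variable {d p : ℕ}

/-- The space of concatenated vectors `(x, y)`. -/
abbrev Joint (d p : ℕ) : Type := EuclideanSpace ℝ (Fin d ⊕ Fin p)

/-- The first block of a concatenated vector. -/
def fstL : Joint d p →L[ℝ] Vec d :=
  LinearMap.toContinuousLinearMap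
    { toFun := fun u => WithLp.toLp 2 fun i => u (Sum.inl i)
      map_add' := fun _ _ => rfl
      map_smul' := fun _ _ => rfl }

/-- The second block of a concatenated vector. -/
def sndL : Joint d p →L[ℝ] Vec p :=
  LinearMap.toContinuousLinearMap
    { toFun := fun u => WithLp.toLp 2 fun i => u (Sum.inr i)
      map_add' := fun _ _ => rfl
      map_smul' := fun _ _ => rfl }

/-- The embedding `x ↦ (x, 0)`. -/
def inlL : Vec d →L[ℝ] Joint d p :=
  LinearMap.toContinuousLinearMap
    { toFun := fun x => WithLp.toLp 2 (Sum.elim x 0)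
      map_add' := fun x y => by ext i; cases i <;> simp
      map_smul' := fun c x => by ext i; cases i <;> simp }

/-- The embedding `y ↦ (0, y)`. -/
def inrL : Vec p →L[ℝ] Joint d p :=
  LinearMap.toContinuousLinearMap
    { toFun := fun y => WithLp.toLp 2 (Sum.elim 0 y)
      map_add' := fun x y => by ext i; cases i <;> simp
      map_smul' := fun c x => by ext i; cases i <;> simp }

/-- The concatenation `(x, y)`. -/
def pair (x : Vec d) (y : Vec p) : Joint d p := inlL x + inrL y

@[simp] theorem fstL_apply (u : Joint d p) (i : Fin d) : fstL u i = u (Sum.inl i) := rfl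

@[simp] theorem sndL_apply (u : Joint d p) (i : Fin p) : sndL u i = u (Sum.inr i) := rfl

@[simp] theorem inlL_apply (x : Vec d) (i : Fin d ⊕ Fin p) :
    (inlL x : Joint d p) i = Sum.elim x (0 : Fin p → ℝ) i := rfl

@[simp] theorem inrL_apply (y : Vec p) (i : Fin d ⊕ Fin p) :
    (inrL y : Joint d p) i = Sum.elim (0 : Fin d → ℝ) y i := rfl

@[simp] theorem fstL_pair (x : Vec d) (y : Vec p) : fstL (pair x y) = x := by
  ext i; simp [pair]

@[simp] theorem sndL_pair (x : Vec d) (y : Vec p) : sndL (pair x y) = y := by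
  ext i; simp [pair]

theorem pair_sub (x x' : Vec d) (y y' : Vec p) :
    pair x y - pair x' y' = pair (x - x') (y - y') := by
  simp [pair]; abel

theorem norm_sq_joint (u : Joint d p) : ‖u‖ ^ 2 = ‖fstL u‖ ^ 2 + ‖sndL u‖ ^ 2 := by
  simp [EuclideanSpace.norm_sq_eq]

theorem norm_pair_sq (x : Vec d) (y : Vec p) : ‖pair x y‖ ^ 2 = ‖x‖ ^ 2 + ‖y‖ ^ 2 := by
  simp [norm_sq_joint]

theorem inner_fstL (u : Joint d p) (x : Vec d) : inner ℝ (fstL u) x = inner ℝ u (inlL x) := by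
  simp [PiLp.inner_apply]

theorem inner_sndL (u : Joint d p) (y : Vec p) : inner ℝ (sndL u) y = inner ℝ u (inrL y) := by
  simp [PiLp.inner_apply]

theorem norm_fstL_le (u : Joint d p) : ‖fstL u‖ ≤ ‖u‖ := by
  refine le_of_sq_le_sq ?_ (norm_nonneg _)
  rw [norm_sq_joint]; nlinarith [sq_nonneg ‖sndL u‖]

theorem norm_sndL_le (u : Joint d p) : ‖sndL u‖ ≤ ‖u‖ := by
  refine le_of_sq_le_sq ?_ (norm_nonneg _)
  rw [norm_sq_joint]; nlinarith [sq_nonneg ‖fstL u‖]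

theorem norm_inlL (x : Vec d) : ‖(inlL x : Joint d p)‖ = ‖x‖ := by
  refine (sq_eq_sq₀ (norm_nonneg _) (norm_nonneg _)).1 ?_
  have : (inlL x : Joint d p) = pair x 0 := by simp [pair]
  rw [this, norm_pair_sq]; simp

theorem norm_inrL (y : Vec p) : ‖(inrL y : Joint d p)‖ = ‖y‖ := by
  refine (sq_eq_sq₀ (norm_nonneg _) (norm_nonneg _)).1 ?_
  have : (inrL y : Joint d p) = pair 0 y := by simp [pair]
  rw [this, norm_pair_sq]; simp

theorem hasFDerivAt_pair_left (x : Vec d) (y : Vec p) :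
    HasFDerivAt (fun x' : Vec d => pair x' y) (inlL : Vec d →L[ℝ] Joint d p) x :=
  (inlL.hasFDerivAt).add_const _

theorem hasFDerivAt_pair_right (x : Vec d) (y : Vec p) :
    HasFDerivAt (fun y' : Vec p => pair x y') (inrL : Vec p →L[ℝ] Joint d p) y :=
  (inrL.hasFDerivAt).const_add _

theorem joint_pair (φ : Vec d → Vec p → ℝ) (x : Vec d) (y : Vec p) :
    joint φ (pair x y) = φ x y := by
  change φ (fstL (pair x y)) (sndL (pair x y)) = _
  simp

/-- Chain rule along `x' ↦ (x', y)`: the projection `fstL` is the adjoint of the embedding `inlL`,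
so it carries the joint gradient to the partial one. -/
theorem hasGradientAt_left {φ : Vec d → Vec p → ℝ} (h : Differentiable ℝ (joint φ))
    (x : Vec d) (y : Vec p) :
    HasGradientAt (fun x' => φ x' y) (fstL (gradient (joint φ) (pair x y))) x := by
  rw [hasGradientAt_iff_hasFDerivAt]
  have h1 := ((h (pair x y)).hasGradientAt.hasFDerivAt).comp x (hasFDerivAt_pair_left x y)
  have h2 : (joint φ ∘ fun x' => pair x' y) = fun x' => φ x' y := by
    ext x'; simp [joint_pair]
  rw [h2] at h1
  have h3 : InnerProductSpace.toDual ℝ (Vec d) (fstL (gradient (joint φ) (pair x y))) =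
      (InnerProductSpace.toDual ℝ (Joint d p) (gradient (joint φ) (pair x y))) ∘L inlL := by
    ext v : 1
    simp only [InnerProductSpace.toDual_apply_apply, ContinuousLinearMap.comp_apply, inner_fstL]
  rw [h3]
  exact h1

theorem hasGradientAt_right {φ : Vec d → Vec p → ℝ} (h : Differentiable ℝ (joint φ))
    (x : Vec d) (y : Vec p) :
    HasGradientAt (fun y' => φ x y') (sndL (gradient (joint φ) (pair x y))) y := by
  rw [hasGradientAt_iff_hasFDerivAt]
  have h1 := ((h (pair x y)).hasGradientAt.hasFDerivAt).comp y (hasFDerivAt_pair_right x y)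
  have h2 : (joint φ ∘ fun y' => pair x y') = fun y' => φ x y' := by
    ext x'; simp [joint_pair]
  rw [h2] at h1
  have h3 : InnerProductSpace.toDual ℝ (Vec p) (sndL (gradient (joint φ) (pair x y))) =
      (InnerProductSpace.toDual ℝ (Joint d p) (gradient (joint φ) (pair x y))) ∘L inrL := by
    ext v : 1
    simp only [InnerProductSpace.toDual_apply_apply, ContinuousLinearMap.comp_apply, inner_sndL]
  rw [h3]
  exact h1

theorem grad1_eq {φ : Vec d → Vec p → ℝ} (h : Differentiable ℝ (joint φ)) (x : Vec d)
    (y : Vec p) : grad1 φ x y = fstL (gradient (joint φ) (pair x y)) :=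
  (hasGradientAt_left h x y).gradient

theorem grad2_eq {φ : Vec d → Vec p → ℝ} (h : Differentiable ℝ (joint φ)) (x : Vec d)
    (y : Vec p) : grad2 φ x y = sndL (gradient (joint φ) (pair x y)) :=
  (hasGradientAt_right h x y).gradient

theorem hasFDerivAt_grad1 {φ : Vec d → Vec p → ℝ} (h : Differentiable ℝ (joint φ))
    (h2 : Differentiable ℝ (gradient (joint φ))) (x : Vec d) (y : Vec p) :
    HasFDerivAt (fun y' => grad1 φ x y')
      (fstL ∘L fderiv ℝ (gradient (joint φ)) (pair x y) ∘L inrL) y := by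
  simp only [grad1_eq h]
  exact fstL.hasFDerivAt.comp y
    ((h2 (pair x y)).hasFDerivAt.comp y (hasFDerivAt_pair_right x y))

theorem hasFDerivAt_grad2 {φ : Vec d → Vec p → ℝ} (h : Differentiable ℝ (joint φ))
    (h2 : Differentiable ℝ (gradient (joint φ))) (x : Vec d) (y : Vec p) :
    HasFDerivAt (fun y' => grad2 φ x y')
      (sndL ∘L fderiv ℝ (gradient (joint φ)) (pair x y) ∘L inrL) y := by
  simp only [grad2_eq h]
  exact sndL.hasFDerivAt.comp y
    ((h2 (pair x y)).hasFDerivAt.comp y (hasFDerivAt_pair_right x y))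

theorem hess12_eq {φ : Vec d → Vec p → ℝ} (h : Differentiable ℝ (joint φ))
    (h2 : Differentiable ℝ (gradient (joint φ))) (x : Vec d) (y : Vec p) :
    hess12 φ x y = fstL ∘L fderiv ℝ (gradient (joint φ)) (pair x y) ∘L inrL :=
  (hasFDerivAt_grad1 h h2 x y).fderiv

theorem hess22_eq {φ : Vec d → Vec p → ℝ} (h : Differentiable ℝ (joint φ))
    (h2 : Differentiable ℝ (gradient (joint φ))) (x : Vec d) (y : Vec p) :
    hess22 φ x y = sndL ∘L fderiv ℝ (gradient (joint φ)) (pair x y) ∘L inrL :=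
  (hasFDerivAt_grad2 h h2 x y).fderiv

end Blocks

/-! ### Taylor bounds and symmetry of the Hessian -/

section Taylor

variable {E F : Type*} [NormedAddCommGroup E] [NormedSpace ℝ E] [NormedAddCommGroup F]
  [NormedSpace ℝ F]

/-- Mean value inequality on the segment, where `f'` stays within `C * ‖v - u‖` of `f' u`. This
costs a factor 2 against the sharp constant but needs no integral. -/
theorem norm_taylor_le {f : E → F} {f' : E → E →L[ℝ] F} {C : ℝ}
    (hf : ∀ u, HasFDerivAt f (f' u) u) (hC : 0 ≤ C) (hlip : ∀ u v, ‖f' u - f' v‖ ≤ C * ‖u - v‖)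
    (u v : E) : ‖f v - f u - f' u (v - u)‖ ≤ C * ‖v - u‖ ^ 2 := by
  have h := (convex_segment u v).norm_image_sub_le_of_norm_hasFDerivWithin_le'
    (f := f) (f' := f') (φ := f' u) (C := C * ‖v - u‖) (x := u) (y := v)
    (fun w _ => (hf w).hasFDerivWithinAt)
    (fun w hw => by
      refine (hlip w u).trans ?_
      gcongr
      exact norm_sub_le_of_mem_segment hw)
    (left_mem_segment ℝ u v) (right_mem_segment ℝ u v)
  rw [sq, ← mul_assoc]
  exact h

theorem norm_fderiv_le_of_lip {f : E → F} {C : ℝ} (hC : 0 ≤ C)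
    (hlip : ∀ u v, ‖f u - f v‖ ≤ C * ‖u - v‖) (u : E) : ‖fderiv ℝ f u‖ ≤ C :=
  norm_fderiv_le_of_lip' ℝ hC (Filter.Eventually.of_forall fun v => hlip v u)

end Taylor

/-- `φ` is continuously differentiable, with an `ℓ`-Lipschitz gradient. -/
structure LipGrad {d p : ℕ} (φ : Vec d → Vec p → ℝ) (ℓ : ℝ) : Prop where
  nonneg : 0 ≤ ℓ
  diff : Differentiable ℝ (joint φ)
  lip : ∀ u v, ‖gradient (joint φ) u - gradient (joint φ) v‖ ≤ ℓ * ‖u - v‖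

/-- `φ` is twice continuously differentiable, with an `ℓ`-Lipschitz gradient and Hessian. -/
structure LipHess {d p : ℕ} (φ : Vec d → Vec p → ℝ) (ℓ : ℝ) : Prop extends LipGrad φ ℓ where
  diff_grad : Differentiable ℝ (gradient (joint φ))
  lip_hess : ∀ u v,
    ‖fderiv ℝ (gradient (joint φ)) u - fderiv ℝ (gradient (joint φ)) v‖ ≤ ℓ * ‖u - v‖

section Bounds

variable {d p : ℕ} {φ : Vec d → Vec p → ℝ} {ℓ : ℝ}

/-- The Euclidean distance of `(x, y)` and `(x', y')`. -/
def pdist (x : Vec d) (y : Vec p) (x' : Vec d) (y' : Vec p) : ℝ := ‖pair x y - pair x' y'‖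

theorem pdist_sq (x : Vec d) (y : Vec p) (x' : Vec d) (y' : Vec p) :
    pdist x y x' y' ^ 2 = ‖x - x'‖ ^ 2 + ‖y - y'‖ ^ 2 := by
  rw [pdist, pair_sub, norm_pair_sq]

theorem pdist_nonneg (x : Vec d) (y : Vec p) (x' : Vec d) (y' : Vec p) : 0 ≤ pdist x y x' y' :=
  norm_nonneg _

theorem pdist_left (x x' : Vec d) (y : Vec p) : pdist x y x' y = ‖x - x'‖ := by
  rw [pdist, pair_sub, sub_self]; simp only [pair, map_zero, add_zero, norm_inlL]

theorem pdist_right (x : Vec d) (y y' : Vec p) : pdist x y x y' = ‖y - y'‖ := by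
  rw [pdist, pair_sub, sub_self]; simp only [pair, map_zero, zero_add, norm_inrL]

theorem LipGrad.grad1_sub_le (h : LipGrad φ ℓ) (x : Vec d) (y : Vec p) (x' : Vec d) (y' : Vec p) :
    ‖grad1 φ x y - grad1 φ x' y'‖ ≤ ℓ * pdist x y x' y' := by
  rw [grad1_eq h.diff, grad1_eq h.diff, ← map_sub]
  exact (norm_fstL_le _).trans (h.lip _ _)

theorem LipGrad.grad2_sub_le (h : LipGrad φ ℓ) (x : Vec d) (y : Vec p) (x' : Vec d) (y' : Vec p) :
    ‖grad2 φ x y - grad2 φ x' y'‖ ≤ ℓ * pdist x y x' y' := by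
  rw [grad2_eq h.diff, grad2_eq h.diff, ← map_sub]
  exact (norm_sndL_le _).trans (h.lip _ _)

theorem norm_fst_comp_inr_le (T : Joint d p →L[ℝ] Joint d p) : ‖fstL ∘L T ∘L inrL‖ ≤ ‖T‖ :=
  ContinuousLinearMap.opNorm_le_bound _ (norm_nonneg _) fun v =>
    (norm_fstL_le _).trans ((T.le_opNorm _).trans (by rw [ContinuousLinearMap.coe_coe, norm_inrL]))

theorem norm_snd_comp_inr_le (T : Joint d p →L[ℝ] Joint d p) : ‖sndL ∘L T ∘L inrL‖ ≤ ‖T‖ :=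
  ContinuousLinearMap.opNorm_le_bound _ (norm_nonneg _) fun v =>
    (norm_sndL_le _).trans ((T.le_opNorm _).trans (by rw [ContinuousLinearMap.coe_coe, norm_inrL]))

theorem LipHess.hess12_sub_le (h : LipHess φ ℓ) (x : Vec d) (y : Vec p) (x' : Vec d)
    (y' : Vec p) : ‖hess12 φ x y - hess12 φ x' y'‖ ≤ ℓ * pdist x y x' y' := by
  rw [hess12_eq h.diff h.diff_grad, hess12_eq h.diff h.diff_grad, ← ContinuousLinearMap.comp_sub,
    ← ContinuousLinearMap.sub_comp]
  exact (norm_fst_comp_inr_le _).trans (h.lip_hess _ _)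

theorem LipHess.hess22_sub_le (h : LipHess φ ℓ) (x : Vec d) (y : Vec p) (x' : Vec d)
    (y' : Vec p) : ‖hess22 φ x y - hess22 φ x' y'‖ ≤ ℓ * pdist x y x' y' := by
  rw [hess22_eq h.diff h.diff_grad, hess22_eq h.diff h.diff_grad, ← ContinuousLinearMap.comp_sub,
    ← ContinuousLinearMap.sub_comp]
  exact (norm_snd_comp_inr_le _).trans (h.lip_hess _ _)

theorem LipHess.norm_hess12_le (h : LipHess φ ℓ) (x : Vec d) (y : Vec p) :
    ‖hess12 φ x y‖ ≤ ℓ := by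
  rw [hess12_eq h.diff h.diff_grad]
  exact (norm_fst_comp_inr_le _).trans (norm_fderiv_le_of_lip h.nonneg h.lip _)

theorem LipHess.norm_hess22_le (h : LipHess φ ℓ) (x : Vec d) (y : Vec p) :
    ‖hess22 φ x y‖ ≤ ℓ := by
  rw [hess22_eq h.diff h.diff_grad]
  exact (norm_snd_comp_inr_le _).trans (norm_fderiv_le_of_lip h.nonneg h.lip _)

theorem LipGrad.taylor (h : LipGrad φ ℓ) (u v : Joint d p) :
    |joint φ v - joint φ u - inner ℝ (gradient (joint φ) u) (v - u)| ≤ ℓ * ‖v - u‖ ^ 2 := by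
  refine norm_taylor_le (f := joint φ)
    (f' := fun u => InnerProductSpace.toDual ℝ _ (gradient (joint φ) u))
    (fun u => (h.diff u).hasGradientAt.hasFDerivAt) h.nonneg (fun u v => ?_) u v
  rw [← map_sub, LinearIsometryEquiv.norm_map]
  exact h.lip u v

theorem LipHess.taylor_grad (h : LipHess φ ℓ) (u v : Joint d p) :
    ‖gradient (joint φ) v - gradient (joint φ) u - fderiv ℝ (gradient (joint φ)) u (v - u)‖
      ≤ ℓ * ‖v - u‖ ^ 2 :=
  norm_taylor_le (fun u => (h.diff_grad u).hasFDerivAt) h.nonneg h.lip_hess u v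

/-- The Riesz isomorphism turns the derivative of the gradient into the second derivative, which is
symmetric. This is what allows `phi_taylor` to move the Hessian from an increment onto z⋆. -/
theorem LipHess.hess_symm (h : LipHess φ ℓ) (u v w : Joint d p) :
    inner ℝ (fderiv ℝ (gradient (joint φ)) u v) w
      = inner ℝ (fderiv ℝ (gradient (joint φ)) u w) v := by
  let D : Joint d p →L[ℝ] (Joint d p →L[ℝ] ℝ) :=
    (InnerProductSpace.toDual ℝ (Joint d p)).toContinuousLinearEquiv.toContinuousLinearMap
  have h1 : ∀ u, HasFDerivAt (joint φ) (D (gradient (joint φ) u)) u :=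
    fun u => (h.diff u).hasGradientAt.hasFDerivAt
  have h2 : HasFDerivAt (fun u => D (gradient (joint φ) u))
      (D ∘L fderiv ℝ (gradient (joint φ)) u) u :=
    D.hasFDerivAt.comp u (h.diff_grad u).hasFDerivAt
  have := second_derivative_symmetric h1 h2 v w
  simpa [D] using this

end Bounds

end DSOBA

end

noncomputable section

namespace DSOBA

/-! ### Derivatives of the averaged losses -/

section AverageLoss

variable {N d p : ℕ} {ℓ : ℝ}

/-- The average of the node losses. -/
def avgFun (φ : Fin N → Vec d → Vec p → ℝ) : Vec d → Vec p → ℝ := fun x y => avg fun i => φ i x y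

theorem hasGradientAt_avgFun {φ : Fin N → Vec d → Vec p → ℝ}
    (h : ∀ i, Differentiable ℝ (joint (φ i))) (u : Joint d p) :
    HasGradientAt (joint (avgFun φ)) (avg fun i => gradient (joint (φ i)) u) u := by
  rw [hasGradientAt_iff_hasFDerivAt]
  have h1 : HasFDerivAt (fun u => ∑ i, joint (φ i) u)
      (∑ i, InnerProductSpace.toDual ℝ (Joint d p) (gradient (joint (φ i)) u)) u :=
    HasFDerivAt.fun_sum fun i _ => (h i u).hasGradientAt.hasFDerivAt
  have h2 := h1.const_smul (N : ℝ)⁻¹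
  have h3 : InnerProductSpace.toDual ℝ (Joint d p) (avg fun i => gradient (joint (φ i)) u) =
      (N : ℝ)⁻¹ • ∑ i, InnerProductSpace.toDual ℝ (Joint d p) (gradient (joint (φ i)) u) := by
    simp [avg, map_sum]
  rw [h3]
  exact h2

theorem gradient_avgFun {φ : Fin N → Vec d → Vec p → ℝ}
    (h : ∀ i, Differentiable ℝ (joint (φ i))) :
    gradient (joint (avgFun φ)) = fun u => avg fun i => gradient (joint (φ i)) u :=
  gradient_eq (hasGradientAt_avgFun h)

theorem norm_avg_sub_le {E : Type*} [NormedAddCommGroup E] [NormedSpace ℝ E] (hN : 1 ≤ N)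
    {v w : Fin N → E} {C : ℝ} (h : ∀ i, ‖v i - w i‖ ≤ C) : ‖avg v - avg w‖ ≤ C := by
  rw [← avg_sub]
  refine (norm_avg_le _).trans ((avg_mono h).trans ?_)
  rw [avg_const hN]

theorem lipGrad_avgFun (hN : 1 ≤ N) {φ : Fin N → Vec d → Vec p → ℝ}
    (h : ∀ i, LipGrad (φ i) ℓ) : LipGrad (avgFun φ) ℓ where
  nonneg := (h ⟨0, hN⟩).nonneg
  diff := fun u => (hasGradientAt_avgFun (fun i => (h i).diff) u).differentiableAt
  lip := fun u v => by
    rw [gradient_avgFun fun i => (h i).diff]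
    exact norm_avg_sub_le hN fun i => (h i).lip u v

theorem hasFDerivAt_gradient_avgFun {φ : Fin N → Vec d → Vec p → ℝ}
    (h : ∀ i, LipHess (φ i) ℓ) (u : Joint d p) :
    HasFDerivAt (gradient (joint (avgFun φ)))
      (avg fun i => fderiv ℝ (gradient (joint (φ i))) u) u := by
  rw [gradient_avgFun fun i => (h i).diff]
  have h1 : HasFDerivAt (fun u => ∑ i, gradient (joint (φ i)) u)
      (∑ i, fderiv ℝ (gradient (joint (φ i))) u) u :=
    HasFDerivAt.fun_sum fun i _ => ((h i).diff_grad u).hasFDerivAt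
  exact h1.const_smul (N : ℝ)⁻¹

theorem lipHess_avgFun (hN : 1 ≤ N) {φ : Fin N → Vec d → Vec p → ℝ}
    (h : ∀ i, LipHess (φ i) ℓ) : LipHess (avgFun φ) ℓ where
  toLipGrad := lipGrad_avgFun hN fun i => (h i).toLipGrad
  diff_grad := fun u => (hasFDerivAt_gradient_avgFun h u).differentiableAt
  lip_hess := fun u v => by
    rw [(hasFDerivAt_gradient_avgFun h u).fderiv, (hasFDerivAt_gradient_avgFun h v).fderiv]
    exact norm_avg_sub_le hN fun i => (h i).lip_hess u v

theorem grad1_avgFun (hN : 1 ≤ N) {φ : Fin N → Vec d → Vec p → ℝ} (h : ∀ i, LipGrad (φ i) ℓ)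
    (x : Vec d) (y : Vec p) : grad1 (avgFun φ) x y = avg fun i => grad1 (φ i) x y := by
  rw [grad1_eq (lipGrad_avgFun hN h).diff, gradient_avgFun fun i => (h i).diff]
  simp only [fun i => grad1_eq (h i).diff x y]
  exact avg_map (fstL : Joint d p →L[ℝ] Vec d).toLinearMap _

theorem grad2_avgFun (hN : 1 ≤ N) {φ : Fin N → Vec d → Vec p → ℝ} (h : ∀ i, LipGrad (φ i) ℓ)
    (x : Vec d) (y : Vec p) : grad2 (avgFun φ) x y = avg fun i => grad2 (φ i) x y := by
  rw [grad2_eq (lipGrad_avgFun hN h).diff, gradient_avgFun fun i => (h i).diff]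
  simp only [fun i => grad2_eq (h i).diff x y]
  exact avg_map (sndL : Joint d p →L[ℝ] Vec p).toLinearMap _

theorem hess12_avgFun (hN : 1 ≤ N) {φ : Fin N → Vec d → Vec p → ℝ} (h : ∀ i, LipHess (φ i) ℓ)
    (x : Vec d) (y : Vec p) (z : Vec p) :
    hess12 (avgFun φ) x y z = avg fun i => hess12 (φ i) x y z := by
  have h' := lipHess_avgFun hN h
  rw [hess12_eq h'.diff h'.diff_grad, (hasFDerivAt_gradient_avgFun h _).fderiv]
  simp only [fun i => hess12_eq (h i).diff (h i).diff_grad x y]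
  simp [avg, map_sum]

theorem hess22_avgFun (hN : 1 ≤ N) {φ : Fin N → Vec d → Vec p → ℝ} (h : ∀ i, LipHess (φ i) ℓ)
    (x : Vec d) (y : Vec p) (z : Vec p) :
    hess22 (avgFun φ) x y z = avg fun i => hess22 (φ i) x y z := by
  have h' := lipHess_avgFun hN h
  rw [hess22_eq h'.diff h'.diff_grad, (hasFDerivAt_gradient_avgFun h _).fderiv]
  simp only [fun i => hess22_eq (h i).diff (h i).diff_grad x y]
  simp [avg, map_sum]

end AverageLoss

/-! ### First- and second-order consequences of strong convexity -/

section StrongConvexity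

variable {d p : ℕ} {φ : Vec d → Vec p → ℝ} {m : ℝ}

/-- On the segment, `φ x - m/2 ‖·‖²` is a convex function of one variable, whose slope at `0` is at
most its secant slope over `[0, 1]`. -/
theorem strongConvex_first_order (h : Differentiable ℝ (joint φ)) {x : Vec d}
    (hc : StrongConvexOn Set.univ m (φ x)) (y y' : Vec p) :
    φ x y + inner ℝ (grad2 φ x y) (y' - y) + m / 2 * ‖y' - y‖ ^ 2 ≤ φ x y' := by
  have hk := strongConvexOn_iff_convex.1 hc
  have hk1 := hk.comp_affineMap (AffineMap.lineMap y y')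
  simp only [Set.preimage_univ] at hk1
  have hγ : HasDerivAt (fun t : ℝ => AffineMap.lineMap y y' t) (y' - y) 0 :=
    AffineMap.hasDerivAt_lineMap
  have hφ : HasFDerivAt (φ x) (InnerProductSpace.toDual ℝ _ (grad2 φ x y))
      (AffineMap.lineMap y y' (0 : ℝ)) := by
    rw [AffineMap.lineMap_apply_zero, grad2_eq h]
    exact (hasGradientAt_right h x y).hasFDerivAt
  have hd := (hφ.comp_hasDerivAt (0 : ℝ) hγ).sub ((hγ.norm_sq).const_mul (m / 2))
  have hs := hk1.le_slope_of_hasDerivAt (Set.mem_univ 0) (Set.mem_univ 1) zero_lt_one hd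
  simp only [InnerProductSpace.toDual_apply_apply, AffineMap.lineMap_apply_zero, slope_def_field,
    Function.comp_apply, AffineMap.lineMap_apply_one, sub_zero, div_one] at hs
  have h3 : ‖y'‖ ^ 2 = ‖y‖ ^ 2 + 2 * inner ℝ y (y' - y) + ‖y' - y‖ ^ 2 := by
    rw [← norm_add_sq_real]; congr 2; abel
  rw [h3] at hs
  linarith

theorem strongConvex_mono (h : Differentiable ℝ (joint φ)) {x : Vec d}
    (hc : StrongConvexOn Set.univ m (φ x)) (y y' : Vec p) :
    m * ‖y - y'‖ ^ 2 ≤ inner ℝ (grad2 φ x y - grad2 φ x y') (y - y') := by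
  have h1 := strongConvex_first_order h hc y y'
  have h2 := strongConvex_first_order h hc y' y
  rw [inner_sub_left]
  have h3 : y' - y = -(y - y') := by abel
  rw [h3, inner_neg_right, norm_neg] at h1
  linarith

/-- Divide strong monotonicity between `y + t v` and `y` by `t²` and let `t` decrease to `0`. -/
theorem strongConvex_hess (h : Differentiable ℝ (joint φ))
    (h2 : Differentiable ℝ (gradient (joint φ))) {x : Vec d}
    (hc : StrongConvexOn Set.univ m (φ x)) (y v : Vec p) :
    m * ‖v‖ ^ 2 ≤ inner ℝ (hess22 φ x y v) v := by
  have hγ : HasDerivAt (fun t : ℝ => y + t • v) v 0 := by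
    simpa using ((hasDerivAt_id (0 : ℝ)).smul_const v).const_add y
  have hg : HasFDerivAt (fun y => grad2 φ x y) (hess22 φ x y) (y + (0 : ℝ) • v) := by
    rw [hess22_eq h h2]; simpa using hasFDerivAt_grad2 h h2 x y
  have hd := (hg.comp_hasDerivAt (0 : ℝ) hγ).inner ℝ (hasDerivAt_const (0 : ℝ) v)
  simp only [inner_zero_right, zero_add] at hd
  refine ge_of_tendsto hd.tendsto_slope_zero_right ?_
  filter_upwards [self_mem_nhdsWithin] with t ht
  have ht' : 0 < t := ht
  have hm := strongConvex_mono h hc (y + t • v) y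
  rw [add_sub_cancel_left, inner_smul_right, norm_smul, mul_pow, Real.norm_eq_abs, sq_abs,
    inner_sub_left] at hm
  simp only [Function.comp_apply, zero_add, zero_smul, add_zero, smul_eq_mul]
  rw [inv_mul_eq_div, le_div_iff₀ ht']
  nlinarith

end StrongConvexity

/-- The regularity of the node losses: gradients and Hessians are `L`-Lipschitz, the lower-level
losses are `L / κ`-strongly convex, and `‖∇₂f(x, y⋆(x))‖ ≤ L`. -/
structure Regular {N d p : ℕ} {Ξ Z : Type*} [MeasurableSpace Ξ] [MeasurableSpace Z]
    (P : Problem N d p Ξ Z) (L κ : ℝ) : Prop where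
  nodes : 1 ≤ N
  L_pos : 0 < L
  one_le_κ : 1 ≤ κ
  f : ∀ i, LipGrad (P.f i) L
  g : ∀ i, LipHess (P.g i) L
  bound : ∀ x, ‖grad2 P.fbar x (P.ystar x)‖ ≤ L
  convex : ∀ i x, StrongConvexOn Set.univ (L / κ) (P.g i x)

/-! ### The maps y⋆ and z⋆ and the gradient of Φ -/

namespace Regular

variable {N d p : ℕ} {Ξ Z : Type*} [MeasurableSpace Ξ] [MeasurableSpace Z]
    {P : Problem N d p Ξ Z} {L κ : ℝ}

theorem κ_pos (h : Regular P L κ) : 0 < κ := by linarith [h.one_le_κ]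

theorem μ_pos (h : Regular P L κ) : 0 < L / κ := div_pos h.L_pos h.κ_pos

theorem fbar (h : Regular P L κ) : LipGrad P.fbar L := lipGrad_avgFun h.nodes h.f

theorem gbar (h : Regular P L κ) : LipHess P.gbar L := lipHess_avgFun h.nodes h.g

theorem grad1_fbar (h : Regular P L κ) (x : Vec d) (y : Vec p) :
    grad1 P.fbar x y = avg fun i => grad1 (P.f i) x y := grad1_avgFun h.nodes h.f x y

theorem grad2_fbar (h : Regular P L κ) (x : Vec d) (y : Vec p) :
    grad2 P.fbar x y = avg fun i => grad2 (P.f i) x y := grad2_avgFun h.nodes h.f x y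

theorem grad2_gbar (h : Regular P L κ) (x : Vec d) (y : Vec p) :
    grad2 P.gbar x y = avg fun i => grad2 (P.g i) x y :=
  grad2_avgFun h.nodes (fun i => (h.g i).toLipGrad) x y

theorem hess12_gbar (h : Regular P L κ) (x : Vec d) (y z : Vec p) :
    hess12 P.gbar x y z = avg fun i => hess12 (P.g i) x y z := hess12_avgFun h.nodes h.g x y z

theorem hess22_gbar (h : Regular P L κ) (x : Vec d) (y z : Vec p) :
    hess22 P.gbar x y z = avg fun i => hess22 (P.g i) x y z := hess22_avgFun h.nodes h.g x y z

theorem gbar_convex (h : Regular P L κ) (x : Vec d) :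
    StrongConvexOn Set.univ (L / κ) (P.gbar x) := by
  refine ⟨convex_univ, fun y _ y' _ a b ha hb hab => ?_⟩
  have h1 := avg_mono fun i => (h.convex i x).2 (Set.mem_univ y) (Set.mem_univ y') ha hb hab
  refine h1.trans (le_of_eq ?_)
  simp only [smul_eq_mul]
  rw [avg_sub, avg_const h.nodes, avg_add]
  have := avg_smul a fun i => P.g i x y
  have := avg_smul b fun i => P.g i x y'
  simp_all [Problem.gbar]

theorem gbar_mono (h : Regular P L κ) (x : Vec d) (y y' : Vec p) :
    L / κ * ‖y - y'‖ ^ 2 ≤ inner ℝ (grad2 P.gbar x y - grad2 P.gbar x y') (y - y') :=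
  strongConvex_mono h.gbar.diff (h.gbar_convex x) y y'

/-- Quadratic growth: outside the ball of radius `2‖v‖ / (L / κ)` the quadratic term of the
first-order bound at `0` beats the linear one. Hence `ystar`, defined by choice, really is a
minimizer. -/
theorem exists_minimizer (h : Regular P L κ) (x : Vec d) :
    ∃ y, IsMinOn (P.gbar x) Set.univ y := by
  have hc : Continuous (P.gbar x) := by
    refine continuous_iff_continuousAt.2 fun y => ?_
    exact (hasGradientAt_right h.gbar.diff x y).continuousAt
  have hμ := h.μ_pos
  set v := grad2 P.gbar x 0 with hv
  obtain ⟨y, hy⟩ := hc.exists_forall_le' (0 : Vec p) (by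
    have hcomp := (isCompact_closedBall (0 : Vec p) (2 * ‖v‖ / (L / κ))).compl_mem_cocompact
    filter_upwards [hcomp] with y hy
    simp only [Set.mem_compl_iff, Metric.mem_closedBall, dist_zero_right, not_le] at hy
    have h1 := strongConvex_first_order h.gbar.diff (h.gbar_convex x) 0 y
    rw [sub_zero, ← hv] at h1
    have h2 := (abs_le.1 (abs_real_inner_le_norm v y)).1
    rw [div_lt_iff₀ hμ] at hy
    nlinarith [norm_nonneg y])
  exact ⟨y, fun y' _ => hy y'⟩

theorem ystar_isMinOn (h : Regular P L κ) (x : Vec d) :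
    IsMinOn (P.gbar x) Set.univ (P.ystar x) :=
  Classical.epsilon_spec (h.exists_minimizer x)

theorem grad2_ystar (h : Regular P L κ) (x : Vec d) : grad2 P.gbar x (P.ystar x) = 0 := by
  have h1 := ((h.ystar_isMinOn x).isLocalMin Filter.univ_mem).hasFDerivAt_eq_zero
    (hasGradientAt_right h.gbar.diff x (P.ystar x)).hasFDerivAt
  rw [← grad2_eq h.gbar.diff] at h1
  simpa using h1

theorem ystar_lip (h : Regular P L κ) (x x' : Vec d) :
    ‖P.ystar x - P.ystar x'‖ ≤ κ * ‖x - x'‖ := by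
  set y := P.ystar x with hy
  set y' := P.ystar x' with hy'
  have h1 := h.gbar_mono x y y'
  -- The zero gradient at `(x, y)` is traded for the zero gradient at `(x', y')`, so that the two
  -- remaining gradients share the second argument `y'` and differ by at most `L * ‖x - x'‖`.
  rw [h.grad2_ystar x, ← h.grad2_ystar x'] at h1
  have h2 := h1.trans (real_inner_le_norm _ _)
  have h3 := h.gbar.grad2_sub_le x' y' x y'
  rw [pdist_left, norm_sub_rev x' x] at h3
  have h4 : L / κ * ‖y - y'‖ ^ 2 ≤ L * ‖x - x'‖ * ‖y - y'‖ :=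
    h2.trans (by gcongr)
  rcases (norm_nonneg (y - y')).eq_or_lt with h0 | h0
  · rw [← h0]; have := h.κ_pos; positivity
  · have h5 : L / κ * ‖y - y'‖ ≤ L * ‖x - x'‖ := by
      refine le_of_mul_le_mul_right ?_ h0
      calc _ = L / κ * ‖y - y'‖ ^ 2 := by ring
        _ ≤ _ := h4
    rw [div_mul_eq_mul_div, div_le_iff₀ h.κ_pos] at h5
    refine le_of_mul_le_mul_left ?_ h.L_pos
    linarith

theorem pdist_ystar_le (h : Regular P L κ) (x x' : Vec d) :
    pdist x (P.ystar x) x' (P.ystar x') ≤ 3 / 2 * κ * ‖x - x'‖ := by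
  have hκ := h.one_le_κ
  refine le_of_sq_le_sq ?_ (by positivity)
  rw [pdist_sq]
  have h1 := pow_le_pow_left₀ (norm_nonneg _) (h.ystar_lip x x') 2
  rw [mul_pow] at h1
  have h2 : (1 : ℝ) ≤ κ ^ 2 := one_le_pow₀ hκ
  have h3 : ‖x - x'‖ ^ 2 ≤ κ ^ 2 * ‖x - x'‖ ^ 2 := le_mul_of_one_le_left (by positivity) h2
  nlinarith

theorem hess22_coercive (h : Regular P L κ) (x : Vec d) (y v : Vec p) :
    L / κ * ‖v‖ ≤ ‖hess22 P.gbar x y v‖ := by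
  have h1 := strongConvex_hess h.gbar.diff h.gbar.diff_grad (h.gbar_convex x) y v
  have h2 := h1.trans (real_inner_le_norm _ _)
  rcases (norm_nonneg v).eq_or_lt with h0 | h0
  · rw [← h0]; simp
  · refine le_of_mul_le_mul_right ?_ h0
    calc _ = L / κ * ‖v‖ ^ 2 := by ring
      _ ≤ _ := h2

/-- Coercivity makes the Hessian injective, hence invertible in finite dimension; the operator
inverse in the definition of z⋆ is therefore a true inverse and not the default value `0`. -/
theorem hess22_zstar (h : Regular P L κ) (x : Vec d) :
    hess22 P.gbar x (P.ystar x) (P.zstar x) = grad2 P.fbar x (P.ystar x) := by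
  set H := hess22 P.gbar x (P.ystar x) with hH
  have hinj : Function.Injective H.toLinearMap := by
    rw [← LinearMap.ker_eq_bot, LinearMap.ker_eq_bot']
    intro v hv
    have h1 := h.hess22_coercive x (P.ystar x) v
    have h2 : H v = 0 := hv
    rw [← hH, h2, norm_zero] at h1
    have := h.μ_pos
    exact norm_le_zero_iff.1 (by nlinarith [norm_nonneg v])
  let e : Vec p ≃L[ℝ] Vec p := (LinearEquiv.ofInjectiveEndo H.toLinearMap hinj).toContinuousLinearEquiv
  have he : H = (e : Vec p →L[ℝ] Vec p) := by ext v; rfl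
  rw [Problem.zstar, ← hH, he, ContinuousLinearMap.inverse_equiv]
  simp

theorem norm_zstar_le (h : Regular P L κ) (x : Vec d) : ‖P.zstar x‖ ≤ κ := by
  have h1 := h.hess22_coercive x (P.ystar x) (P.zstar x)
  rw [h.hess22_zstar] at h1
  have h2 := h1.trans (h.bound x)
  rw [div_mul_eq_mul_div, div_le_iff₀ h.κ_pos] at h2
  exact le_of_mul_le_mul_left h2 h.L_pos

/-- Subtract the two linear systems: `H (z - z') = (b - b') - (H - H') z'`. Of the three powers of
`κ`, one comes from inverting `H`, one from `‖z'‖ ≤ κ` and one from the Lipschitz constant of `x ↦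
(x, y⋆(x))`. -/
theorem zstar_lip (h : Regular P L κ) (x x' : Vec d) :
    ‖P.zstar x - P.zstar x'‖ ≤ 3 * κ ^ 3 * ‖x - x'‖ := by
  have hκ := h.one_le_κ
  have hL := h.L_pos
  set y := P.ystar x with hy
  set y' := P.ystar x' with hy'
  set D := pdist x y x' y' with hD
  have h1 := h.hess22_coercive x y (P.zstar x - P.zstar x')
  have h2 : hess22 P.gbar x y (P.zstar x - P.zstar x') =
      (grad2 P.fbar x y - grad2 P.fbar x' y') -
        (hess22 P.gbar x y - hess22 P.gbar x' y') (P.zstar x') := by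
    rw [map_sub, h.hess22_zstar, sub_apply, h.hess22_zstar]
    abel
  have h3 : ‖hess22 P.gbar x y (P.zstar x - P.zstar x')‖ ≤ L * D + L * D * κ := by
    rw [h2]
    refine (norm_sub_le _ _).trans (add_le_add (h.fbar.grad2_sub_le x y x' y') ?_)
    refine (ContinuousLinearMap.le_opNorm _ _).trans ?_
    have := pdist_nonneg x y x' y'
    exact mul_le_mul (h.gbar.hess22_sub_le x y x' y') (h.norm_zstar_le x') (norm_nonneg _)
      (by positivity)
  have h4 : D ≤ 3 / 2 * κ * ‖x - x'‖ := h.pdist_ystar_le x x'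
  have h5 : L / κ * ‖P.zstar x - P.zstar x'‖ ≤ L * (1 + κ) * (3 / 2 * κ * ‖x - x'‖) := by
    calc _ ≤ L * (1 + κ) * D := by linarith
      _ ≤ _ := by gcongr
  rw [div_mul_eq_mul_div, div_le_iff₀ h.κ_pos] at h5
  refine le_of_mul_le_mul_left ?_ hL
  calc _ ≤ _ := h5
    _ = L * (3 / 2 * κ ^ 2 * (1 + κ) * ‖x - x'‖) := by ring
    _ ≤ L * (3 / 2 * κ ^ 2 * (κ + κ) * ‖x - x'‖) := by gcongr
    _ = _ := by ring

/-- The hypergradient `∇₁f(x, y⋆) - ∇²₁₂g(x, y⋆) z⋆`. -/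
def hyperGrad (P : Problem N d p Ξ Z) (x : Vec d) : Vec d :=
  grad1 P.fbar x (P.ystar x) - hess12 P.gbar x (P.ystar x) (P.zstar x)

/-- Expand `f` and `∇g` at `u = (x, y⋆(x))` towards `u' = (x', y⋆(x'))`. As `∇₂g` vanishes at both
points, the second block of `T (u' - u)` is minus the second block of the Taylor remainder `e`.
Pairing with z⋆ and using the symmetry of `T` expresses `⟨∇₂f, y' - y⟩` through `x' - x` and `e`, so
y⋆ need not be differentiated. -/
theorem phi_taylor (h : Regular P L κ) (x x' : Vec d) :
    |P.Phi x' - P.Phi x - inner ℝ (hyperGrad P x) (x' - x)| ≤ 5 * L * κ ^ 3 * ‖x' - x‖ ^ 2 := by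
  have hκ := h.one_le_κ
  have hL := h.L_pos
  set y := P.ystar x with hy
  set y' := P.ystar x' with hy'
  set z := P.zstar x with hz
  set u := pair x y with hu
  set u' := pair x' y' with hu'
  set T := fderiv ℝ (gradient (joint P.gbar)) u with hT
  set e := gradient (joint P.gbar) u' - gradient (joint P.gbar) u - T (u' - u) with he
  have hΔ : u' - u = inlL (x' - x) + inrL (y' - y) := pair_sub _ _ _ _
  have hf := h.fbar.taylor u u'
  have hg : ‖e‖ ≤ L * ‖u' - u‖ ^ 2 := h.gbar.taylor_grad u u'
  have h1 : inner ℝ (gradient (joint P.fbar) u) (u' - u) =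
      inner ℝ (grad1 P.fbar x y) (x' - x) + inner ℝ (grad2 P.fbar x y) (y' - y) := by
    rw [hΔ, inner_add_right, grad1_eq h.fbar.diff, grad2_eq h.fbar.diff, inner_fstL, inner_sndL]
  have h2 : inner ℝ (grad2 P.fbar x y) (y' - y) =
      - inner ℝ (sndL e) z - inner ℝ (hess12 P.gbar x y z) (x' - x) := by
    have hs : sndL (T (u' - u)) = - sndL e := by
      have e1 : sndL (gradient (joint P.gbar) u) = 0 := by
        rw [← h.grad2_ystar x, grad2_eq h.gbar.diff]
      have e2 : sndL (gradient (joint P.gbar) u') = 0 := by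
        rw [← h.grad2_ystar x', grad2_eq h.gbar.diff]
      have e3 : T (u' - u) = gradient (joint P.gbar) u' - gradient (joint P.gbar) u - e := by
        rw [he]; abel
      simp only [e3, map_sub sndL, e1, e2, sub_zero, zero_sub]
    have h3 : inner ℝ (sndL (T (u' - u))) z =
        inner ℝ (hess12 P.gbar x y z) (x' - x) + inner ℝ (grad2 P.fbar x y) (y' - y) := by
      rw [inner_sndL, h.gbar.hess_symm, hΔ, inner_add_right, ← h.hess22_zstar x,
        hess12_eq h.gbar.diff h.gbar.diff_grad, hess22_eq h.gbar.diff h.gbar.diff_grad]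
      simp only [ContinuousLinearMap.comp_apply, inner_fstL, inner_sndL]
      rfl
    rw [hs, inner_neg_left] at h3
    linarith
  have h4 : P.Phi x' - P.Phi x - inner ℝ (hyperGrad P x) (x' - x) =
      (joint P.fbar u' - joint P.fbar u - inner ℝ (gradient (joint P.fbar) u) (u' - u))
        - inner ℝ (sndL e) z := by
    rw [h1, h2, joint_pair, joint_pair, hyperGrad, inner_sub_left, Problem.Phi, Problem.Phi]
    ring
  have h5 : |inner ℝ (sndL e) z| ≤ L * ‖u' - u‖ ^ 2 * κ := by
    refine (abs_real_inner_le_norm _ _).trans ?_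
    exact mul_le_mul ((norm_sndL_le e).trans hg) (h.norm_zstar_le x) (norm_nonneg _)
      (by positivity)
  have h6 : ‖u' - u‖ ≤ 3 / 2 * κ * ‖x' - x‖ := h.pdist_ystar_le x' x
  have h7 : ‖u' - u‖ ^ 2 ≤ 9 / 4 * κ ^ 2 * ‖x' - x‖ ^ 2 := by
    calc _ ≤ (3 / 2 * κ * ‖x' - x‖) ^ 2 := by gcongr
      _ = _ := by ring
  rw [h4]
  refine (abs_sub _ _).trans ?_
  calc _ ≤ L * ‖u' - u‖ ^ 2 + L * ‖u' - u‖ ^ 2 * κ := add_le_add hf h5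
    _ = L * (1 + κ) * ‖u' - u‖ ^ 2 := by ring
    _ ≤ L * (κ + κ) * (9 / 4 * κ ^ 2 * ‖x' - x‖ ^ 2) := by gcongr
    _ = 9 / 2 * (L * κ ^ 3 * ‖x' - x‖ ^ 2) := by ring
    _ ≤ 5 * (L * κ ^ 3 * ‖x' - x‖ ^ 2) := by gcongr; norm_num
    _ = _ := by ring

theorem hasGradientAt_phi (h : Regular P L κ) (x : Vec d) :
    HasGradientAt P.Phi (hyperGrad P x) x := by
  rw [hasGradientAt_iff_isLittleO]
  have hb : (fun x' => P.Phi x' - P.Phi x - inner ℝ (hyperGrad P x) (x' - x))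
      =O[nhds x] fun x' => ‖x' - x‖ ^ 2 := by
    refine Asymptotics.IsBigO.of_bound (5 * L * κ ^ 3) (Filter.Eventually.of_forall fun x' => ?_)
    rw [Real.norm_eq_abs, Real.norm_of_nonneg (by positivity)]
    exact h.phi_taylor x x'
  exact hb.trans_isLittleO (Asymptotics.isLittleO_pow_sub_sub x one_lt_two)

theorem gradient_phi (h : Regular P L κ) (x : Vec d) : gradient P.Phi x = hyperGrad P x :=
  (h.hasGradientAt_phi x).gradient

theorem hyperGrad_lip (h : Regular P L κ) (x x' : Vec d) :
    ‖hyperGrad P x - hyperGrad P x'‖ ≤ 6 * L * κ ^ 3 * ‖x - x'‖ := by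
  have hκ := h.one_le_κ
  have hL := h.L_pos
  set y := P.ystar x with hy
  set y' := P.ystar x' with hy'
  set D := pdist x y x' y' with hD
  have hD0 : 0 ≤ D := pdist_nonneg _ _ _ _
  have h2 : hyperGrad P x - hyperGrad P x' =
      (grad1 P.fbar x y - grad1 P.fbar x' y') - (hess12 P.gbar x y (P.zstar x - P.zstar x')
        + (hess12 P.gbar x y - hess12 P.gbar x' y') (P.zstar x')) := by
    rw [map_sub, sub_apply, hyperGrad, hyperGrad]
    abel
  have h3 : ‖hess12 P.gbar x y (P.zstar x - P.zstar x')‖ ≤ L * (3 * κ ^ 3 * ‖x - x'‖) := by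
    refine (ContinuousLinearMap.le_opNorm _ _).trans ?_
    exact mul_le_mul (h.gbar.norm_hess12_le x y) (h.zstar_lip x x') (norm_nonneg _) hL.le
  have h4 : ‖(hess12 P.gbar x y - hess12 P.gbar x' y') (P.zstar x')‖ ≤ L * D * κ := by
    refine (ContinuousLinearMap.le_opNorm _ _).trans ?_
    exact mul_le_mul (h.gbar.hess12_sub_le x y x' y') (h.norm_zstar_le x') (norm_nonneg _)
      (by positivity)
  have h5 : D ≤ 3 / 2 * κ * ‖x - x'‖ := h.pdist_ystar_le x x'
  rw [h2]
  calc _ ≤ L * D + (L * (3 * κ ^ 3 * ‖x - x'‖) + L * D * κ) :=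
        (norm_sub_le _ _).trans (add_le_add (h.fbar.grad1_sub_le x y x' y')
          ((norm_add_le _ _).trans (add_le_add h3 h4)))
    _ = L * (1 + κ) * D + 3 * L * κ ^ 3 * ‖x - x'‖ := by ring
    _ ≤ L * (κ + κ) * (3 / 2 * κ * ‖x - x'‖) + 3 * L * κ ^ 3 * ‖x - x'‖ := by gcongr
    _ = 3 * L * κ ^ 2 * ‖x - x'‖ + 3 * L * κ ^ 3 * ‖x - x'‖ := by ring
    _ ≤ 3 * L * κ ^ 3 * ‖x - x'‖ + 3 * L * κ ^ 3 * ‖x - x'‖ := by gcongr; norm_num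
    _ = _ := by ring

end Regular

/-- Along a unit vector of `ℝᵖ`, which exists because `1 ≤ p`, the gradient of a node loss changes
by at least `μ` and by at most `Lgradg`. -/
theorem Smooth.condNumber_ge_one {N d p : ℕ} {Ξ Z : Type*} [MeasurableSpace Ξ]
    [MeasurableSpace Z] {P : Problem N d p Ξ Z} {Lf Lgradf Lgradg Lhessg μ L : ℝ}
    (h : Smooth P Lf Lgradf Lgradg Lhessg μ) (hN : 1 ≤ N) (hp : 1 ≤ p) (hμ : 0 < μ)
    (hL : max (max Lf Lgradf) (max Lgradg Lhessg) = L) : 1 ≤ L / μ := by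
  rw [le_div_iff₀ hμ, one_mul]
  let i : Fin N := ⟨0, hN⟩
  let v : Vec p := EuclideanSpace.single ⟨0, hp⟩ 1
  have hv : ‖v‖ = 1 := by simp [v]
  have h1 := strongConvex_mono (h.diff_g i) (h.strong_convex i 0) v 0
  have h2 := h1.trans (real_inner_le_norm _ _)
  have h3 : ‖grad2 (P.g i) 0 v - grad2 (P.g i) 0 0‖ ≤ Lgradg := by
    rw [grad2_eq (h.diff_g i), grad2_eq (h.diff_g i), ← map_sub]
    refine (norm_sndL_le _).trans ((h.lip_grad_g i _ _).trans (le_of_eq ?_))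
    have : ‖pair (0 : Vec d) v - pair 0 0‖ = 1 := by
      have := pdist_right (0 : Vec d) v 0
      rw [sub_zero, hv] at this
      exact this
    rw [this, mul_one]
  rw [sub_zero, hv] at h2
  have h4 : Lgradg ≤ L := hL ▸ (le_max_left _ _).trans (le_max_right _ _)
  linarith

theorem Smooth.regular {N d p : ℕ} {Ξ Z : Type*} [MeasurableSpace Ξ] [MeasurableSpace Z]
    {P : Problem N d p Ξ Z} {Lf Lgradf Lgradg Lhessg μ L : ℝ}
    (h : Smooth P Lf Lgradf Lgradg Lhessg μ) (hN : 1 ≤ N) (hp : 1 ≤ p) (hμ : 0 < μ)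
    (hL0 : 0 < L) (hL : max (max Lf Lgradf) (max Lgradg Lhessg) = L) : Regular P L (L / μ) := by
  have h1 : Lf ≤ L := hL ▸ (le_max_left _ _).trans (le_max_left _ _)
  have h2 : Lgradf ≤ L := hL ▸ (le_max_right _ _).trans (le_max_left _ _)
  have h3 : Lgradg ≤ L := hL ▸ (le_max_left _ _).trans (le_max_right _ _)
  have h4 : Lhessg ≤ L := hL ▸ (le_max_right _ _).trans (le_max_right _ _)
  have hf : ∀ i, LipGrad (P.f i) L := fun i => ⟨hL0.le, h.diff_f i, fun u v =>
    (h.lip_grad_f i u v).trans (by gcongr)⟩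
  refine ⟨hN, hL0, h.condNumber_ge_one hN hp hμ hL, hf, fun i => ⟨⟨hL0.le, h.diff_g i,
    fun u v => (h.lip_grad_g i u v).trans (by gcongr)⟩, h.diff_grad_g i,
    fun u v => (h.lip_hess_g i u v).trans (by gcongr)⟩, fun x => ?_, fun i x => ?_⟩
  · have := grad2_avgFun hN hf x (P.ystar x)
    change ‖grad2 (avgFun P.f) x (P.ystar x)‖ ≤ L
    rw [this]
    refine (norm_avg_le _).trans ((avg_mono fun i => (h.bound_f i x).trans h1).trans ?_)
    rw [avg_const hN]
  · rw [div_div_cancel₀ hL0.ne']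
    exact h.strong_convex i x

end DSOBA

end

noncomputable section

namespace DSOBA

/-- Under the distribution `D`, the random vector `V` has mean `m` and variance at most `s`. -/
structure Oracle {S E : Type*} [MeasurableSpace S] [NormedAddCommGroup E] [NormedSpace ℝ E]
    (D : Measure S) (V : S → E) (m : E) (s : ℝ) : Prop where
  memLp : MemLp V 2 D
  mean : ∫ a, V a ∂D = m
  var : ∫ a, ‖V a - m‖ ^ 2 ∂D ≤ s

/-! ### Variance of independent noises over the nodes -/

section Noise

variable {S : Type*} [MeasurableSpace S] {n N : ℕ}

theorem integral_norm_add_smul_sq {D : Measure S} [IsProbabilityMeasure D] {V : S → Vec n}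
    (hV : MemLp V 2 D) (h0 : ∫ a, V a ∂D = 0) (A : Vec n) (c : ℝ) :
    Integrable (fun a => ‖A + c • V a‖ ^ 2) D ∧
      ∫ a, ‖A + c • V a‖ ^ 2 ∂D = ‖A‖ ^ 2 + c ^ 2 * ∫ a, ‖V a‖ ^ 2 ∂D := by
  have hi : Integrable V D := hV.integrable (by norm_num)
  have h2 : Integrable (fun a => ‖V a‖ ^ 2) D := hV.integrable_norm_pow (by norm_num)
  have h3 : Integrable (fun a => inner ℝ A (V a)) D := hi.const_inner A
  have he : ∀ a, ‖A + c • V a‖ ^ 2 =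
      ‖A‖ ^ 2 + 2 * c * inner ℝ A (V a) + c ^ 2 * ‖V a‖ ^ 2 := by
    intro a
    rw [norm_add_sq_real, inner_smul_right, norm_smul, mul_pow, Real.norm_eq_abs, sq_abs]
    ring
  have hi1 : Integrable (fun a => ‖A‖ ^ 2 + 2 * c * inner ℝ A (V a)) D :=
    (integrable_const _).add (h3.const_mul _)
  simp only [he]
  refine ⟨hi1.add (h2.const_mul _), ?_⟩
  rw [integral_add hi1 (h2.const_mul _), integral_add (integrable_const _) (h3.const_mul _),
    integral_const_mul, integral_const_mul, integral_inner hi, h0]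
  simp

theorem Oracle.centered {D : Measure S} [IsProbabilityMeasure D] {V : S → Vec n} {m : Vec n}
    {s : ℝ} (h : Oracle D V m s) : ∫ a, (V a - m) ∂D = 0 := by
  rw [integral_sub (h.memLp.integrable (by norm_num)) (integrable_const _), h.mean]
  simp

variable {Q : Fin N → Measure S} [∀ j, IsProbabilityMeasure (Q j)]
  {V : Fin N → S → Vec n} {m : Fin N → Vec n} {s : Fin N → ℝ}

theorem memLp_eval (h : ∀ j, Oracle (Q j) (V j) (m j) (s j)) (j : Fin N) :
    MemLp (fun w : Fin N → S => V j (w j) - m j) 2 (Measure.pi Q) :=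
  ((h j).memLp.sub (memLp_const _)).comp_measurePreserving (measurePreserving_eval Q j)

theorem integral_eval {E : Type*} [NormedAddCommGroup E] [NormedSpace ℝ E] (j : Fin N)
    {f : S → E} (hf : AEStronglyMeasurable f (Q j)) :
    ∫ w, f (w j) ∂(Measure.pi Q) = ∫ a, f a ∂(Q j) := by
  have hp := measurePreserving_eval Q j
  rw [← hp.map_eq] at hf
  have := integral_map hp.measurable.aemeasurable hf
  rw [hp.map_eq] at this
  exact this.symm

theorem integral_noise_eval (h : ∀ j, Oracle (Q j) (V j) (m j) (s j)) (j : Fin N) :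
    ∫ w, (V j (w j) - m j) ∂(Measure.pi Q) = 0 := by
  rw [integral_eval (Q := Q) j (f := fun a => V j a - m j)
    ((h j).memLp.sub (memLp_const _)).aestronglyMeasurable]
  exact (h j).centered

theorem integral_noise_sq_eval_le (h : ∀ j, Oracle (Q j) (V j) (m j) (s j)) (j : Fin N) :
    ∫ w, ‖V j (w j) - m j‖ ^ 2 ∂(Measure.pi Q) ≤ s j := by
  rw [integral_eval (Q := Q) j (f := fun a => ‖V j a - m j‖ ^ 2)
    (((h j).memLp.sub (memLp_const _)).aestronglyMeasurable.norm.pow 2)]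
  exact (h j).var

/-- The variance of a sum of independent noises is the sum of the variances. -/
theorem integral_norm_sum_noise_sq_le (h : ∀ j, Oracle (Q j) (V j) (m j) (s j)) :
    ∫ w, ‖∑ j, (V j (w j) - m j)‖ ^ 2 ∂(Measure.pi Q) ≤ ∑ j, s j := by
  have hc : ∀ (k : Fin n) (j : Fin N), MemLp (fun a => (V j a - m j) k) 2 (Q j) := fun k j =>
    (EuclideanSpace.proj (𝕜 := ℝ) k).comp_memLp' ((h j).memLp.sub (memLp_const _))
  have hc0 : ∀ (k : Fin n) (j : Fin N), ∫ a, (V j a - m j) k ∂(Q j) = 0 := by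
    intro k j
    have := ContinuousLinearMap.integral_comp_comm (EuclideanSpace.proj (𝕜 := ℝ) k)
      (((h j).memLp.sub (memLp_const (m j))).integrable (by norm_num))
    refine Eq.trans this ?_
    simp only [Pi.sub_apply, (h j).centered, map_zero]
  have hce : ∀ (k : Fin n) (j : Fin N),
      MemLp (fun w : Fin N → S => (V j (w j) - m j) k) 2 (Measure.pi Q) := fun k j =>
    (hc k j).comp_measurePreserving (measurePreserving_eval Q j)
  -- In each coordinate the variances of independent real variables add; the squared norm is
  -- recovered by summing over the coordinates.
  have hk : ∀ k : Fin n, ∫ w, (∑ j, (V j (w j) - m j) k) ^ 2 ∂(Measure.pi Q) =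
      ∑ j, ∫ a, ((V j a - m j) k) ^ 2 ∂(Q j) := by
    intro k
    have hv := variance_sum_pi (hc k)
    have hs : (∑ j, fun w : Fin N → S => (V j (w j) - m j) k) =
        fun w => ∑ j, (V j (w j) - m j) k := by ext w; simp
    rw [hs, variance_of_integral_eq_zero] at hv
    · rw [hv]
      refine Finset.sum_congr rfl fun j _ => ?_
      rw [variance_of_integral_eq_zero (hc k j).aestronglyMeasurable.aemeasurable (hc0 k j)]
    · exact (memLp_finsetSum _ fun j _ => hce k j).aestronglyMeasurable.aemeasurable
    · rw [integral_finsetSum _ fun j _ => (hce k j).integrable (by norm_num)]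
      refine Finset.sum_eq_zero fun j _ => ?_
      rw [integral_eval (Q := Q) j (f := fun a => (V j a - m j) k)
        (hc k j).aestronglyMeasurable, hc0]
  have h1 : ∀ w : Fin N → S, ‖∑ j, (V j (w j) - m j)‖ ^ 2 =
      ∑ k, (∑ j, (V j (w j) - m j) k) ^ 2 := by
    intro w
    rw [vec_norm_sq]
    simp
  simp only [h1]
  rw [integral_finsetSum _ fun k _ => (memLp_finsetSum _ fun j _ => hce k j).integrable_sq]
  simp only [hk]
  rw [Finset.sum_comm]
  refine Finset.sum_le_sum fun j _ => ?_
  rw [← integral_finsetSum _ fun k _ => (hc k j).integrable_sq]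
  refine (le_of_eq ?_).trans (h j).var
  simp only [vec_norm_sq]

/-- The cross term vanishes and independent noises add, so the noise of the average is `(c / N)² ∑ s
= c² / N * avg s`. This factor `1 / N` produces the linear speedup. -/
theorem integral_avg_noise (h : ∀ j, Oracle (Q j) (V j) (m j) (s j)) (A : Vec n) (c : ℝ) :
    Integrable (fun w => ‖A - c • avg fun j => V j (w j)‖ ^ 2) (Measure.pi Q) ∧
      ∫ w, ‖A - c • avg fun j => V j (w j)‖ ^ 2 ∂(Measure.pi Q)
        ≤ ‖A - c • avg m‖ ^ 2 + c ^ 2 / N * avg s := by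
  have he : ∀ w : Fin N → S, A - c • avg (fun j => V j (w j)) =
      (A - c • avg m) + (-(c / N)) • ∑ j, (V j (w j) - m j) := by
    intro w
    simp only [avg, Finset.sum_sub_distrib]
    module
  simp only [he]
  obtain ⟨h1, h2⟩ := integral_norm_add_smul_sq (D := Measure.pi Q)
    (V := fun w => ∑ j, (V j (w j) - m j)) (memLp_finsetSum _ fun j _ => memLp_eval h j)
    (by
      rw [integral_finsetSum _ fun j _ => (memLp_eval h j).integrable (by norm_num)]
      exact Finset.sum_eq_zero fun j _ => integral_noise_eval h j)
    (A - c • avg m) (-(c / N))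
  refine ⟨h1, h2.trans_le ?_⟩
  have h3 := integral_norm_sum_noise_sq_le h
  have h4 : c ^ 2 / N * avg s = (-(c / N)) ^ 2 * ∑ j, s j := by
    simp only [avg, smul_eq_mul]; ring
  rw [h4]
  gcongr

/-- Same expansion for the deviations. Subtracting the average noise only decreases the total, but
without a gain of `1 / N`: the deviations keep the full local noise. -/
theorem integral_spread_noise (hN : 1 ≤ N) (h : ∀ j, Oracle (Q j) (V j) (m j) (s j))
    (Y : Fin N → Vec n) (c : ℝ) :
    Integrable (fun w => spread fun j => Y j - c • V j (w j)) (Measure.pi Q) ∧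
      ∫ w, (spread fun j => Y j - c • V j (w j)) ∂(Measure.pi Q)
        ≤ (spread fun j => Y j - c • m j) + c ^ 2 * ∑ j, s j := by
  have he : ∀ (w : Fin N → S) (i : Fin N),
      (Y i - c • V i (w i)) - avg (fun j => Y j - c • V j (w j)) =
      ((Y i - c • m i) - avg fun j => Y j - c • m j) +
        (-c) • ((V i (w i) - m i) - avg fun j => V j (w j) - m j) := by
    intro w i
    simp only [avg_sub, avg_smul]
    module
  have hm : ∀ i, MemLp (fun w : Fin N → S =>
      (V i (w i) - m i) - avg fun j => V j (w j) - m j) 2 (Measure.pi Q) := by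
    intro i
    have hs : MemLp (fun w : Fin N → S => avg fun j => V j (w j) - m j) 2 (Measure.pi Q) :=
      (memLp_finsetSum Finset.univ fun j _ => memLp_eval h j).const_smul (N : ℝ)⁻¹
    exact (memLp_eval h i).sub hs
  have h0 : ∀ i, ∫ w, ((V i (w i) - m i) - avg fun j => V j (w j) - m j) ∂(Measure.pi Q) = 0 := by
    intro i
    have hs : MemLp (fun w : Fin N → S => avg fun j => V j (w j) - m j) 2 (Measure.pi Q) :=
      (memLp_finsetSum Finset.univ fun j _ => memLp_eval h j).const_smul (N : ℝ)⁻¹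
    rw [integral_sub ((memLp_eval h i).integrable (by norm_num))
      (hs.integrable (by norm_num)), integral_noise_eval h]
    simp only [avg]
    rw [integral_smul, integral_finsetSum _ fun j _ => (memLp_eval h j).integrable (by norm_num),
      Finset.sum_eq_zero fun j _ => integral_noise_eval h j]
    simp
  have hi := fun i => integral_norm_add_smul_sq (hm i) (h0 i)
    ((Y i - c • m i) - avg fun j => Y j - c • m j) (-c)
  simp only [spread, he]
  refine ⟨integrable_finsetSum _ fun i _ => (hi i).1, ?_⟩
  rw [integral_finsetSum _ fun i _ => (hi i).1]
  simp only [fun i => (hi i).2, Finset.sum_add_distrib, ← Finset.mul_sum, neg_sq]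
  refine add_le_add le_rfl (mul_le_mul_of_nonneg_left ?_ (sq_nonneg c))
  have hn2 : ∀ i, Integrable (fun w : Fin N → S => ‖V i (w i) - m i‖ ^ 2) (Measure.pi Q) :=
    fun i => (memLp_eval h i).integrable_norm_pow (by norm_num)
  rw [← integral_finsetSum _ fun i _ => (hm i).integrable_norm_pow (by norm_num)]
  calc _ ≤ ∫ w, ∑ i, ‖V i (w i) - m i‖ ^ 2 ∂(Measure.pi Q) := by
        refine integral_mono (integrable_finsetSum _ fun i _ =>
          (hm i).integrable_norm_pow (by norm_num)) (integrable_finsetSum _ fun i _ => hn2 i) ?_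
        intro w
        simpa [spread] using spread_le hN (fun i => V i (w i) - m i) 0
    _ = ∑ i, ∫ w, ‖V i (w i) - m i‖ ^ 2 ∂(Measure.pi Q) := integral_finsetSum _ fun i _ => hn2 i
    _ ≤ _ := Finset.sum_le_sum fun i _ => integral_noise_sq_eval_le h i

/-- The factors 2 come from `‖a - b‖² ≤ 2‖a‖² + 2‖b‖²`; the independence of the two samples is not
exploited, as only the order of the variance matters. -/
theorem Oracle.sub_prod {S' : Type*} [MeasurableSpace S'] {D : Measure S} {D' : Measure S'}
    [IsProbabilityMeasure D] [IsProbabilityMeasure D'] {A : S → Vec n} {B : S' → Vec n}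
    {a b : Vec n} {s t : ℝ} (hA : Oracle D A a s) (hB : Oracle D' B b t) :
    Oracle (D.prod D') (fun w => A w.1 - B w.2) (a - b) (2 * s + 2 * t) := by
  have hf : MeasurePreserving Prod.fst (D.prod D') D := measurePreserving_fst
  have hs : MeasurePreserving Prod.snd (D.prod D') D' := measurePreserving_snd
  have h1 : MemLp (fun w : S × S' => A w.1) 2 (D.prod D') := hA.memLp.comp_measurePreserving hf
  have h2 : MemLp (fun w : S × S' => B w.2) 2 (D.prod D') := hB.memLp.comp_measurePreserving hs
  have ef : ∀ {E : Type _} [NormedAddCommGroup E] [NormedSpace ℝ E] {f : S → E},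
      AEStronglyMeasurable f D → ∫ w, f w.1 ∂(D.prod D') = ∫ x, f x ∂D := by
    intro E _ _ f hm
    have := integral_map (φ := Prod.fst) (μ := D.prod D') measurable_fst.aemeasurable
      (hf.map_eq.symm ▸ hm)
    rw [hf.map_eq] at this
    exact this.symm
  have es : ∀ {E : Type _} [NormedAddCommGroup E] [NormedSpace ℝ E] {f : S' → E},
      AEStronglyMeasurable f D' → ∫ w, f w.2 ∂(D.prod D') = ∫ x, f x ∂D' := by
    intro E _ _ f hm
    have := integral_map (φ := Prod.snd) (μ := D.prod D') measurable_snd.aemeasurable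
      (hs.map_eq.symm ▸ hm)
    rw [hs.map_eq] at this
    exact this.symm
  refine ⟨h1.sub h2, ?_, ?_⟩
  · rw [integral_sub (h1.integrable (by norm_num)) (h2.integrable (by norm_num)),
      ef hA.memLp.aestronglyMeasurable, es hB.memLp.aestronglyMeasurable, hA.mean, hB.mean]
  · have i1 : Integrable (fun w : S × S' => ‖A w.1 - a‖ ^ 2) (D.prod D') :=
      (h1.sub (memLp_const _)).integrable_norm_pow (by norm_num)
    have i2 : Integrable (fun w : S × S' => ‖B w.2 - b‖ ^ 2) (D.prod D') :=
      (h2.sub (memLp_const _)).integrable_norm_pow (by norm_num)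
    have i3 : Integrable (fun w : S × S' => ‖A w.1 - B w.2 - (a - b)‖ ^ 2) (D.prod D') :=
      ((h1.sub h2).sub (memLp_const _)).integrable_norm_pow (by norm_num)
    calc _ ≤ ∫ w, (2 * ‖A w.1 - a‖ ^ 2 + 2 * ‖B w.2 - b‖ ^ 2) ∂(D.prod D') := by
          refine integral_mono i3 ((i1.const_mul 2).add (i2.const_mul 2)) fun w => ?_
          have : A w.1 - B w.2 - (a - b) = (A w.1 - a) + -(B w.2 - b) := by abel
          simp only [this]
          refine (norm_add_sq_le_two _ _).trans ?_
          rw [norm_neg]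
      _ = 2 * ∫ x, ‖A x - a‖ ^ 2 ∂D + 2 * ∫ x, ‖B x - b‖ ^ 2 ∂D' := by
          rw [integral_add (i1.const_mul 2) (i2.const_mul 2), integral_const_mul,
            integral_const_mul]
          rw [ef (f := fun x => ‖A x - a‖ ^ 2)
              ((hA.memLp.sub (memLp_const _)).aestronglyMeasurable.norm.pow 2),
            es (f := fun x => ‖B x - b‖ ^ 2)
              ((hB.memLp.sub (memLp_const _)).aestronglyMeasurable.norm.pow 2)]
      _ ≤ _ := by
          have := hA.var
          have := hB.var
          linarith

end Noise

end DSOBA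

end

noncomputable section

namespace DSOBA

/-! ### Joint measurability of derivatives in the point and the sample -/

section Measurability

/-- The directional derivative is the pointwise limit of difference quotients with step `1 / (n +
1)`, so differentiability for each sample suffices; no continuity of the derivative is needed. -/
theorem measurable_fderiv_param {E F S : Type*} [NormedAddCommGroup E] [NormedSpace ℝ E]
    [MeasurableSpace E] [BorelSpace E] [SecondCountableTopology E] [NormedAddCommGroup F]
    [NormedSpace ℝ F] [MeasurableSpace F] [BorelSpace F] [SecondCountableTopology F]
    [MeasurableSpace S] {f : E → S → F} (hm : Measurable (Function.uncurry f))
    (hd : ∀ s, Differentiable ℝ fun u => f u s) :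
    Measurable fun q : E × E × S => fderiv ℝ (fun u => f u q.2.2) q.1 q.2.1 := by
  refine measurable_of_tendsto_metrizable
    (f := fun (n : ℕ) (q : E × E × S) => ((n : ℝ) + 1) •
      (Function.uncurry f (q.1 + ((n : ℝ) + 1)⁻¹ • q.2.1, q.2.2) -
        Function.uncurry f (q.1, q.2.2))) (fun n => ?_) ?_
  · have h1 : Measurable fun q : E × E × S => (q.1 + ((n : ℝ) + 1)⁻¹ • q.2.1, q.2.2) := by
      fun_prop
    have h2 : Measurable fun q : E × E × S => (q.1, q.2.2) := by fun_prop
    exact ((hm.comp h1).sub (hm.comp h2)).const_smul _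
  · rw [tendsto_pi_nhds]
    intro q
    have hlim : Filter.Tendsto (fun n : ℕ => ‖(n : ℝ) + 1‖) Filter.atTop Filter.atTop := by
      refine Filter.tendsto_atTop_mono (fun n => ?_) tendsto_natCast_atTop_atTop
      rw [Real.norm_of_nonneg (by positivity)]
      linarith
    exact ((hd q.2.2) q.1).hasFDerivAt.lim q.2.1 hlim

variable {S : Type*} [MeasurableSpace S] {d p : ℕ} {φ : Vec d → Vec p → S → ℝ}

theorem measurable_joint (hm : ∀ x y, Measurable (φ x y))
    (hd : ∀ s, Differentiable ℝ (joint fun x y => φ x y s)) :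
    Measurable (Function.uncurry fun (u : Joint d p) s => joint (fun x y => φ x y s) u) :=
  measurable_uncurry_of_continuous_of_measurable (fun s => (hd s).continuous)
    fun u => hm (fstL u) (sndL u)

theorem measurable_gradient (hm : ∀ x y, Measurable (φ x y))
    (hd : ∀ s, Differentiable ℝ (joint fun x y => φ x y s)) :
    Measurable (Function.uncurry fun (u : Joint d p) s =>
      gradient (joint fun x y => φ x y s) u) := by
  have h := measurable_fderiv_param (measurable_joint hm hd) hd
  let b := EuclideanSpace.basisFun (Fin d ⊕ Fin p) ℝ
  have h1 : (Function.uncurry fun (u : Joint d p) s => gradient (joint fun x y => φ x y s) u) =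
      fun q => ∑ i, (fderiv ℝ (joint fun x y => φ x y q.2) q.1 (b i)) • b i := by
    ext1 q
    change gradient (joint fun x y => φ x y q.2) q.1 = _
    refine (b.sum_repr' _).symm.trans (Finset.sum_congr rfl fun i _ => ?_)
    rw [inner_gradient_right]
    simp
  rw [h1]
  refine Finset.measurable_sum _ fun i _ => ?_
  have h2 : Measurable fun q : Joint d p × S => (q.1, b i, q.2) := by fun_prop
  exact (h.comp h2).smul_const _

theorem measurable_hess (hm : ∀ x y, Measurable (φ x y))
    (hd : ∀ s, Differentiable ℝ (joint fun x y => φ x y s))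
    (hd2 : ∀ s, Differentiable ℝ (gradient (joint fun x y => φ x y s))) :
    Measurable fun q : Joint d p × Joint d p × S =>
      fderiv ℝ (gradient (joint fun x y => φ x y q.2.2)) q.1 q.2.1 :=
  measurable_fderiv_param (measurable_gradient hm hd) hd2

theorem measurable_grad1 {A : Type*} [MeasurableSpace A] (hm : ∀ x y, Measurable (φ x y))
    (hd : ∀ s, Differentiable ℝ (joint fun x y => φ x y s)) {x : A → Vec d} {y : A → Vec p}
    {s : A → S} (hx : Measurable x) (hy : Measurable y) (hs : Measurable s) :
    Measurable fun a => grad1 (fun x y => φ x y (s a)) (x a) (y a) := by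
  simp only [fun a => grad1_eq (hd (s a)) (x a) (y a)]
  have h1 : Measurable fun a => (pair (x a) (y a), s a) :=
    (((inlL : Vec d →L[ℝ] Joint d p).measurable.comp hx).add
      ((inrL : Vec p →L[ℝ] Joint d p).measurable.comp hy)).prodMk hs
  exact fstL.measurable.comp ((measurable_gradient hm hd).comp h1)

theorem measurable_grad2 {A : Type*} [MeasurableSpace A] (hm : ∀ x y, Measurable (φ x y))
    (hd : ∀ s, Differentiable ℝ (joint fun x y => φ x y s)) {x : A → Vec d} {y : A → Vec p}
    {s : A → S} (hx : Measurable x) (hy : Measurable y) (hs : Measurable s) :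
    Measurable fun a => grad2 (fun x y => φ x y (s a)) (x a) (y a) := by
  simp only [fun a => grad2_eq (hd (s a)) (x a) (y a)]
  have h1 : Measurable fun a => (pair (x a) (y a), s a) :=
    (((inlL : Vec d →L[ℝ] Joint d p).measurable.comp hx).add
      ((inrL : Vec p →L[ℝ] Joint d p).measurable.comp hy)).prodMk hs
  exact sndL.measurable.comp ((measurable_gradient hm hd).comp h1)

theorem measurable_hess12 {A : Type*} [MeasurableSpace A] (hm : ∀ x y, Measurable (φ x y))
    (hd : ∀ s, Differentiable ℝ (joint fun x y => φ x y s))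
    (hd2 : ∀ s, Differentiable ℝ (gradient (joint fun x y => φ x y s)))
    {x : A → Vec d} {y z : A → Vec p} {s : A → S} (hx : Measurable x) (hy : Measurable y)
    (hz : Measurable z) (hs : Measurable s) :
    Measurable fun a => hess12 (fun x y => φ x y (s a)) (x a) (y a) (z a) := by
  simp only [fun a => hess12_eq (hd (s a)) (hd2 (s a)) (x a) (y a)]
  have h1 : Measurable fun a => (pair (x a) (y a), inrL (z a), s a) :=
    (((inlL : Vec d →L[ℝ] Joint d p).measurable.comp hx).add
      ((inrL : Vec p →L[ℝ] Joint d p).measurable.comp hy)).prodMk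
      (((inrL : Vec p →L[ℝ] Joint d p).measurable.comp hz).prodMk hs)
  exact fstL.measurable.comp ((measurable_hess hm hd hd2).comp h1)

theorem measurable_hess22 {A : Type*} [MeasurableSpace A] (hm : ∀ x y, Measurable (φ x y))
    (hd : ∀ s, Differentiable ℝ (joint fun x y => φ x y s))
    (hd2 : ∀ s, Differentiable ℝ (gradient (joint fun x y => φ x y s)))
    {x : A → Vec d} {y z : A → Vec p} {s : A → S} (hx : Measurable x) (hy : Measurable y)
    (hz : Measurable z) (hs : Measurable s) :
    Measurable fun a => hess22 (fun x y => φ x y (s a)) (x a) (y a) (z a) := by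
  simp only [fun a => hess22_eq (hd (s a)) (hd2 (s a)) (x a) (y a)]
  have h1 : Measurable fun a => (pair (x a) (y a), inrL (z a), s a) :=
    (((inlL : Vec d →L[ℝ] Joint d p).measurable.comp hx).add
      ((inrL : Vec p →L[ℝ] Joint d p).measurable.comp hy)).prodMk
      (((inrL : Vec p →L[ℝ] Joint d p).measurable.comp hz).prodMk hs)
  exact sndL.measurable.comp ((measurable_hess hm hd hd2).comp h1)

end Measurability

/-! ### Mean and variance of increments along a random path -/

section FiniteDifference

variable {S : Type*} [MeasurableSpace S] {n : ℕ}

theorem norm_integral_sq_le {D : Measure S} [IsProbabilityMeasure D] {f : S → Vec n}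
    (hf : MemLp f 2 D) : ‖∫ a, f a ∂D‖ ^ 2 ≤ ∫ a, ‖f a‖ ^ 2 ∂D := by
  have h1 : ‖∫ a, f a ∂D‖ ^ 2 ≤ (∫ a, ‖f a‖ ∂D) ^ 2 := by
    gcongr
    exact norm_integral_le_integral_norm _
  have h2 := variance_nonneg (fun a => ‖f a‖) D
  rw [variance_eq_sub hf.norm] at h2
  simp only [Pi.pow_apply] at h2
  linarith

/-- If a random path is differentiable at every time and its velocity has mean `m s` and variance
at most `v` at every time `s`, then its increment over `[0, 1]` has mean `∫ m` and variance at most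
`v`. -/
theorem oracle_increment {D : Measure S} [IsProbabilityMeasure D] {ψ ψ' : ℝ → S → Vec n}
    {m : ℝ → Vec n} {m₀ : Vec n} {v B : ℝ} (hψ : ∀ s, Measurable (ψ s))
    (hd : ∀ s a, HasDerivAt (fun s => ψ s a) (ψ' s a) s) (hm : Continuous m)
    (ho : ∀ s, Oracle D (ψ' s) (m s) v)
    (hB : ∀ s ∈ Set.Ioc (0 : ℝ) 1, ‖m s - m₀‖ ≤ B) :
    ∃ m', Oracle D (fun a => ψ 1 a - ψ 0 a) m' v ∧ ‖m' - m₀‖ ≤ B := by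
  let I : Measure ℝ := volume.restrict (Set.Ioc 0 1)
  have hI : IsProbabilityMeasure I := ⟨by simp [I]⟩
  have hjm : Measurable (Function.uncurry ψ) :=
    measurable_uncurry_of_continuous_of_measurable
      (fun a => continuous_iff_continuousAt.2 fun s => (hd s a).continuousAt) hψ
  have hjm' : Measurable (Function.uncurry ψ') := by
    have h1 := measurable_fderiv_param hjm fun a s => (hd s a).differentiableAt
    have h2 : Measurable fun q : ℝ × S => (q.1, (1 : ℝ), q.2) := by fun_prop
    have h3 := h1.comp h2
    convert h3 using 1
    ext1 q
    simp [Function.uncurry_def, (hd q.1 q.2).deriv]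
  have hnm : Measurable fun q : ℝ × S => ψ' q.1 q.2 - m q.1 :=
    hjm'.sub (hm.measurable.comp measurable_fst)
  have hsec : ∀ s, Integrable (fun a => ‖ψ' s a - m s‖ ^ 2) D := fun s =>
    ((ho s).memLp.sub (memLp_const _)).integrable_norm_pow (by norm_num)
  have hnsm : StronglyMeasurable fun q : ℝ × S => ‖ψ' q.1 q.2 - m q.1‖ ^ 2 :=
    (hnm.norm.pow_const 2).stronglyMeasurable
  -- The bound on the variance at every time gives square integrability of the centred velocity on
  -- the product space, which is what Fubini requires below.
  have hvar : Integrable (fun s => ∫ a, ‖ψ' s a - m s‖ ^ 2 ∂D) I := by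
    refine (integrable_const v).mono' hnsm.integral_prod_right'.aestronglyMeasurable ?_
    refine Filter.Eventually.of_forall fun s => ?_
    rw [Real.norm_of_nonneg (integral_nonneg fun a => by positivity)]
    exact (ho s).var
  have hsq : Integrable (fun q : ℝ × S => ‖ψ' q.1 q.2 - m q.1‖ ^ 2) (I.prod D) := by
    rw [integrable_prod_iff hnsm.aestronglyMeasurable]
    refine ⟨Filter.Eventually.of_forall fun s => hsec s, ?_⟩
    simpa using hvar
  have hn2 : MemLp (fun q : ℝ × S => ψ' q.1 q.2 - m q.1) 2 (I.prod D) :=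
    (memLp_two_iff_integrable_sq_norm hnm.stronglyMeasurable.aestronglyMeasurable).2 hsq
  have hn1 : Integrable (fun q : ℝ × S => ψ' q.1 q.2 - m q.1) (I.prod D) :=
    hn2.integrable (by norm_num)
  have hmI : Integrable m I := (hm.integrableOn_Icc (a := 0) (b := 1)).mono_set
    Set.Ioc_subset_Icc_self
  -- The fundamental theorem of calculus is available for almost every sample only: Fubini gives the
  -- integrability of the velocity in time outside a null set.
  have hincr : ∀ᵐ a ∂D, ψ 1 a - ψ 0 a - ∫ s, m s ∂I = ∫ s, (ψ' s a - m s) ∂I := by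
    filter_upwards [hn1.prod_left_ae] with a ha
    have h1 : Integrable (fun s => ψ' s a) I := by
      have := ha.add hmI
      refine this.congr (Filter.Eventually.of_forall fun s => ?_)
      simp
    have h2 := intervalIntegral.integral_eq_sub_of_hasDerivAt (a := 0) (b := 1)
      (f := fun s => ψ s a) (f' := fun s => ψ' s a) (fun s _ => hd s a)
      ((intervalIntegrable_iff_integrableOn_Ioc_of_le zero_le_one).2 h1)
    rw [integral_sub h1 hmI, ← h2, intervalIntegral.integral_of_le zero_le_one]
  -- Jensen in time; integrating this over the samples and exchanging the integrals leaves the time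
  -- average of the variances, which is at most `v`.
  have hN2 : ∀ᵐ a ∂D, ‖∫ s, (ψ' s a - m s) ∂I‖ ^ 2 ≤ ∫ s, ‖ψ' s a - m s‖ ^ 2 ∂I := by
    filter_upwards [hsq.prod_left_ae] with a ha
    refine norm_integral_sq_le ((memLp_two_iff_integrable_sq_norm ?_).2 ha)
    exact (hnm.comp measurable_prodMk_right).stronglyMeasurable.aestronglyMeasurable
  have hψm : Measurable fun a => ψ 1 a - ψ 0 a := (hψ 1).sub (hψ 0)
  have hle : ∀ᵐ a ∂D, ‖ψ 1 a - ψ 0 a - ∫ s, m s ∂I‖ ^ 2 ≤ ∫ s, ‖ψ' s a - m s‖ ^ 2 ∂I := by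
    filter_upwards [hincr, hN2] with a h1 h2
    rwa [h1]
  have hint : Integrable (fun a => ‖ψ 1 a - ψ 0 a - ∫ s, m s ∂I‖ ^ 2) D := by
    refine hsq.integral_prod_right.mono'
      ((hψm.sub_const _).norm.pow_const 2).stronglyMeasurable.aestronglyMeasurable ?_
    filter_upwards [hle] with a ha
    rwa [Real.norm_of_nonneg (by positivity)]
  have hcen : MemLp (fun a => ψ 1 a - ψ 0 a - ∫ s, m s ∂I) 2 D :=
    (memLp_two_iff_integrable_sq_norm
      (hψm.sub_const _).stronglyMeasurable.aestronglyMeasurable).2 hint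
  have hL2 : MemLp (fun a => ψ 1 a - ψ 0 a) 2 D := by
    have := hcen.add (memLp_const (∫ s, m s ∂I))
    refine this.congr_norm hψm.stronglyMeasurable.aestronglyMeasurable
      (Filter.Eventually.of_forall fun a => ?_)
    simp
  refine ⟨∫ s, m s ∂I, ⟨hL2, ?_, ?_⟩, ?_⟩
  · have h0 : ∫ a, (ψ 1 a - ψ 0 a - ∫ s, m s ∂I) ∂D = 0 := by
      rw [integral_congr_ae hincr, ← integral_integral_swap hn1]
      refine (integral_congr_ae (Filter.Eventually.of_forall fun s => ?_)).trans
        (integral_zero _ _)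
      exact (ho s).centered
    rw [integral_sub (hL2.integrable (by norm_num)) (integrable_const _)] at h0
    simpa [sub_eq_zero] using h0
  · calc _ ≤ ∫ a, ∫ s, ‖ψ' s a - m s‖ ^ 2 ∂I ∂D :=
          integral_mono_ae hint hsq.integral_prod_right hle
      _ = ∫ s, ∫ a, ‖ψ' s a - m s‖ ^ 2 ∂D ∂I := (integral_integral_swap hsq).symm
      _ ≤ ∫ _, v ∂I := integral_mono hvar (integrable_const v) fun s => (ho s).var
      _ = v := by simp
  · have h1 : ∫ s, m s ∂I - m₀ = ∫ s, (m s - m₀) ∂I := by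
      rw [integral_sub hmI (integrable_const _)]; simp
    rw [h1]
    have := norm_setIntegral_le_of_norm_le_const (μ := volume) (s := Set.Ioc (0 : ℝ) 1)
      (f := fun s => m s - m₀) (C := B) (by simp) hB
    simpa using this

end FiniteDifference

end DSOBA

end

noncomputable section

namespace DSOBA

/-! ### The sampled directions as oracles, for both variants -/

section Oracles

theorem Oracle.neg {S : Type*} [MeasurableSpace S] {n : ℕ} {D : Measure S} {V : S → Vec n}
    {m : Vec n} {s : ℝ} (h : Oracle D V m s) : Oracle D (fun a => - V a) (-m) s := by
  refine ⟨h.memLp.neg, by rw [integral_neg, h.mean], ?_⟩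
  refine (le_of_eq ?_).trans h.var
  congr 1
  ext a
  rw [← norm_neg]
  congr 2
  abel

theorem UnbiasedOracle.oracle {S E : Type*} [MeasurableSpace S] [NormedAddCommGroup E]
    [NormedSpace ℝ E] {D : Measure S} {V : S → E} {m : E} {σ : ℝ}
    (h : UnbiasedOracle D V m σ) : Oracle D V m (σ ^ 2) := ⟨h.1, h.2.1, h.2.2⟩

theorem Oracle.apply {S : Type*} [MeasurableSpace S] {n k : ℕ} {D : Measure S}
    [IsProbabilityMeasure D] {V : S → Vec k →L[ℝ] Vec n} {m : Vec k →L[ℝ] Vec n} {s : ℝ}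
    (h : Oracle D V m s) (z : Vec k) : Oracle D (fun a => V a z) (m z) (s * ‖z‖ ^ 2) := by
  have h1 : MemLp (fun a => V a z) 2 D := (ContinuousLinearMap.apply ℝ (Vec n) z).comp_memLp' h.memLp
  refine ⟨h1, ?_, ?_⟩
  · rw [← h.mean]
    exact ((ContinuousLinearMap.apply ℝ (Vec n) z).integral_comp_comm
      (h.memLp.integrable (by norm_num)))
  · have h2 : Integrable (fun a => ‖V a - m‖ ^ 2) D :=
      (h.memLp.sub (memLp_const _)).integrable_norm_pow (by norm_num)
    calc _ ≤ ∫ a, ‖V a - m‖ ^ 2 * ‖z‖ ^ 2 ∂D := by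
          refine integral_mono ((h1.sub (memLp_const _)).integrable_norm_pow (by norm_num))
            (h2.mul_const _) fun a => ?_
          have := (V a - m).le_opNorm z
          rw [sub_apply] at this
          calc _ ≤ (‖V a - m‖ * ‖z‖) ^ 2 := by
                gcongr
            _ = _ := by ring
      _ ≤ _ := by
          rw [integral_mul_const]
          gcongr
          exact h.var

/-- The path `y + (2t - 1) δ z`, `0 ≤ t ≤ 1`, has velocity `2 δ z`, which the prefactor normalises
to `z`. Hence the central difference is the time average of `T z` along the segment. It inherits the
variance of `T z`, and its mean is off by at most `L δ ‖z‖² ≤ L ε`. Only the mean of `T` has to be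
Lipschitz, not the samples. -/
theorem oracle_difference {S : Type*} [MeasurableSpace S] {D : Measure S}
    [IsProbabilityMeasure D] {p n : ℕ} {Γ : S → Vec p → Vec n}
    {T : S → Vec p → Vec p →L[ℝ] Vec n} {Tm : Vec p → Vec p →L[ℝ] Vec n} {s L ε δ : ℝ}
    {y z : Vec p} (hΓ : ∀ y, Measurable fun a => Γ a y)
    (hd : ∀ a y, HasFDerivAt (Γ a) (T a y) y)
    (ho : ∀ y, Oracle D (fun a => T a y) (Tm y) s) (hL : 0 ≤ L)
    (hlip : ∀ y y', ‖Tm y - Tm y'‖ ≤ L * ‖y - y'‖) (hδ : 0 < δ) (hδz : δ * ‖z‖ ^ 2 ≤ ε) :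
    ∃ m, Oracle D (fun a => (2 * δ)⁻¹ • (Γ a (y + δ • z) - Γ a (y - δ • z))) m (s * ‖z‖ ^ 2) ∧
      ‖m - Tm y z‖ ≤ L * ε := by
  have hpath : ∀ t : ℝ, HasDerivAt (fun t : ℝ => y + ((2 * t - 1) * δ) • z) ((2 * δ) • z) t := by
    intro t
    have h1 : HasDerivAt (fun t : ℝ => (2 * t - 1) * δ) (2 * δ) t := by
      simpa using (((hasDerivAt_id t).const_mul 2).sub_const 1).mul_const δ
    exact (h1.smul_const z).const_add y
  have hTc : Continuous Tm := by
    refine continuous_iff_continuousAt.2 fun y₀ => ?_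
    have : LipschitzWith (Real.toNNReal L) Tm := LipschitzWith.of_dist_le_mul fun a b => by
      rw [dist_eq_norm, dist_eq_norm, Real.coe_toNNReal L hL]
      exact hlip a b
    exact this.continuous.continuousAt
  obtain ⟨m, hm, hB⟩ := oracle_increment (D := D)
    (ψ := fun t a => (2 * δ)⁻¹ • Γ a (y + ((2 * t - 1) * δ) • z))
    (ψ' := fun t a => T a (y + ((2 * t - 1) * δ) • z) z)
    (m := fun t => Tm (y + ((2 * t - 1) * δ) • z) z) (m₀ := Tm y z) (v := s * ‖z‖ ^ 2)
    (B := L * ε)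
    (fun t => (hΓ (y + ((2 * t - 1) * δ) • z)).const_smul (2 * δ)⁻¹)
    (fun t a => by
      have h1 := ((hd a _).comp_hasDerivAt t (hpath t)).const_smul (2 * δ)⁻¹
      rw [map_smul, inv_smul_smul₀ (by positivity)] at h1
      exact h1)
    (by
      have hc : Continuous fun t : ℝ => y + ((2 * t - 1) * δ) • z := by fun_prop
      exact (hTc.comp hc).clm_apply continuous_const)
    (fun t => (ho _).apply z)
    (fun t ht => by
      have h1 : ‖Tm (y + ((2 * t - 1) * δ) • z) z - Tm y z‖ ≤
          L * ‖((2 * t - 1) * δ) • z‖ * ‖z‖ := by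
        rw [← sub_apply]
        refine (ContinuousLinearMap.le_opNorm _ _).trans ?_
        gcongr
        refine (hlip _ _).trans (le_of_eq ?_)
        rw [add_sub_cancel_left]
      refine h1.trans ?_
      rw [norm_smul, norm_mul, Real.norm_of_nonneg hδ.le]
      have h2 : ‖2 * t - 1‖ ≤ 1 := by
        rw [Real.norm_eq_abs, abs_le]
        constructor <;> linarith [ht.1, ht.2]
      calc L * (‖2 * t - 1‖ * δ * ‖z‖) * ‖z‖ ≤ L * (1 * δ * ‖z‖) * ‖z‖ := by gcongr
        _ = L * (δ * ‖z‖ ^ 2) := by ring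
        _ ≤ L * ε := by gcongr)
  refine ⟨m, ?_, hB⟩
  convert hm using 2 with a
  rw [smul_sub]
  congr 4 <;> module

variable {N d p : ℕ} {Ξ Z : Type*} [MeasurableSpace Ξ] [MeasurableSpace Z]
    {P : Problem N d p Ξ Z} {L κ σ ε δ : ℝ} {v : Variant}

theorem oracle_pH (h : Regular P L κ) (hs : Stochastic P σ) (hε : 0 ≤ ε) (i : Fin N)
    (x : Vec d) (y z : Vec p) (hδ : v = .FO → 0 < δ ∧ δ * ‖z‖ ^ 2 ≤ ε) :
    ∃ m, Oracle (P.Dg i) (fun ζ => pH P v δ ζ x y z) m (σ ^ 2 * ‖z‖ ^ 2) ∧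
      ‖m - hess22 (P.g i) x y z‖ ≤ L * ε := by
  have := hs.prob_g i
  have hL := h.L_pos
  cases v with
  | SO =>
    refine ⟨hess22 (P.g i) x y z, (hs.G22 i x y).oracle.apply z, ?_⟩
    rw [sub_self, norm_zero]
    positivity
  | FO =>
    refine oracle_difference (T := fun ζ y => hess22 (P.Gat ζ) x y)
      (Tm := fun y => hess22 (P.g i) x y)
      (fun y => measurable_grad2 hs.meas_G hs.diff_G measurable_const measurable_const
        measurable_id) (fun ζ y => ?_) (fun y => (hs.G22 i x y).oracle) hL.le
      (fun y y' => ?_) (hδ rfl).1 (hδ rfl).2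
    · rw [hess22_eq (hs.diff_G ζ) (hs.diff_grad_G ζ)]
      exact hasFDerivAt_grad2 (hs.diff_G ζ) (hs.diff_grad_G ζ) x y
    · have := (h.g i).hess22_sub_le x y x y'
      rwa [pdist_right] at this

theorem oracle_pJ (h : Regular P L κ) (hs : Stochastic P σ) (hε : 0 ≤ ε) (i : Fin N)
    (x : Vec d) (y z : Vec p) (hδ : v = .FO → 0 < δ ∧ δ * ‖z‖ ^ 2 ≤ ε) :
    ∃ m, Oracle (P.Dg i) (fun ζ => pJ P v δ ζ x y z) m (σ ^ 2 * ‖z‖ ^ 2) ∧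
      ‖m - hess12 (P.g i) x y z‖ ≤ L * ε := by
  have := hs.prob_g i
  have hL := h.L_pos
  cases v with
  | SO =>
    refine ⟨hess12 (P.g i) x y z, (hs.G12 i x y).oracle.apply z, ?_⟩
    rw [sub_self, norm_zero]
    positivity
  | FO =>
    refine oracle_difference (T := fun ζ y => hess12 (P.Gat ζ) x y)
      (Tm := fun y => hess12 (P.g i) x y)
      (fun y => measurable_grad1 hs.meas_G hs.diff_G measurable_const measurable_const
        measurable_id) (fun ζ y => ?_) (fun y => (hs.G12 i x y).oracle) hL.le
      (fun y y' => ?_) (hδ rfl).1 (hδ rfl).2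
    · rw [hess12_eq (hs.diff_G ζ) (hs.diff_grad_G ζ)]
      exact hasFDerivAt_grad1 (hs.diff_G ζ) (hs.diff_grad_G ζ) x y
    · have := (h.g i).hess12_sub_le x y x y'
      rwa [pdist_right] at this

theorem oracle_y (hs : Stochastic P σ) (i : Fin N) (x : Vec d) (y : Vec p) :
    Oracle ((P.Df i).prod (P.Dg i)) (fun w => grad2 (P.Gat w.2) x y) (grad2 (P.g i) x y)
      (2 * σ ^ 2) := by
  have := hs.prob_f i
  have := hs.prob_g i
  -- The direction for `y` uses `ζ` only. Adding the zero oracle in `ξ` places it on the law of the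
  -- pair, like the other directions.
  have h0 : Oracle (P.Df i) (fun _ => (0 : Vec p)) 0 0 :=
    ⟨memLp_const _, by simp, by simp⟩
  simpa using (h0.sub_prod (hs.G2 i x y).oracle).neg

theorem oracle_z (h : Regular P L κ) (hs : Stochastic P σ) (hε : 0 ≤ ε) (i : Fin N)
    (x : Vec d) (y z : Vec p) (hδ : v = .FO → 0 < δ ∧ δ * ‖z‖ ^ 2 ≤ ε) :
    ∃ m, Oracle ((P.Df i).prod (P.Dg i))
      (fun w => pH P v δ w.2 x y z - grad2 (P.Fat w.1) x y) m (2 * σ ^ 2 * (1 + ‖z‖ ^ 2)) ∧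
      ‖m - (hess22 (P.g i) x y z - grad2 (P.f i) x y)‖ ≤ L * ε := by
  have := hs.prob_f i
  have := hs.prob_g i
  obtain ⟨m, hm, hb⟩ := oracle_pH (v := v) (δ := δ) h hs hε i x y z hδ
  have h1 := ((hs.F2 i x y).oracle.sub_prod hm).neg
  simp only [neg_sub] at h1
  refine ⟨m - grad2 (P.f i) x y, ?_, ?_⟩
  · convert h1 using 1
    ring
  · rwa [sub_sub_sub_cancel_right]

/-- The mean is written `-m` so that `m` estimates `∇²₁₂g z - ∇₁f`, which has the same shape `T z -
r` as the direction for `z`. The bounds for `MeanEstimate` then serve both. -/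
theorem oracle_h (h : Regular P L κ) (hs : Stochastic P σ) (hε : 0 ≤ ε) (i : Fin N)
    (x : Vec d) (y z : Vec p) (hδ : v = .FO → 0 < δ ∧ δ * ‖z‖ ^ 2 ≤ ε) :
    ∃ m, Oracle ((P.Df i).prod (P.Dg i))
      (fun w => grad1 (P.Fat w.1) x y - pJ P v δ w.2 x y z) (-m) (2 * σ ^ 2 * (1 + ‖z‖ ^ 2)) ∧
      ‖m - (hess12 (P.g i) x y z - grad1 (P.f i) x y)‖ ≤ L * ε := by
  have := hs.prob_f i
  have := hs.prob_g i
  obtain ⟨m, hm, hb⟩ := oracle_pJ (v := v) (δ := δ) h hs hε i x y z hδ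
  have h1 := ((hs.F1 i x y).oracle.sub_prod hm)
  refine ⟨m - grad1 (P.f i) x y, ?_, ?_⟩
  · convert h1 using 1
    · abel
    · ring
  · rwa [sub_sub_sub_cancel_right]

end Oracles

/-! ### Averages and dissimilarity of the conditional means -/

section MeanBounds

variable {N d p n : ℕ} {T : Fin N → Vec d → Vec p → Vec p →L[ℝ] Vec n}
  {r : Fin N → Vec d → Vec p → Vec n} {L κ ε : ℝ} {M : Fin N → Vec n}
  {x : Fin N → Vec d} {y z : Fin N → Vec p} {x₀ : Vec d} {y₀ z₀ : Vec p}

theorem avg_pdist_sq (hN : 1 ≤ N) (x : Fin N → Vec d) (y : Fin N → Vec p) (x₀ : Vec d)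
    (y₀ : Vec p) : avg (fun j => pdist (x j) (y j) x₀ y₀ ^ 2) =
      spread x / N + ‖avg x - x₀‖ ^ 2 + (spread y / N + ‖avg y - y₀‖ ^ 2) := by
  simp only [pdist_sq]
  rw [avg_add, avg_sq_eq_spread_add hN, avg_sq_eq_spread_add hN]

theorem add_three_sq_le (a b c : ℝ) : (a + b + c) ^ 2 ≤ 3 * (a ^ 2 + b ^ 2 + c ^ 2) := by
  nlinarith [sq_nonneg (a - b), sq_nonneg (a - c), sq_nonneg (b - c)]

/-- The means `M j` of the estimates `T z - r`, up to the errors of the finite differences. -/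
structure MeanEstimate (T : Fin N → Vec d → Vec p → Vec p →L[ℝ] Vec n)
    (r : Fin N → Vec d → Vec p → Vec n) (L ε : ℝ) (x : Fin N → Vec d) (y z : Fin N → Vec p)
    (M : Fin N → Vec n) : Prop where
  nodes : 1 ≤ N
  L_nonneg : 0 ≤ L
  norm_T : ∀ j x y, ‖T j x y‖ ≤ L
  lip_T : ∀ j x y x' y', ‖T j x y - T j x' y'‖ ≤ L * pdist x y x' y'
  lip_r : ∀ j x y x' y', ‖r j x y - r j x' y'‖ ≤ L * pdist x y x' y'
  bias : ∀ j, ‖M j - (T j (x j) (y j) (z j) - r j (x j) (y j))‖ ≤ L * ε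

/-- The split lets the difference of `T` act on the reference `z₀`, with `‖z₀‖ ≤ κ`, while `z j -
z₀` meets `T` itself. No a priori bound on the iterates `z j` is needed. The factor `2 κ` is `κ + 1`
rounded up. -/
theorem MeanEstimate.error_le (h : MeanEstimate T r L ε x y z M) (hκ : 1 ≤ κ) (hz : ‖z₀‖ ≤ κ)
    (j : Fin N) :
    ‖M j - (T j x₀ y₀ z₀ - r j x₀ y₀) - T j (x j) (y j) (z j - z₀)‖ ≤
      L * (2 * κ * pdist (x j) (y j) x₀ y₀ + ε) := by
  have hL := h.L_nonneg
  have hp := pdist_nonneg (x j) (y j) x₀ y₀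
  have he : M j - (T j x₀ y₀ z₀ - r j x₀ y₀) - T j (x j) (y j) (z j - z₀) =
      (M j - (T j (x j) (y j) (z j) - r j (x j) (y j))) + (T j (x j) (y j) - T j x₀ y₀) z₀
        - (r j (x j) (y j) - r j x₀ y₀) := by
    rw [map_sub, sub_apply]; abel
  rw [he]
  have h1 : ‖(T j (x j) (y j) - T j x₀ y₀) z₀‖ ≤ L * pdist (x j) (y j) x₀ y₀ * κ :=
    (ContinuousLinearMap.le_opNorm _ _).trans
      (mul_le_mul (h.lip_T _ _ _ _ _) hz (norm_nonneg _) (by positivity))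
  calc _ ≤ L * ε + L * pdist (x j) (y j) x₀ y₀ * κ + L * pdist (x j) (y j) x₀ y₀ :=
        (norm_sub_le _ _).trans (add_le_add ((norm_add_le _ _).trans (add_le_add (h.bias j) h1))
          (h.lip_r _ _ _ _ _))
    _ = L * ((κ + 1) * pdist (x j) (y j) x₀ y₀ + ε) := by ring
    _ ≤ L * ((κ + κ) * pdist (x j) (y j) x₀ y₀ + ε) := by gcongr
    _ = _ := by ring

theorem MeanEstimate.norm_apply_le (h : MeanEstimate T r L ε x y z M) (j : Fin N) (u : Vec p) :
    ‖T j (x j) (y j) u‖ ≤ L * ‖u‖ :=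
  (ContinuousLinearMap.le_opNorm _ _).trans (by gcongr; exact h.norm_T _ _ _)

theorem avg_three_sq (hN : 1 ≤ N) (u : Vec p) :
    avg (fun j => L ^ 2 * (3 * (‖z j - u‖ ^ 2 + (2 * κ * pdist (x j) (y j) x₀ y₀) ^ 2 + ε ^ 2)))
      = 3 * L ^ 2 * (spread z / N + ‖avg z - u‖ ^ 2 + 4 * κ ^ 2 *
        (spread x / N + ‖avg x - x₀‖ ^ 2 + (spread y / N + ‖avg y - y₀‖ ^ 2)) + ε ^ 2) := by
  have h1 : ∀ j, L ^ 2 * (3 * (‖z j - u‖ ^ 2 + (2 * κ * pdist (x j) (y j) x₀ y₀) ^ 2 + ε ^ 2)) =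
      (3 * L ^ 2) • (‖z j - u‖ ^ 2 + (4 * κ ^ 2) • pdist (x j) (y j) x₀ y₀ ^ 2 + ε ^ 2) := by
    intro j; simp only [smul_eq_mul]; ring
  simp only [h1]
  rw [avg_smul, avg_add, avg_add, avg_smul, avg_const hN, avg_pdist_sq hN,
    avg_sq_eq_spread_add hN]
  simp only [smul_eq_mul]

theorem MeanEstimate.avg_sub_sq_le (h : MeanEstimate T r L ε x y z M) (hκ : 1 ≤ κ)
    (hz : ‖z₀‖ ≤ κ) :
    ‖avg M - avg fun j => T j x₀ y₀ z₀ - r j x₀ y₀‖ ^ 2 ≤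
      3 * L ^ 2 * (spread z / N + ‖avg z - z₀‖ ^ 2 + 4 * κ ^ 2 *
        (spread x / N + ‖avg x - x₀‖ ^ 2 + (spread y / N + ‖avg y - y₀‖ ^ 2)) + ε ^ 2) := by
  rw [← avg_sub, ← avg_three_sq h.nodes]
  refine (norm_avg_sq_le _).trans (avg_mono fun j => ?_)
  have h1 : ‖M j - (T j x₀ y₀ z₀ - r j x₀ y₀)‖ ≤
      L * (‖z j - z₀‖ + 2 * κ * pdist (x j) (y j) x₀ y₀ + ε) := by
    calc _ = ‖T j (x j) (y j) (z j - z₀) +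
          (M j - (T j x₀ y₀ z₀ - r j x₀ y₀) - T j (x j) (y j) (z j - z₀))‖ := by congr 1; abel
      _ ≤ L * ‖z j - z₀‖ + L * (2 * κ * pdist (x j) (y j) x₀ y₀ + ε) :=
          (norm_add_le _ _).trans (add_le_add (h.norm_apply_le j _) (h.error_le hκ hz j))
      _ = _ := by ring
  refine (pow_le_pow_left₀ (norm_nonneg _) h1 2).trans ?_
  rw [mul_pow]
  gcongr
  exact add_three_sq_le _ _ _

/-- The part of the mean that is linear in `avg z - z₀` is left untouched, because strong convexity
makes it contract; the remainder then contains only the consensus error of `z` and not the error of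
its average. -/
theorem MeanEstimate.avg_linearized_sq_le (h : MeanEstimate T r L ε x y z M) (hκ : 1 ≤ κ)
    (hz : ‖z₀‖ ≤ κ) :
    ‖avg M - (avg fun j => T j x₀ y₀ z₀ - r j x₀ y₀)
      - avg fun j => T j (x j) (y j) (avg z - z₀)‖ ^ 2 ≤
      3 * L ^ 2 * (spread z / N + 4 * κ ^ 2 *
        (spread x / N + ‖avg x - x₀‖ ^ 2 + (spread y / N + ‖avg y - y₀‖ ^ 2)) + ε ^ 2) := by
  have h3 := avg_three_sq (L := L) (κ := κ) (ε := ε) (x := x) (y := y) (z := z) (x₀ := x₀)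
    (y₀ := y₀) h.nodes (avg z)
  rw [sub_self, norm_zero, zero_pow two_ne_zero, add_zero] at h3
  rw [← avg_sub, ← avg_sub, ← h3]
  refine (norm_avg_sq_le _).trans (avg_mono fun j => ?_)
  have h1 : ‖M j - (T j x₀ y₀ z₀ - r j x₀ y₀) - T j (x j) (y j) (avg z - z₀)‖ ≤
      L * (‖z j - avg z‖ + 2 * κ * pdist (x j) (y j) x₀ y₀ + ε) := by
    calc _ = ‖T j (x j) (y j) (z j - avg z) +
          (M j - (T j x₀ y₀ z₀ - r j x₀ y₀) - T j (x j) (y j) (z j - z₀))‖ := by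
            congr 1
            simp only [map_sub]
            abel
      _ ≤ L * ‖z j - avg z‖ + L * (2 * κ * pdist (x j) (y j) x₀ y₀ + ε) :=
          (norm_add_le _ _).trans (add_le_add (h.norm_apply_le j _) (h.error_le hκ hz j))
      _ = _ := by ring
  refine (pow_le_pow_left₀ (norm_nonneg _) h1 2).trans ?_
  rw [mul_pow]
  gcongr
  exact add_three_sq_le _ _ _

/-- All means are compared with the single vector `Tbar z₀ - rbar`, so dissimilarity enters only at
the reference point. The dissimilarity of `T` acts on `z₀`, hence the factor `κ²` in front of `b₂²`.
-/
theorem MeanEstimate.spread_le (h : MeanEstimate T r L ε x y z M) (hκ : 1 ≤ κ)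
    (hz : ‖z₀‖ ≤ κ) {Tbar : Vec p →L[ℝ] Vec n} {rbar : Vec n} {b₁ b₂ : ℝ}
    (hT : avg (fun j => ‖T j x₀ y₀ - Tbar‖ ^ 2) ≤ b₂ ^ 2)
    (hr : avg (fun j => ‖r j x₀ y₀ - rbar‖ ^ 2) ≤ b₁ ^ 2) :
    spread M / N ≤
      6 * L ^ 2 * (spread z / N + ‖avg z - z₀‖ ^ 2 + 4 * κ ^ 2 *
        (spread x / N + ‖avg x - x₀‖ ^ 2 + (spread y / N + ‖avg y - y₀‖ ^ 2)) + ε ^ 2)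
      + 4 * (κ ^ 2 * b₂ ^ 2 + b₁ ^ 2) := by
  refine (spread_le_avg h.nodes M (Tbar z₀ - rbar)).trans ?_
  have h1 : ∀ j, ‖M j - (Tbar z₀ - rbar)‖ ^ 2 ≤
      2 * (L ^ 2 * (3 * (‖z j - z₀‖ ^ 2 + (2 * κ * pdist (x j) (y j) x₀ y₀) ^ 2 + ε ^ 2)))
      + (4 * κ ^ 2 * ‖T j x₀ y₀ - Tbar‖ ^ 2 + 4 * ‖r j x₀ y₀ - rbar‖ ^ 2) := by
    intro j
    have e1 : M j - (Tbar z₀ - rbar) = (M j - (T j x₀ y₀ z₀ - r j x₀ y₀)) +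
        ((T j x₀ y₀ - Tbar) z₀ + -(r j x₀ y₀ - rbar)) := by
      rw [sub_apply]; abel
    have e2 : ‖M j - (T j x₀ y₀ z₀ - r j x₀ y₀)‖ ≤
        L * (‖z j - z₀‖ + 2 * κ * pdist (x j) (y j) x₀ y₀ + ε) := by
      calc _ = ‖T j (x j) (y j) (z j - z₀) +
            (M j - (T j x₀ y₀ z₀ - r j x₀ y₀) - T j (x j) (y j) (z j - z₀))‖ := by congr 1; abel
        _ ≤ L * ‖z j - z₀‖ + L * (2 * κ * pdist (x j) (y j) x₀ y₀ + ε) :=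
            (norm_add_le _ _).trans (add_le_add (h.norm_apply_le j _) (h.error_le hκ hz j))
        _ = _ := by ring
    have e3 : ‖M j - (T j x₀ y₀ z₀ - r j x₀ y₀)‖ ^ 2 ≤
        L ^ 2 * (3 * (‖z j - z₀‖ ^ 2 + (2 * κ * pdist (x j) (y j) x₀ y₀) ^ 2 + ε ^ 2)) := by
      refine (pow_le_pow_left₀ (norm_nonneg _) e2 2).trans ?_
      rw [mul_pow]
      gcongr
      exact add_three_sq_le _ _ _
    have e4 : ‖(T j x₀ y₀ - Tbar) z₀‖ ^ 2 ≤ κ ^ 2 * ‖T j x₀ y₀ - Tbar‖ ^ 2 := by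
      rw [← mul_pow]
      have := (ContinuousLinearMap.le_opNorm (T j x₀ y₀ - Tbar) z₀).trans
        (mul_le_mul_of_nonneg_left hz (norm_nonneg _))
      rw [mul_comm] at this
      gcongr
    rw [e1]
    refine (norm_add_sq_le_two _ _).trans ?_
    have e5 := norm_add_sq_le_two ((T j x₀ y₀ - Tbar) z₀) (-(r j x₀ y₀ - rbar))
    rw [norm_neg] at e5
    linarith
  refine (avg_mono h1).trans ?_
  have h2 := avg_three_sq (L := L) (κ := κ) (ε := ε) (x := x) (y := y) (z := z) (x₀ := x₀)
    (y₀ := y₀) h.nodes z₀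
  have h3 := avg_smul (2 : ℝ) fun j =>
    L ^ 2 * (3 * (‖z j - z₀‖ ^ 2 + (2 * κ * pdist (x j) (y j) x₀ y₀) ^ 2 + ε ^ 2))
  have h4 := avg_smul (4 * κ ^ 2) fun j => ‖T j x₀ y₀ - Tbar‖ ^ 2
  have h5 := avg_smul (4 : ℝ) fun j => ‖r j x₀ y₀ - rbar‖ ^ 2
  simp only [smul_eq_mul] at h3 h4 h5
  rw [avg_add, avg_add, h3, h4, h5, h2]
  have h6 : κ ^ 2 * avg (fun j => ‖T j x₀ y₀ - Tbar‖ ^ 2) ≤ κ ^ 2 * b₂ ^ 2 := by gcongr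
  linarith

end MeanBounds

end DSOBA

end

noncomputable section

namespace DSOBA

/-- The function `f` is dominated by an integrable function of mean at most `c`. -/
def MeanLE {S : Type*} [MeasurableSpace S] (D : Measure S) (f : S → ℝ) (c : ℝ) : Prop :=
  ∃ U : S → ℝ, Integrable U D ∧ (∀ w, f w ≤ U w) ∧ ∫ w, U w ∂D ≤ c

/-! ### Upper bounds on expectations through integrable majorants -/

namespace MeanLE

variable {S : Type*} [MeasurableSpace S] {D : Measure S} {f g : S → ℝ} {c e : ℝ}

theorem of_integral (h : Integrable f D ∧ ∫ w, f w ∂D ≤ c) : MeanLE D f c :=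
  ⟨f, h.1, fun _ => le_rfl, h.2⟩

theorem const [IsProbabilityMeasure D] (c : ℝ) : MeanLE D (fun _ => c) c :=
  ⟨fun _ => c, integrable_const _, fun _ => le_rfl, by simp⟩

theorem add (hf : MeanLE D f c) (hg : MeanLE D g e) : MeanLE D (fun w => f w + g w) (c + e) := by
  obtain ⟨U, h1, h2, h3⟩ := hf
  obtain ⟨U', h1', h2', h3'⟩ := hg
  exact ⟨fun w => U w + U' w, h1.add h1', fun w => add_le_add (h2 w) (h2' w),
    (integral_add h1 h1').trans_le (add_le_add h3 h3')⟩

theorem const_mul {k : ℝ} (hk : 0 ≤ k) (hf : MeanLE D f c) :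
    MeanLE D (fun w => k * f w) (k * c) := by
  obtain ⟨U, h1, h2, h3⟩ := hf
  exact ⟨fun w => k * U w, h1.const_mul k, fun w => mul_le_mul_of_nonneg_left (h2 w) hk,
    (integral_const_mul _ _).trans_le (mul_le_mul_of_nonneg_left h3 hk)⟩

theorem mono (hf : MeanLE D f c) (h : ∀ w, g w ≤ f w) (hc : c ≤ e) : MeanLE D g e := by
  obtain ⟨U, h1, h2, h3⟩ := hf
  exact ⟨U, h1, fun w => (h w).trans (h2 w), h3.trans hc⟩

end MeanLE

/-! ### Contraction under a gradient step with perturbation -/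

section Contraction

variable {E : Type*} [NormedAddCommGroup E] [InnerProductSpace ℝ E]

/-- Expanding the square gives the factor `1 - 2 a / κ + a²`, and `a κ ≤ 1` makes the last term at
most `a / κ`. -/
theorem norm_gradient_step_sq_le {L κ a : ℝ} (hL : 0 < L) (hκ : 1 ≤ κ) (ha : 0 < a)
    (haκ : a * κ ≤ 1) {e G : E} (h1 : L / κ * ‖e‖ ^ 2 ≤ inner ℝ G e) (h2 : ‖G‖ ≤ L * ‖e‖) :
    ‖e - (a / L) • G‖ ^ 2 ≤ (1 - a / κ) * ‖e‖ ^ 2 := by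
  have hκ0 : 0 < κ := by linarith
  rw [norm_sub_sq_real, inner_smul_right, real_inner_comm, norm_smul, mul_pow, Real.norm_eq_abs,
    sq_abs]
  have h3 : a / L * (L / κ * ‖e‖ ^ 2) ≤ a / L * inner ℝ G e := by gcongr
  have h4 : a / L * (L / κ * ‖e‖ ^ 2) = a / κ * ‖e‖ ^ 2 := by field_simp
  have h5 : (a / L) ^ 2 * ‖G‖ ^ 2 ≤ (a / L) ^ 2 * (L * ‖e‖) ^ 2 := by gcongr
  have h6 : (a / L) ^ 2 * (L * ‖e‖) ^ 2 = a ^ 2 * ‖e‖ ^ 2 := by field_simp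
  have h7 : a ^ 2 ≤ a / κ := by rw [le_div_iff₀ hκ0]; nlinarith
  have h8 : a ^ 2 * ‖e‖ ^ 2 ≤ a / κ * ‖e‖ ^ 2 := by gcongr
  linarith

/-- Young's inequality with parameter `q / 2` keeps half of the contraction and charges the
perturbation at most `3 / q`. -/
theorem norm_contracted_add_sq_le {q Q : ℝ} (hq : 0 < q) (hq1 : q ≤ 1) {u e e' : E}
    (hQ : 0 ≤ Q) (hu : ‖u‖ ^ 2 ≤ (1 - q) * Q) :
    ‖u + (e + e')‖ ^ 2 ≤ (1 - q / 2) * Q + 6 / q * (‖e‖ ^ 2 + ‖e'‖ ^ 2) := by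
  have h1 := norm_add_sq_le_young (s := q / 2) (by positivity) u (e + e')
  have h2 := norm_add_sq_le_two e e'
  have h3 : (1 + q / 2) * ‖u‖ ^ 2 ≤ (1 - q / 2) * Q := by
    calc _ ≤ (1 + q / 2) * ((1 - q) * Q) := by gcongr
      _ = (1 - q / 2) * Q - q ^ 2 / 2 * Q := by ring
      _ ≤ _ := by have : 0 ≤ q ^ 2 / 2 * Q := by positivity
                  linarith
  have h4 : (1 + 1 / (q / 2)) ≤ 3 / q := by
    rw [le_div_iff₀ hq]
    field_simp
    linarith
  have h5 : (1 + 1 / (q / 2)) * ‖e + e'‖ ^ 2 ≤ 3 / q * (2 * ‖e‖ ^ 2 + 2 * ‖e'‖ ^ 2) := by gcongr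
  calc _ ≤ _ := h1
    _ ≤ (1 - q / 2) * Q + 3 / q * (2 * ‖e‖ ^ 2 + 2 * ‖e'‖ ^ 2) := add_le_add h3 h5
    _ = _ := by ring

end Contraction

/-! ### One-step bounds for all error quantities -/

section Scalars

variable {N d p : ℕ} {Ξ Z : Type*} [MeasurableSpace Ξ] [MeasurableSpace Z]

/-- The squared error of the averaged lower-level variable. -/
def errY (P : Problem N d p Ξ Z) (s : State N d p) : ℝ := ‖avg s.y - P.ystar (avg s.x)‖ ^ 2

/-- The squared error of the averaged auxiliary variable. -/
def errZ (P : Problem N d p Ξ Z) (s : State N d p) : ℝ := ‖avg s.z - P.zstar (avg s.x)‖ ^ 2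

/-- The normalized squared error of the averaged hypergradient estimate. -/
def errH (P : Problem N d p Ξ Z) (L : ℝ) (s : State N d p) : ℝ :=
  ‖avg s.h - Regular.hyperGrad P (avg s.x)‖ ^ 2 / L ^ 2

/-- The normalized squared norm of the averaged hypergradient estimate. -/
def sizeH (L : ℝ) (s : State N d p) : ℝ := ‖avg s.h‖ ^ 2 / L ^ 2

/-- The normalized squared norm of the hypergradient. -/
def sizeG (P : Problem N d p Ξ Z) (L : ℝ) (s : State N d p) : ℝ :=
  ‖Regular.hyperGrad P (avg s.x)‖ ^ 2 / L ^ 2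

/-- The mean squared consensus error. -/
def cons {n : ℕ} (v : Fin N → Vec n) : ℝ := spread v / N

theorem cons_nonneg {n : ℕ} (v : Fin N → Vec n) : 0 ≤ cons v :=
  div_nonneg (spread_nonneg v) (Nat.cast_nonneg N)

theorem errY_nonneg (P : Problem N d p Ξ Z) (s : State N d p) : 0 ≤ errY P s := by
  rw [errY]; positivity

theorem errZ_nonneg (P : Problem N d p Ξ Z) (s : State N d p) : 0 ≤ errZ P s := by
  rw [errZ]; positivity

theorem errH_nonneg (P : Problem N d p Ξ Z) (L : ℝ) (s : State N d p) : 0 ≤ errH P L s := by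
  rw [errH]; positivity

theorem sizeH_nonneg (L : ℝ) (s : State N d p) : 0 ≤ sizeH L s := by
  rw [sizeH]; positivity

theorem sizeG_nonneg (P : Problem N d p Ξ Z) (L : ℝ) (s : State N d p) : 0 ≤ sizeG P L s := by
  rw [sizeG]; positivity

/-- The joint law of the samples of one iteration. -/
def sampleLaw (P : Problem N d p Ξ Z) : Measure (Fin N → Ξ × Z) :=
  Measure.pi fun j => (P.Df j).prod (P.Dg j)

/-- One iteration, as a function of the samples of all nodes. -/
def next (P : Problem N d p Ξ Z) (v : Variant) (W : Matrix (Fin N) (Fin N) ℝ)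
    (τ α β γ θ δ : ℝ) (s : State N d p) (w : Fin N → Ξ × Z) : State N d p :=
  step P v W τ α β γ θ δ (fun i => (w i).1) (fun i => (w i).2) s

/-- The setting of one iteration: `β = γ = a / L`, `θ = a` and `τ α = r / L`, and the steps of the
finite differences are small. -/
structure StepSetting (P : Problem N d p Ξ Z) (v : Variant) (W : Matrix (Fin N) (Fin N) ℝ)
    (L κ σ ρ b₁ b₂ ε a r τ α δ : ℝ) (s : State N d p) : Prop where
  reg : Regular P L κ
  diss : Dissimilarity P b₁ b₂
  stoch : Stochastic P σ
  mix : Mixing W ρ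
  ρ_nonneg : 0 ≤ ρ
  ρ_lt : ρ < 1
  ε_nonneg : 0 ≤ ε
  a_pos : 0 < a
  aκ_le : a * κ ≤ 1
  r_pos : 0 < r
  rate : τ * α = r / L
  diff : v = .FO → 0 < δ ∧ ∀ i, δ * ‖s.z i‖ ^ 2 ≤ ε

variable {P : Problem N d p Ξ Z} {v : Variant} {W : Matrix (Fin N) (Fin N) ℝ}
  {L κ σ ρ b₁ b₂ ε a r τ α δ : ℝ} {s : State N d p}

namespace StepSetting

/-- The next averaged upper-level variable. -/
def xnext (L r : ℝ) (s : State N d p) : Vec d := avg s.x - (r / L) • avg s.h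

theorem avg_x (h : StepSetting P v W L κ σ ρ b₁ b₂ ε a r τ α δ s) (w : Fin N → Ξ × Z) :
    avg (next P v W τ α (a / L) (a / L) a δ s w).x = xnext L r s := by
  simp only [next, step]
  rw [avg_mix h.mix, avg_sub, avg_smul, h.rate]
  rfl

theorem avg_y (h : StepSetting P v W L κ σ ρ b₁ b₂ ε a r τ α δ s) (w : Fin N → Ξ × Z) :
    avg (next P v W τ α (a / L) (a / L) a δ s w).y =
      avg s.y - (a / L) • avg fun j => grad2 (P.Gat (w j).2) (s.x j) (s.y j) := by
  simp only [next, step]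
  rw [avg_mix h.mix, avg_sub, avg_smul]

theorem avg_z (h : StepSetting P v W L κ σ ρ b₁ b₂ ε a r τ α δ s) (w : Fin N → Ξ × Z) :
    avg (next P v W τ α (a / L) (a / L) a δ s w).z =
      avg s.z - (a / L) • avg fun j => pH P v δ (w j).2 (s.x j) (s.y j) (s.z j)
        - grad2 (P.Fat (w j).1) (s.x j) (s.y j) := by
  simp only [next, step]
  rw [avg_mix h.mix, avg_sub, avg_smul]

/-- The double minus sign puts the update in the form `A - c • avg` of `integral_avg_noise`. -/
theorem avg_h (w : Fin N → Ξ × Z) :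
    avg (next P v W τ α (a / L) (a / L) a δ s w).h =
      (1 - a) • avg s.h - (-a) • avg fun j => grad1 (P.Fat (w j).1) (s.x j) (s.y j)
        - pJ P v δ (w j).2 (s.x j) (s.y j) (s.z j) := by
  simp only [next, step]
  rw [avg_add, avg_smul, avg_smul, neg_smul, sub_neg_eq_add]

variable (h : StepSetting P v W L κ σ ρ b₁ b₂ ε a r τ α δ s)

omit [MeasurableSpace Ξ] [MeasurableSpace Z] in
theorem sub_xnext_sq : ‖avg s.x - xnext L r s‖ ^ 2 = r ^ 2 * sizeH L s := by
  rw [xnext, sub_sub_cancel, norm_smul, mul_pow, Real.norm_eq_abs, sq_abs, sizeH]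
  ring

include h

theorem prob (j : Fin N) : IsProbabilityMeasure ((P.Df j).prod (P.Dg j)) := by
  have := h.stoch.prob_f j
  have := h.stoch.prob_g j
  infer_instance

theorem a_le_one : a ≤ 1 := by
  have := h.aκ_le
  have := h.a_pos
  have := h.reg.one_le_κ
  nlinarith

theorem aκ_div_le_one : a / κ ≤ 1 := by
  rw [div_le_one h.reg.κ_pos]
  linarith [h.a_le_one, h.reg.one_le_κ]

/-- The update of ȳ is an exact gradient step for g(x̄, ·), perturbed by the use of local points
(consensus error) and by the motion of y⋆, which is at most `κ (r / L) ‖h̄‖`. Dividing by the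
contraction rate `a / κ` gives the coefficients `κ a` and `κ³ r² / a`. -/
theorem errY_next : MeanLE (sampleLaw P)
    (fun w => errY P (next P v W τ α (a / L) (a / L) a δ s w))
    ((1 - a / κ / 2) * errY P s + 6 * κ * a * (cons s.x + cons s.y)
      + 6 * κ ^ 3 * (r ^ 2 / a) * sizeH L s + a ^ 2 / N * (2 * (σ / L) ^ 2)) := by
  have hp := h.prob
  have hL := h.reg.L_pos
  have hκ := h.reg.κ_pos
  have ha := h.a_pos
  have hor := fun j => oracle_y h.stoch j (s.x j) (s.y j)
  refine (MeanLE.of_integral (integral_avg_noise hor (avg s.y - P.ystar (xnext L r s))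
    (a / L))).mono (fun w => ?_) ?_
  · rw [errY, h.avg_y, h.avg_x, sub_right_comm]
  set m := fun j => grad2 (P.g j) (s.x j) (s.y j) with hm
  set x := avg s.x with hx
  set y := avg s.y with hy
  set G := grad2 P.gbar x y with hG
  have h1 : ‖(y - P.ystar x) - (a / L) • G‖ ^ 2 ≤ (1 - a / κ) * errY P s := by
    refine norm_gradient_step_sq_le hL h.reg.one_le_κ ha h.aκ_le ?_ ?_
    · have := h.reg.gbar_mono x y (P.ystar x)
      rwa [h.reg.grad2_ystar, sub_zero] at this
    · have := h.reg.gbar.grad2_sub_le x y x (P.ystar x)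
      rwa [h.reg.grad2_ystar, sub_zero, pdist_right] at this
  have h2 : ‖(a / L) • (G - avg m)‖ ^ 2 ≤ a ^ 2 * (cons s.x + cons s.y) := by
    have e1 : ‖G - avg m‖ ^ 2 ≤ L ^ 2 * (cons s.x + cons s.y) := by
      rw [hG, h.reg.grad2_gbar, ← avg_sub]
      refine (norm_avg_sq_le _).trans ?_
      have e2 : ∀ j, ‖grad2 (P.g j) x y - m j‖ ^ 2 ≤ L ^ 2 • pdist (s.x j) (s.y j) x y ^ 2 := by
        intro j
        rw [norm_sub_rev, smul_eq_mul, ← mul_pow]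
        exact pow_le_pow_left₀ (norm_nonneg _) ((h.reg.g j).grad2_sub_le _ _ _ _) 2
      refine (avg_mono e2).trans (le_of_eq ?_)
      rw [avg_smul, avg_pdist_sq h.reg.nodes]
      simp [hx, hy, cons]
    rw [norm_smul, mul_pow, Real.norm_eq_abs, sq_abs]
    calc _ ≤ (a / L) ^ 2 * (L ^ 2 * (cons s.x + cons s.y)) := by gcongr
      _ = _ := by field_simp
  have h3 : ‖P.ystar x - P.ystar (xnext L r s)‖ ^ 2 ≤ κ ^ 2 * (r ^ 2 * sizeH L s) := by
    rw [← sub_xnext_sq, ← mul_pow]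
    exact pow_le_pow_left₀ (norm_nonneg _) (h.reg.ystar_lip _ _) 2
  have h4 := norm_contracted_add_sq_le (div_pos ha hκ) h.aκ_div_le_one
    (e := (a / L) • (G - avg m)) (e' := P.ystar x - P.ystar (xnext L r s)) (errY_nonneg P s) h1
  have h5 : y - P.ystar (xnext L r s) - (a / L) • avg m =
      y - P.ystar x - (a / L) • G + ((a / L) • (G - avg m) + (P.ystar x - P.ystar (xnext L r s))) := by
    module
  rw [h5, avg_const h.reg.nodes]
  calc _ ≤ (1 - a / κ / 2) * errY P s + 6 / (a / κ) * (a ^ 2 * (cons s.x + cons s.y) +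
        κ ^ 2 * (r ^ 2 * sizeH L s)) + (a / L) ^ 2 / N * (2 * σ ^ 2) := by
        gcongr
        exact h4.trans (by gcongr)
    _ = _ := by field_simp; ring

/-- The variance grows with the iterates `z`. It is expressed through `κ²` and errors that the
Lyapunov function already controls, so no boundedness of `z` is assumed. -/
theorem avg_norm_z_sq_le : avg (fun j => 2 * σ ^ 2 * (1 + ‖s.z j‖ ^ 2)) ≤
    2 * σ ^ 2 * (3 * κ ^ 2 + cons s.z + 2 * errZ P s) := by
  have h1 : ∀ j, 2 * σ ^ 2 * (1 + ‖s.z j‖ ^ 2) = (2 * σ ^ 2) • (1 + ‖s.z j - 0‖ ^ 2) := by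
    intro j; rw [sub_zero, smul_eq_mul]
  simp only [h1]
  rw [avg_smul, avg_add, avg_const h.reg.nodes, avg_sq_eq_spread_add h.reg.nodes, sub_zero,
    smul_eq_mul]
  have h2 : ‖avg s.z‖ ^ 2 ≤ 2 * errZ P s + 2 * κ ^ 2 := by
    have e1 := norm_add_sq_le_two (avg s.z - P.zstar (avg s.x)) (P.zstar (avg s.x))
    rw [sub_add_cancel] at e1
    have e2 := pow_le_pow_left₀ (norm_nonneg _) (h.reg.norm_zstar_le (avg s.x)) 2
    rw [errZ]
    linarith
  have h3 : 1 ≤ κ ^ 2 := one_le_pow₀ h.reg.one_le_κ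
  rw [cons]
  refine mul_le_mul_of_nonneg_left ?_ (by positivity)
  linarith

theorem meanEstimate_z {M : Fin N → Vec p}
    (hM : ∀ j, ‖M j - (hess22 (P.g j) (s.x j) (s.y j) (s.z j) - grad2 (P.f j) (s.x j) (s.y j))‖
      ≤ L * ε) :
    MeanEstimate (fun j => hess22 (P.g j)) (fun j => grad2 (P.f j)) L ε s.x s.y s.z M where
  nodes := h.reg.nodes
  L_nonneg := h.reg.L_pos.le
  norm_T j := (h.reg.g j).norm_hess22_le
  lip_T j := (h.reg.g j).hess22_sub_le
  lip_r j := (h.reg.f j).grad2_sub_le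
  bias := hM

theorem meanEstimate_h {M : Fin N → Vec d}
    (hM : ∀ j, ‖M j - (hess12 (P.g j) (s.x j) (s.y j) (s.z j) - grad1 (P.f j) (s.x j) (s.y j))‖
      ≤ L * ε) :
    MeanEstimate (fun j => hess12 (P.g j)) (fun j => grad1 (P.f j)) L ε s.x s.y s.z M where
  nodes := h.reg.nodes
  L_nonneg := h.reg.L_pos.le
  norm_T j := (h.reg.g j).norm_hess12_le
  lip_T j := (h.reg.g j).hess12_sub_le
  lip_r j := (h.reg.f j).grad1_sub_le
  bias := hM

/-- The contraction comes from the averaged local Hessians at the local points, coercive because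
each node loss is strongly convex. At the reference point the averaged direction vanishes, this
being the equation that defines z⋆ (`h0`). -/
theorem errZ_next : MeanLE (sampleLaw P)
    (fun w => errZ P (next P v W τ α (a / L) (a / L) a δ s w))
    ((1 - a / κ / 2) * errZ P s
      + 18 * κ * a * (cons s.z + 4 * κ ^ 2 * (cons s.x + cons s.y + errY P s) + ε ^ 2)
      + 54 * κ ^ 7 * (r ^ 2 / a) * sizeH L s
      + a ^ 2 / N * (2 * (σ / L) ^ 2 * (3 * κ ^ 2 + cons s.z + 2 * errZ P s))) := by
  have hp := h.prob
  have hL := h.reg.L_pos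
  have hκ := h.reg.κ_pos
  have ha := h.a_pos
  choose M hor hM using fun j => oracle_z (v := v) (δ := δ) h.reg h.stoch h.ε_nonneg j (s.x j)
    (s.y j) (s.z j) (fun hv => ⟨(h.diff hv).1, (h.diff hv).2 j⟩)
  refine (MeanLE.of_integral (integral_avg_noise hor (avg s.z - P.zstar (xnext L r s))
    (a / L))).mono (fun w => ?_) ?_
  · rw [errZ, h.avg_z, h.avg_x, sub_right_comm]
  have hE := (h.meanEstimate_z hM).avg_linearized_sq_le (x₀ := avg s.x) (y₀ := P.ystar (avg s.x))
    h.reg.one_le_κ (h.reg.norm_zstar_le (avg s.x))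
  set x := avg s.x with hx
  set zs := P.zstar x with hzs
  have h0 : avg (fun j => hess22 (P.g j) x (P.ystar x) zs - grad2 (P.f j) x (P.ystar x)) = 0 := by
    rw [avg_sub, ← h.reg.hess22_gbar, ← h.reg.grad2_fbar, h.reg.hess22_zstar, sub_self]
  set G := avg fun j => hess22 (P.g j) (s.x j) (s.y j) (avg s.z - zs) with hG
  rw [h0, sub_zero, sub_self, norm_zero, zero_pow two_ne_zero, add_zero] at hE
  have h1 : ‖(avg s.z - zs) - (a / L) • G‖ ^ 2 ≤ (1 - a / κ) * errZ P s := by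
    refine norm_gradient_step_sq_le hL h.reg.one_le_κ ha h.aκ_le ?_ ?_
    · have e1 : inner ℝ G (avg s.z - zs) =
          avg fun j => inner ℝ (hess22 (P.g j) (s.x j) (s.y j) (avg s.z - zs)) (avg s.z - zs) := by
        generalize avg s.z - zs = u at hG ⊢
        rw [hG]
        simp only [avg, real_inner_smul_left, sum_inner, smul_eq_mul]
      rw [e1, ← avg_const h.reg.nodes (L / κ * ‖avg s.z - zs‖ ^ 2)]
      exact avg_mono fun j => strongConvex_hess (h.reg.g j).diff (h.reg.g j).diff_grad
        (h.reg.convex j _) _ _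
    · refine (norm_avg_le _).trans ?_
      rw [← avg_const h.reg.nodes (L * ‖avg s.z - zs‖)]
      exact avg_mono fun j => (h.meanEstimate_z hM).norm_apply_le j _
  have h2 : ‖(a / L) • (G - avg M)‖ ^ 2 ≤ a ^ 2 * (3 *
      (cons s.z + 4 * κ ^ 2 * (cons s.x + cons s.y + errY P s) + ε ^ 2)) := by
    rw [norm_smul, mul_pow, Real.norm_eq_abs, sq_abs, norm_sub_rev]
    calc _ ≤ (a / L) ^ 2 * _ := mul_le_mul_of_nonneg_left hE (sq_nonneg _)
      _ = _ := by simp only [cons, errY]; field_simp; ring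
  have h3 : ‖P.zstar x - P.zstar (xnext L r s)‖ ^ 2 ≤ 9 * κ ^ 6 * (r ^ 2 * sizeH L s) := by
    rw [← sub_xnext_sq]
    refine (pow_le_pow_left₀ (norm_nonneg _) (h.reg.zstar_lip _ _) 2).trans (le_of_eq ?_)
    ring
  have h4 := norm_contracted_add_sq_le (div_pos ha hκ) h.aκ_div_le_one
    (e := (a / L) • (G - avg M)) (e' := P.zstar x - P.zstar (xnext L r s)) (errZ_nonneg P s) h1
  have h5 : avg s.z - P.zstar (xnext L r s) - (a / L) • avg M =
      avg s.z - zs - (a / L) • G + ((a / L) • (G - avg M) + (P.zstar x - P.zstar (xnext L r s))) := by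
    module
  rw [h5]
  calc _ ≤ (1 - a / κ / 2) * errZ P s + 6 / (a / κ) * (a ^ 2 * (3 *
        (cons s.z + 4 * κ ^ 2 * (cons s.x + cons s.y + errY P s) + ε ^ 2)) +
        9 * κ ^ 6 * (r ^ 2 * sizeH L s)) + (a / L) ^ 2 / N *
        (2 * σ ^ 2 * (3 * κ ^ 2 + cons s.z + 2 * errZ P s)) := by
        refine add_le_add (h4.trans ?_) ?_
        · gcongr
        · gcongr
          exact h.avg_norm_z_sq_le
    _ = _ := by field_simp; ring

theorem errH_next : MeanLE (sampleLaw P)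
    (fun w => errH P L (next P v W τ α (a / L) (a / L) a δ s w))
    ((1 - a) * errH P L s
      + 6 * a * (cons s.z + errZ P s + 4 * κ ^ 2 * (cons s.x + cons s.y + errY P s) + ε ^ 2)
      + 72 * κ ^ 6 * (r ^ 2 / a) * sizeH L s
      + a ^ 2 / N * (2 * (σ / L) ^ 2 * (3 * κ ^ 2 + cons s.z + 2 * errZ P s))) := by
  have hp := h.prob
  have hL := h.reg.L_pos
  have hκ := h.reg.κ_pos
  have ha := h.a_pos
  choose M hor hM using fun j => oracle_h (v := v) (δ := δ) h.reg h.stoch h.ε_nonneg j (s.x j)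
    (s.y j) (s.z j) (fun hv => ⟨(h.diff hv).1, (h.diff hv).2 j⟩)
  set hg := Regular.hyperGrad P (avg s.x) with hhg
  set hg' := Regular.hyperGrad P (xnext L r s) with hhg'
  have hE := (h.meanEstimate_h hM).avg_sub_sq_le (x₀ := avg s.x) (y₀ := P.ystar (avg s.x))
    h.reg.one_le_κ (h.reg.norm_zstar_le (avg s.x))
  have h0 : avg (fun j => hess12 (P.g j) (avg s.x) (P.ystar (avg s.x)) (P.zstar (avg s.x))
      - grad1 (P.f j) (avg s.x) (P.ystar (avg s.x))) = - hg := by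
    rw [avg_sub, ← h.reg.hess12_gbar, ← h.reg.grad1_fbar, hhg, Regular.hyperGrad, neg_sub]
  rw [h0, sub_neg_eq_add, sub_self, norm_zero, zero_pow two_ne_zero, add_zero] at hE
  have hN := MeanLE.of_integral (integral_avg_noise hor ((1 - a) • avg s.h - hg') (-a))
  refine (hN.const_mul (k := 1 / L ^ 2) (by positivity)).mono (fun w => ?_) ?_
  · rw [errH, avg_h, h.avg_x, sub_right_comm, ← hhg']
    exact le_of_eq (by ring)
  have hneg : avg (fun j => - M j) = - avg M := by
    have := avg_smul (-1 : ℝ) M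
    simpa using this
  have h3 : ‖hg - hg'‖ ^ 2 ≤ 36 * L ^ 2 * κ ^ 6 * (r ^ 2 * sizeH L s) := by
    rw [← sub_xnext_sq]
    refine (pow_le_pow_left₀ (norm_nonneg _) (h.reg.hyperGrad_lip _ _) 2).trans (le_of_eq ?_)
    ring
  -- The motion of the target, as `a • a⁻¹ • (hg - hg')`, joins the part of weight `a`. Convexity of
  -- the squared norm then keeps the full factor `1 - a` and charges the motion only `1 / a`.
  have h5 : (1 - a) • avg s.h - hg' - -a • avg (fun j => - M j) =
      (1 - a) • (avg s.h - hg) + a • (-(avg M + hg) + a⁻¹ • (hg - hg')) := by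
    rw [hneg, smul_add a, smul_smul, mul_inv_cancel₀ ha.ne']
    module
  have h6 : ‖(1 - a) • avg s.h - hg' - -a • avg (fun j => - M j)‖ ^ 2 ≤
      (1 - a) * ‖avg s.h - hg‖ ^ 2 + a * (2 * ‖avg M + hg‖ ^ 2
        + 2 * ((a⁻¹) ^ 2 * ‖hg - hg'‖ ^ 2)) := by
    rw [h5]
    refine (norm_convex_sq_le ha.le h.a_le_one _ _).trans ?_
    gcongr
    refine (norm_add_sq_le_two _ _).trans ?_
    rw [norm_neg, norm_smul, mul_pow, Real.norm_eq_abs, sq_abs]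
  have h7 := h.avg_norm_z_sq_le
  calc _ ≤ 1 / L ^ 2 * ((1 - a) * ‖avg s.h - hg‖ ^ 2 + a * (2 * (3 * L ^ 2 * (spread s.z / N +
          ‖avg s.z - P.zstar (avg s.x)‖ ^ 2 + 4 * κ ^ 2 * (spread s.x / N + (spread s.y / N +
          ‖avg s.y - P.ystar (avg s.x)‖ ^ 2)) + ε ^ 2))
        + 2 * ((a⁻¹) ^ 2 * (36 * L ^ 2 * κ ^ 6 * (r ^ 2 * sizeH L s))))
        + (-a) ^ 2 / N * (2 * σ ^ 2 * (3 * κ ^ 2 + cons s.z + 2 * errZ P s))) := by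
        gcongr
        refine h6.trans ?_
        gcongr
    _ = _ := by
        simp only [cons, errY, errZ, errH, ← hhg]
        field_simp
        ring

/-- The update of x̄ uses the old `h`, hence no fresh sample, and the bound holds for every `w`. The
polarisation `-2⟨g, h⟩ = ‖h - g‖² - ‖g‖² - ‖h‖²` yields the two negative terms: `sizeG` is what the
theorem bounds, `sizeH` pays for the motion of the targets. -/
theorem phi_next (w : Fin N → Ξ × Z) :
    P.Phi (avg (next P v W τ α (a / L) (a / L) a δ s w).x) / L ≤ P.Phi (avg s.x) / L
      + r / 2 * (errH P L s - sizeG P L s - sizeH L s) + 5 * κ ^ 3 * r ^ 2 * sizeH L s := by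
  have hL := h.reg.L_pos
  rw [h.avg_x]
  have h1 := (abs_le.1 (h.reg.phi_taylor (avg s.x) (xnext L r s))).2
  rw [norm_sub_rev, sub_xnext_sq] at h1
  have h2 : xnext L r s - avg s.x = -((r / L) • avg s.h) := by rw [xnext]; abel
  rw [h2, inner_neg_right, inner_smul_right] at h1
  have h3 : ‖avg s.h - Regular.hyperGrad P (avg s.x)‖ ^ 2 = ‖avg s.h‖ ^ 2
      - 2 * inner ℝ (Regular.hyperGrad P (avg s.x)) (avg s.h)
      + ‖Regular.hyperGrad P (avg s.x)‖ ^ 2 := by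
    rw [norm_sub_sq_real, real_inner_comm]
  have h4 : r / 2 * (errH P L s - sizeG P L s - sizeH L s) =
      -(r / L * inner ℝ (Regular.hyperGrad P (avg s.x)) (avg s.h)) / L := by
    rw [errH, sizeG, sizeH, h3]
    field_simp
    ring
  rw [h4, ← add_div]
  have h5 : 5 * κ ^ 3 * r ^ 2 * sizeH L s = (5 * L * κ ^ 3 * (r ^ 2 * sizeH L s)) / L := by
    field_simp
  rw [h5, ← add_div]
  gcongr
  linarith

theorem cons_x_next (w : Fin N → Ξ × Z) :
    cons (next P v W τ α (a / L) (a / L) a δ s w).x ≤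
      ρ * cons s.x + ρ ^ 2 / (1 - ρ) * (r ^ 2 * (cons s.h / L ^ 2)) := by
  have hL := h.reg.L_pos
  have h1 := (spread_mix_le h.reg.nodes h.mix _).trans
    (contracted_spread_le h.ρ_nonneg h.ρ_lt s.x s.h (τ * α))
  have h2 : cons (next P v W τ α (a / L) (a / L) a δ s w).x ≤
      (ρ * spread s.x + ρ ^ 2 / (1 - ρ) * ((τ * α) ^ 2 * spread s.h)) / N := by
    rw [cons]
    exact div_le_div_of_nonneg_right h1 (Nat.cast_nonneg N)
  refine h2.trans (le_of_eq ?_)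
  rw [h.rate, cons, cons]
  field_simp

/-- The noise is separated before mixing, because its cross term has mean zero. It therefore carries
only `ρ²`, without the factor `1 / (1 - ρ)` paid by the means. -/
theorem mixed_noise {n : ℕ} {V : Fin N → Ξ × Z → Vec n} {M : Fin N → Vec n} {S : Fin N → ℝ}
    (hor : ∀ j, Oracle ((P.Df j).prod (P.Dg j)) (V j) (M j) (S j)) (Y : Fin N → Vec n) (c : ℝ) :
    MeanLE (sampleLaw P) (fun w => cons fun i => ∑ j, W i j • (Y j - c • V j (w j)))
      (ρ * cons Y + ρ ^ 2 / (1 - ρ) * (c ^ 2 * cons M) + ρ ^ 2 * (c ^ 2 * avg S)) := by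
  have hp := h.prob
  have hN : (N : ℝ) ≠ 0 := by have := h.reg.nodes; positivity
  have h1 := MeanLE.of_integral (integral_spread_noise h.reg.nodes hor Y c)
  refine (h1.const_mul (k := ρ ^ 2 / N) (by positivity)).mono (fun w => ?_) ?_
  · rw [cons, div_mul_eq_mul_div]
    exact div_le_div_of_nonneg_right (spread_mix_le h.reg.nodes h.mix _) (Nat.cast_nonneg N)
  · have h2 := contracted_spread_le h.ρ_nonneg h.ρ_lt Y M c
    have h3 := div_le_div_of_nonneg_right h2 (Nat.cast_nonneg (α := ℝ) N)
    simp only [cons, avg, smul_eq_mul]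
    calc _ = ρ ^ 2 * (spread fun j => Y j - c • M j) / N + ρ ^ 2 * (c ^ 2 * ((N : ℝ)⁻¹ * ∑ j, S j)) := by
          field_simp
      _ ≤ (ρ * spread Y + ρ ^ 2 / (1 - ρ) * (c ^ 2 * spread M)) / N
          + ρ ^ 2 * (c ^ 2 * ((N : ℝ)⁻¹ * ∑ j, S j)) := by gcongr
      _ = _ := by ring

/-- The local gradients are compared at (x̄, ȳ), where the dissimilarity bound also holds, instead
of at y⋆; the error of ȳ therefore does not enter. -/
theorem cons_y_next : MeanLE (sampleLaw P)
    (fun w => cons (next P v W τ α (a / L) (a / L) a δ s w).y)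
    (ρ * cons s.y + ρ ^ 2 / (1 - ρ) * (a ^ 2 * (2 * (cons s.x + cons s.y) + 2 * (b₂ / L) ^ 2))
      + ρ ^ 2 * (a ^ 2 * (2 * (σ / L) ^ 2))) := by
  have hL := h.reg.L_pos
  have hρ : 0 < 1 - ρ := by linarith [h.ρ_lt]
  refine (h.mixed_noise (fun j => oracle_y h.stoch j (s.x j) (s.y j)) s.y (a / L)).mono
    (fun w => le_rfl) ?_
  set x := avg s.x with hx
  set y := avg s.y with hy
  have h1 : cons (fun j => grad2 (P.g j) (s.x j) (s.y j)) ≤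
      2 * L ^ 2 * (cons s.x + cons s.y) + 2 * b₂ ^ 2 := by
    refine (spread_le_avg h.reg.nodes _ (grad2 P.gbar x y)).trans ?_
    have e1 : ∀ j, ‖grad2 (P.g j) (s.x j) (s.y j) - grad2 P.gbar x y‖ ^ 2 ≤
        (2 * L ^ 2) • pdist (s.x j) (s.y j) x y ^ 2 +
          (2 : ℝ) • ‖grad2 (P.g j) x y - grad2 P.gbar x y‖ ^ 2 := by
      intro j
      have e2 := norm_add_sq_le_two (grad2 (P.g j) (s.x j) (s.y j) - grad2 (P.g j) x y)
        (grad2 (P.g j) x y - grad2 P.gbar x y)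
      rw [sub_add_sub_cancel] at e2
      have e3 := pow_le_pow_left₀ (norm_nonneg _)
        ((h.reg.g j).grad2_sub_le (s.x j) (s.y j) x y) 2
      simp only [smul_eq_mul]
      linarith
    refine (avg_mono e1).trans ?_
    rw [avg_add, avg_smul, avg_smul, avg_pdist_sq h.reg.nodes]
    have e4 := h.diss.g2 x y
    simp only [← hx, ← hy, sub_self, norm_zero, smul_eq_mul, cons]
    norm_num
    linarith
  rw [avg_const h.reg.nodes]
  calc _ ≤ ρ * cons s.y + ρ ^ 2 / (1 - ρ) * ((a / L) ^ 2 *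
        (2 * L ^ 2 * (cons s.x + cons s.y) + 2 * b₂ ^ 2)) + ρ ^ 2 * ((a / L) ^ 2 * (2 * σ ^ 2)) := by
        gcongr
    _ = _ := by field_simp

omit h in
/-- The bound on the dissimilarity of the means of the estimates. -/
def meanSpread (P : Problem N d p Ξ Z) (L κ b₁ b₂ ε : ℝ) (s : State N d p) : ℝ :=
  6 * (cons s.z + errZ P s + 4 * κ ^ 2 * (cons s.x + cons s.y + errY P s) + ε ^ 2)
    + 4 * (κ ^ 2 * (b₂ / L) ^ 2 + (b₁ / L) ^ 2)

theorem cons_mean_z_le {M : Fin N → Vec p}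
    (hM : ∀ j, ‖M j - (hess22 (P.g j) (s.x j) (s.y j) (s.z j) - grad2 (P.f j) (s.x j) (s.y j))‖
      ≤ L * ε) : cons M ≤ L ^ 2 * meanSpread P L κ b₁ b₂ ε s := by
  have hL := h.reg.L_pos
  refine ((h.meanEstimate_z hM).spread_le (x₀ := avg s.x) (y₀ := P.ystar (avg s.x))
    h.reg.one_le_κ (h.reg.norm_zstar_le (avg s.x)) (h.diss.g22 _ _) (h.diss.f2 _ _)).trans
    (le_of_eq ?_)
  simp only [sub_self, norm_zero, meanSpread, cons, errY, errZ]
  field_simp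
  ring

theorem cons_mean_h_le {M : Fin N → Vec d}
    (hM : ∀ j, ‖M j - (hess12 (P.g j) (s.x j) (s.y j) (s.z j) - grad1 (P.f j) (s.x j) (s.y j))‖
      ≤ L * ε) : cons M ≤ L ^ 2 * meanSpread P L κ b₁ b₂ ε s := by
  have hL := h.reg.L_pos
  refine ((h.meanEstimate_h hM).spread_le (x₀ := avg s.x) (y₀ := P.ystar (avg s.x))
    h.reg.one_le_κ (h.reg.norm_zstar_le (avg s.x)) (h.diss.g12 _ _) (h.diss.f1 _ _)).trans
    (le_of_eq ?_)
  simp only [sub_self, norm_zero, meanSpread, cons, errY, errZ]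
  field_simp
  ring

theorem cons_z_next : MeanLE (sampleLaw P)
    (fun w => cons (next P v W τ α (a / L) (a / L) a δ s w).z)
    (ρ * cons s.z + ρ ^ 2 / (1 - ρ) * (a ^ 2 * meanSpread P L κ b₁ b₂ ε s)
      + ρ ^ 2 * (a ^ 2 * (2 * (σ / L) ^ 2 * (3 * κ ^ 2 + cons s.z + 2 * errZ P s)))) := by
  have hL := h.reg.L_pos
  have hρ : 0 < 1 - ρ := by linarith [h.ρ_lt]
  choose M hor hM using fun j => oracle_z (v := v) (δ := δ) h.reg h.stoch h.ε_nonneg j (s.x j)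
    (s.y j) (s.z j) (fun hv => ⟨(h.diff hv).1, (h.diff hv).2 j⟩)
  refine (h.mixed_noise hor s.z (a / L)).mono (fun w => le_rfl) ?_
  have h1 := h.cons_mean_z_le hM
  have h2 := h.avg_norm_z_sq_le
  calc _ ≤ ρ * cons s.z + ρ ^ 2 / (1 - ρ) * ((a / L) ^ 2 * (L ^ 2 * meanSpread P L κ b₁ b₂ ε s))
        + ρ ^ 2 * ((a / L) ^ 2 * (2 * σ ^ 2 * (3 * κ ^ 2 + cons s.z + 2 * errZ P s))) := by gcongr
    _ = _ := by field_simp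

/-- The variable `h` is not mixed, so its consensus error contracts only by `1 - a` and need not
become small. This is harmless because it reaches the other variables only through x, with the
factor `r²`. -/
theorem cons_h_next : MeanLE (sampleLaw P)
    (fun w => cons (next P v W τ α (a / L) (a / L) a δ s w).h / L ^ 2)
    ((1 - a) * (cons s.h / L ^ 2) + a * meanSpread P L κ b₁ b₂ ε s
      + a ^ 2 * (2 * (σ / L) ^ 2 * (3 * κ ^ 2 + cons s.z + 2 * errZ P s))) := by
  have hp := h.prob
  have hL := h.reg.L_pos
  have ha := h.a_pos
  have hN : (0 : ℝ) < N := by have := h.reg.nodes; positivity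
  choose M hor hM using fun j => oracle_h (v := v) (δ := δ) h.reg h.stoch h.ε_nonneg j (s.x j)
    (s.y j) (s.z j) (fun hv => ⟨(h.diff hv).1, (h.diff hv).2 j⟩)
  have h1 := MeanLE.of_integral (integral_spread_noise h.reg.nodes hor
    (fun j => (1 - a) • s.h j) (-a))
  refine (h1.const_mul (k := 1 / (N * L ^ 2)) (by positivity)).mono (fun w => le_of_eq ?_) ?_
  · have e : (fun j => (1 - a) • s.h j - -a • (grad1 (P.Fat (w j).1) (s.x j) (s.y j)
        - pJ P v δ (w j).2 (s.x j) (s.y j) (s.z j))) =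
        (next P v W τ α (a / L) (a / L) a δ s w).h := by
      funext j
      simp only [next, step, neg_smul, sub_neg_eq_add]
    rw [e, cons]
    field_simp
  · have h2 : (spread fun j => (1 - a) • s.h j - -a • -M j) ≤
        (1 - a) * spread s.h + a * spread M := by
      simp only [spread, Finset.mul_sum, ← Finset.sum_add_distrib]
      refine Finset.sum_le_sum fun i _ => ?_
      have e1 := norm_convex_sq_le ha.le h.a_le_one (s.h i - avg s.h) (-(M i - avg M))
      rw [norm_neg] at e1
      refine (le_of_eq ?_).trans e1
      have e2 : avg (fun j => (1 - a) • s.h j - -a • -M j) = (1 - a) • avg s.h - a • avg M := by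
        rw [← avg_smul, ← avg_smul, ← avg_sub]
        congr 1
        funext j
        module
      rw [e2]
      congr 2
      module
    have h3 := h.cons_mean_h_le hM
    have h4 := h.avg_norm_z_sq_le
    calc _ ≤ 1 / (N * L ^ 2) * (((1 - a) * spread s.h + a * spread M)
          + (-a) ^ 2 * ∑ j, 2 * σ ^ 2 * (1 + ‖s.z j‖ ^ 2)) := by gcongr
      _ = (1 - a) * (cons s.h / L ^ 2) + a * (cons M / L ^ 2)
          + a ^ 2 / L ^ 2 * avg (fun j => 2 * σ ^ 2 * (1 + ‖s.z j‖ ^ 2)) := by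
          simp only [cons, avg, smul_eq_mul]
          field_simp
      _ ≤ (1 - a) * (cons s.h / L ^ 2) + a * (L ^ 2 * meanSpread P L κ b₁ b₂ ε s / L ^ 2)
          + a ^ 2 / L ^ 2 * (2 * σ ^ 2 * (3 * κ ^ 2 + cons s.z + 2 * errZ P s)) := by gcongr
      _ = _ := by field_simp

end StepSetting

end Scalars

end DSOBA

end

/-! ### The Lyapunov function and its drift -/

noncomputable section

namespace DSOBA

set_option maxHeartbeats 2000000 in
/-- The drift of the Lyapunov function, divided by the step size: with the chosen weights, the
negative terms absorb all the errors. -/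
theorem drift_le {κ t a ν ψ ω S E B₁ B₂ Py Pz Ph H G u dz dh NZ MS : ℝ}
    (hκ : 1 ≤ κ) (ht : 0 ≤ t) (htκ : κ ^ 4 * t ≤ 1 / 500) (ha : 0 ≤ a) (hS : 0 ≤ S)
    (haκ : a * κ * (1000 * (1 + S)) ≤ 1) (hν : 0 ≤ ν) (hνa : ν ≤ a) (hψ : 0 ≤ ψ)
    (hψκ : κ ^ 2 * ψ ≤ 1 / 250000) (hω : 0 ≤ ω) (hωκ : κ ^ 2 * ω * (1 + S) ≤ 1 / 500000)
    (hψω : ψ * a ≤ 2 * ω) (hE : 0 ≤ E) (hB₁ : 0 ≤ B₁) (hB₂ : 0 ≤ B₂) (hPy : 0 ≤ Py)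
    (hPz : 0 ≤ Pz) (hPh : 0 ≤ Ph) (hH : 0 ≤ H) (hu : 0 ≤ u) (hdz : 0 ≤ dz)
    (hNZ : NZ = 2 * S * (3 * κ ^ 2 + dz + 2 * Pz))
    (hMS : MS = 6 * (dz + Pz + 4 * κ ^ 2 * (u + Py) + E) + 4 * (κ ^ 2 * B₂ + B₁)) :
    1 / 2 * (Ph - G - H) + 5 * κ ^ 3 * (t * a) * H
      + (-Ph + 6 * (dz + Pz + 4 * κ ^ 2 * (u + Py) + E) + 72 * κ ^ 6 * t ^ 2 * H + ν * NZ)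
      + (-8 * Pz + 288 * κ ^ 2 * (dz + 4 * κ ^ 2 * (u + Py) + E) + 864 * κ ^ 8 * t ^ 2 * H
        + 16 * κ * ν * NZ)
      + (-1500 * κ ^ 4 * Py + 18000 * κ ^ 6 * u + 18000 * κ ^ 8 * t ^ 2 * H
        + 3000 * κ ^ 5 * ν * (2 * S))
      + 20000 * (-κ ^ 6 * u + κ ^ 6 * ψ * t ^ 2 * dh + κ ^ 6 * ψ * (2 * u + 2 * B₂)
        + κ ^ 6 * ω * (2 * S))
      + 20000 * (-κ ^ 2 * dz + κ ^ 2 * ψ * MS + κ ^ 2 * ω * NZ)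
      + 20000 * κ ^ 6 * t ^ 2 * ψ * (-dh + MS + a * NZ)
    ≤ -(1 / 2) * G + 300000 * (S * κ ^ 5 * ν + S * κ ^ 6 * ω + ψ * (κ ^ 2 * B₁ + κ ^ 6 * B₂)
        + κ ^ 2 * E) := by
  subst hNZ hMS
  have hκ0 : 0 < κ := by linarith
  -- All motions of the targets contribute powers of `q`, and `q ≤ 1 / 500` makes them small against
  -- the coefficient `-1/2` of `H`.
  set q := κ ^ 4 * t with hq
  have hq0 : 0 ≤ q := by positivity
  have hq2 : q ^ 2 ≤ 1 / 250000 := by nlinarith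
  have k2 : 1 ≤ κ ^ 2 := one_le_pow₀ hκ
  have k4 : 1 ≤ κ ^ 4 := one_le_pow₀ hκ
  have k24 : κ ^ 2 ≤ κ ^ 4 := pow_le_pow_right₀ hκ (by norm_num)
  have k26 : κ ^ 2 ≤ κ ^ 6 := pow_le_pow_right₀ hκ (by norm_num)
  have k46 : κ ^ 4 ≤ κ ^ 6 := pow_le_pow_right₀ hκ (by norm_num)
  have k25 : κ ^ 2 ≤ κ ^ 5 := pow_le_pow_right₀ hκ (by norm_num)
  have k35 : κ ^ 3 ≤ κ ^ 5 := pow_le_pow_right₀ hκ (by norm_num)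
  have k34 : κ ^ 3 ≤ κ ^ 4 := pow_le_pow_right₀ hκ (by norm_num)
  have haS : a * κ * 1000 + a * κ * S * 1000 ≤ 1 := by linarith
  have haκS : 0 ≤ a * κ * S := by positivity
  have haκ0 : 0 ≤ a * κ := by positivity
  have ha1 : a ≤ 1 := by nlinarith
  have hνS : ν * S * κ ≤ 1 / 1000 := by
    have : ν * S * κ ≤ a * S * κ := by gcongr
    nlinarith
  have hνS1 : ν * S ≤ 1 / 1000 := by
    refine le_trans ?_ hνS
    exact le_mul_of_one_le_right (by positivity) hκ
  have haS1 : a * S ≤ 1 / 1000 := by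
    have : a * S ≤ a * S * κ := le_mul_of_one_le_right (by positivity) hκ
    nlinarith
  have hωS : κ ^ 2 * ω * S ≤ 1 / 500000 := by
    have : 0 ≤ κ ^ 2 * ω := by positivity
    nlinarith
  have t2 : κ ^ 8 * t ^ 2 = q ^ 2 := by rw [hq]; ring
  have t62 : κ ^ 6 * t ^ 2 ≤ q ^ 2 := by
    rw [← t2]
    have : κ ^ 6 ≤ κ ^ 8 := pow_le_pow_right₀ hκ (by norm_num)
    gcongr
  have t42 : κ ^ 4 * t ^ 2 ≤ 1 := by
    have : κ ^ 4 * t ^ 2 ≤ κ ^ 8 * t ^ 2 := by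
      have : κ ^ 4 ≤ κ ^ 8 := pow_le_pow_right₀ hκ (by norm_num)
      gcongr
    linarith
  have hta : κ ^ 3 * (t * a) ≤ q := by
    calc κ ^ 3 * (t * a) ≤ κ ^ 4 * (t * 1) := by gcongr
      _ = q := by rw [hq]; ring
  set χ := κ ^ 6 * t ^ 2 * ψ with hχ
  have hχ0 : 0 ≤ χ := by positivity
  have hχψ : χ ≤ κ ^ 2 * ψ := by
    calc χ = κ ^ 2 * ψ * (κ ^ 4 * t ^ 2) := by rw [hχ]; ring
      _ ≤ κ ^ 2 * ψ * 1 := by gcongr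
      _ = _ := mul_one _
  have hχ1 : χ ≤ 1 / 250000 * (1 / 250000) := by
    calc χ ≤ q ^ 2 * ψ := by rw [hχ]; gcongr
      _ ≤ q ^ 2 * (κ ^ 2 * ψ) := by
          gcongr
          exact le_mul_of_one_le_left hψ k2
      _ ≤ _ := by gcongr
  have hχaS : χ * (a * S) ≤ 1 / 250000 * (1 / 250000) := by
    calc χ * (a * S) ≤ χ * 1 := by gcongr; linarith
      _ ≤ _ := by linarith
  have hψ1 : ψ ≤ 1 / 250000 := by nlinarith
  -- From here on the terms are sorted by error quantity. Each of `H`, `Pz`, `Py`, `u`, `dz` has a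
  -- dominant negative coefficient (`-1/2`, `-2`, `-1500 κ⁴`, `-20000 κ⁶`, `-20000 κ²`); the terms
  -- in `E`, `S`, `B₁`, `B₂` form the right-hand side.
  have cH : (-(1 / 2) + 5 * (κ ^ 3 * (t * a)) + 72 * (κ ^ 6 * t ^ 2) + 864 * (κ ^ 8 * t ^ 2)
      + 18000 * (κ ^ 8 * t ^ 2)) * H ≤ 0 := by
    refine mul_nonpos_of_nonpos_of_nonneg ?_ hH
    rw [t2]
    linarith
  have cPz : (-2 + 4 * (ν * S) + 64 * (ν * S * κ) + 120000 * (κ ^ 2 * ψ)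
      + 80000 * (κ ^ 2 * ω * S) + 120000 * χ + 80000 * (χ * (a * S))) * Pz ≤ 0 := by
    refine mul_nonpos_of_nonpos_of_nonneg ?_ hPz
    linarith
  have cPy : (24 * κ ^ 2 + 1152 * κ ^ 4 - 1500 * κ ^ 4 + 480000 * (κ ^ 2 * (κ ^ 2 * ψ))
      + 480000 * (κ ^ 2 * χ)) * Py ≤ 0 := by
    refine mul_nonpos_of_nonpos_of_nonneg ?_ hPy
    have h1 : κ ^ 2 * (κ ^ 2 * ψ) ≤ κ ^ 4 * (1 / 250000) := by gcongr
    have h2 : κ ^ 2 * χ ≤ κ ^ 4 * (1 / 250000) := by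
      calc _ ≤ κ ^ 2 * (κ ^ 2 * ψ) := by gcongr
        _ ≤ _ := h1
    linarith
  have cu : (24 * κ ^ 2 + 1152 * κ ^ 4 + 18000 * κ ^ 6 - 20000 * κ ^ 6 + 40000 * (κ ^ 6 * ψ)
      + 480000 * (κ ^ 2 * (κ ^ 2 * ψ)) + 480000 * (κ ^ 2 * χ)) * u ≤ 0 := by
    refine mul_nonpos_of_nonpos_of_nonneg ?_ hu
    have h1 : κ ^ 2 * (κ ^ 2 * ψ) ≤ κ ^ 6 * (1 / 250000) := by gcongr
    have h2 : κ ^ 2 * χ ≤ κ ^ 6 * (1 / 250000) := by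
      calc _ ≤ κ ^ 2 * (κ ^ 2 * ψ) := by gcongr
        _ ≤ _ := h1
    have h3 : κ ^ 6 * ψ ≤ κ ^ 6 * (1 / 250000) := by gcongr
    linarith
  have cdz : (6 + 288 * κ ^ 2 - 20000 * κ ^ 2 + 2 * (ν * S) + 32 * (ν * S * κ)
      + 120000 * (κ ^ 2 * ψ) + 40000 * (κ ^ 2 * ω * S) + 120000 * χ + 40000 * (χ * (a * S))) * dz
      ≤ 0 := by
    refine mul_nonpos_of_nonpos_of_nonneg ?_ hdz
    linarith
  have cE : (6 + 288 * κ ^ 2 + 120000 * (κ ^ 2 * ψ) + 120000 * χ) * E ≤ 300000 * κ ^ 2 * E := by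
    gcongr
    linarith
  have cν : 6 * (κ ^ 2 * (ν * S)) + 96 * (κ ^ 3 * (ν * S)) + 6000 * (κ ^ 5 * (ν * S)) ≤
      300000 * (S * κ ^ 5 * ν) := by
    have h1 : κ ^ 2 * (ν * S) ≤ κ ^ 5 * (ν * S) := by gcongr
    have h2 : κ ^ 3 * (ν * S) ≤ κ ^ 5 * (ν * S) := by gcongr
    have h3 : 0 ≤ κ ^ 5 * (ν * S) := by positivity
    linarith
  have cω : 40000 * (κ ^ 6 * ω * S) + 120000 * (κ ^ 4 * ω * S) + 120000 * (κ ^ 2 * (χ * (a * S)))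
      ≤ 300000 * (S * κ ^ 6 * ω) := by
    have h1 : κ ^ 4 * ω * S ≤ κ ^ 6 * ω * S := by gcongr
    -- This is the noise of `h` felt through the consensus error of x; `ψ a ≤ 2 ω` reduces it to the
    -- noise already present in the consensus errors.
    have h2 : κ ^ 2 * (χ * (a * S)) ≤ 1 * (κ ^ 6 * ω * S) := by
      calc κ ^ 2 * (χ * (a * S)) = (κ ^ 8 * t ^ 2) * (ψ * a) * S := by rw [hχ]; ring
        _ ≤ (1 / 250000) * (2 * ω) * S := by rw [t2]; gcongr
        _ ≤ 1 * (ω * S) := by have : 0 ≤ ω * S := by positivity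
                              linarith
        _ ≤ 1 * (κ ^ 6 * (ω * S)) := by
            rw [one_mul, one_mul]
            exact le_mul_of_one_le_left (by positivity) (one_le_pow₀ hκ)
        _ = _ := by ring
    have h3 : 0 ≤ κ ^ 6 * ω * S := by positivity
    linarith
  have cB : 40000 * (κ ^ 6 * ψ * B₂) + 80000 * (κ ^ 2 * ψ * (κ ^ 2 * B₂ + B₁))
      + 80000 * (χ * (κ ^ 2 * B₂ + B₁)) ≤ 300000 * (ψ * (κ ^ 2 * B₁ + κ ^ 6 * B₂)) := by
    have h1 : χ * (κ ^ 2 * B₂ + B₁) ≤ κ ^ 2 * ψ * (κ ^ 2 * B₂ + B₁) := by gcongr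
    have h2 : κ ^ 2 * ψ * (κ ^ 2 * B₂ + B₁) ≤ ψ * (κ ^ 2 * B₁ + κ ^ 6 * B₂) := by
      calc _ = ψ * (κ ^ 2 * B₁ + κ ^ 4 * B₂) := by ring
        _ ≤ _ := by gcongr
    have h3 : κ ^ 6 * ψ * B₂ ≤ ψ * (κ ^ 2 * B₁ + κ ^ 6 * B₂) := by
      have : 0 ≤ ψ * (κ ^ 2 * B₁) := by positivity
      linarith
    have h4 : 0 ≤ ψ * (κ ^ 2 * B₁ + κ ^ 6 * B₂) := by positivity
    linarith
  have e1 : 20000 * κ ^ 6 * t ^ 2 * ψ * (-dh + (6 * (dz + Pz + 4 * κ ^ 2 * (u + Py) + E)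
      + 4 * (κ ^ 2 * B₂ + B₁)) + a * (2 * S * (3 * κ ^ 2 + dz + 2 * Pz))) =
      20000 * χ * (-dh + (6 * (dz + Pz + 4 * κ ^ 2 * (u + Py) + E)
      + 4 * (κ ^ 2 * B₂ + B₁)) + a * (2 * S * (3 * κ ^ 2 + dz + 2 * Pz))) := by
    rw [hχ]; ring
  -- The consensus error of `h` cancels exactly: the weight of `cons h` is chosen so that its decay
  -- equals its contribution to the consensus error of x.
  have e2 : κ ^ 6 * ψ * t ^ 2 * dh = χ * dh := by rw [hχ]; ring
  rw [e1, e2]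
  clear_value χ
  -- The coefficient of `Ph` is `1/2 - 1`; the surplus `-1/2 * Ph` is dropped by `hPh`.
  linear_combination cH + cPz + cPy + cu + cdz + cE + cν + cω + cB + 1 / 2 * hPh

section Lyapunov

variable {N d p : ℕ} {Ξ Z : Type*} [MeasurableSpace Ξ] [MeasurableSpace Z]

/-- The Lyapunov function, with `t = r / a` and the optimality gap measured from the level `Φ₀`. -/
def lyapunov (P : Problem N d p Ξ Z) (L κ ρ a t Φ₀ : ℝ) (s : State N d p) : ℝ :=
  (P.Phi (avg s.x) - Φ₀) / L + t * errH P L s + 16 * κ * t * errZ P s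
    + 3000 * κ ^ 5 * t * errY P s
    + 20000 * κ ^ 2 * (t * a) * (1 - ρ)⁻¹ * (κ ^ 4 * (cons s.x + cons s.y) + cons s.z)
    + 20000 * κ ^ 6 * t ^ 3 * (ρ * a * (1 - ρ)⁻¹) ^ 2 * (cons s.h / L ^ 2)

/-- The error of one iteration. -/
def stepError (N : ℕ) (L κ σ ρ b₁ b₂ ε a : ℝ) : ℝ :=
  300000 * ((σ / L) ^ 2 * κ ^ 5 * (a / N) + (σ / L) ^ 2 * κ ^ 6 * (ρ ^ 2 * a ^ 2 * (1 - ρ)⁻¹)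
    + (ρ * a * (1 - ρ)⁻¹) ^ 2 * (κ ^ 2 * (b₁ / L) ^ 2 + κ ^ 6 * (b₂ / L) ^ 2) + κ ^ 2 * ε ^ 2)

variable {P : Problem N d p Ξ Z} {v : Variant} {W : Matrix (Fin N) (Fin N) ℝ}
  {L κ σ ρ b₁ b₂ ε a r τ α δ : ℝ} {s : State N d p}

/-- Combine the one-step bounds with the Lyapunov weights; after division by `r = t a` the change is
the left side of `drift_le`. -/
theorem StepSetting.lyapunov_next (h : StepSetting P v W L κ σ ρ b₁ b₂ ε a r τ α δ s) {t : ℝ}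
    (ht : r = t * a) (htκ : κ ^ 4 * t ≤ 1 / 500)
    (haκ : a * κ * (1000 * (1 + (σ / L) ^ 2)) ≤ 1) (hρa : ρ * a * (1 - ρ)⁻¹ * κ ≤ 1 / 500)
    (Φ₀ : ℝ) :
    MeanLE (sampleLaw P)
      (fun w => lyapunov P L κ ρ a t Φ₀ (next P v W τ α (a / L) (a / L) a δ s w))
      (lyapunov P L κ ρ a t Φ₀ s + r * (-(1 / 2) * sizeG P L s + stepError N L κ σ ρ b₁ b₂ ε a)) := by
  have hp := h.prob
  have hprob : IsProbabilityMeasure (sampleLaw P) := by rw [sampleLaw]; infer_instance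
  have hL := h.reg.L_pos
  have hκ := h.reg.one_le_κ
  have hκ0 := h.reg.κ_pos
  have ha := h.a_pos
  have hN : (1 : ℝ) ≤ N := by exact_mod_cast h.reg.nodes
  have hρ0 := h.ρ_nonneg
  have ht0 : 0 < t := by
    have := h.r_pos
    rw [ht] at this
    exact pos_of_mul_pos_left this ha.le
  have hρ1 : 0 < 1 - ρ := by linarith [h.ρ_lt]
  set e := (1 - ρ)⁻¹ with he
  have he0 : 0 < e := inv_pos.2 hρ1
  have hee : (1 - ρ) * e = 1 := mul_inv_cancel₀ hρ1.ne'
  have hdiv : ∀ c : ℝ, c / (1 - ρ) = c * e := fun c => div_eq_mul_inv _ _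
  have mx := MeanLE.const (D := sampleLaw P)
    (ρ * cons s.x + ρ ^ 2 / (1 - ρ) * (r ^ 2 * (cons s.h / L ^ 2)))
  have mF := MeanLE.const (D := sampleLaw P) ((P.Phi (avg s.x) / L
    + r / 2 * (errH P L s - sizeG P L s - sizeH L s) + 5 * κ ^ 3 * r ^ 2 * sizeH L s) - Φ₀ / L)
  have m1 := h.errH_next.const_mul (k := t) ht0.le
  have m2 := h.errZ_next.const_mul (k := 16 * κ * t) (by positivity)
  have m3 := h.errY_next.const_mul (k := 3000 * κ ^ 5 * t) (by positivity)
  have m4 := (((mx.add h.cons_y_next).const_mul (k := κ ^ 4) (by positivity)).add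
    h.cons_z_next).const_mul (k := 20000 * κ ^ 2 * (t * a) * e) (by positivity)
  have m5 := h.cons_h_next.const_mul (k := 20000 * κ ^ 6 * t ^ 3 * (ρ * a * e) ^ 2)
    (by positivity)
  refine (((((mF.add m1).add m2).add m3).add m4).add m5).mono (fun w => ?_) ?_
  · rw [lyapunov, ← he]
    have h1 := h.phi_next w
    have h2 := h.cons_x_next w
    rw [sub_div]
    gcongr
  -- Here `ν` is the averaged noise level, `ψ` the squared consensus response to a persistent
  -- disagreement, and `ω` the consensus response to noise.
  have hd := drift_le (κ := κ) (t := t) (a := a) (ν := a / N) (ψ := (ρ * a * e) ^ 2)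
    (ω := ρ ^ 2 * a ^ 2 * e) (S := (σ / L) ^ 2) (E := ε ^ 2) (B₁ := (b₁ / L) ^ 2)
    (B₂ := (b₂ / L) ^ 2) (Py := errY P s) (Pz := errZ P s) (Ph := errH P L s)
    (H := sizeH L s) (G := sizeG P L s) (u := cons s.x + cons s.y) (dz := cons s.z)
    (dh := cons s.h / L ^ 2) (NZ := 2 * (σ / L) ^ 2 * (3 * κ ^ 2 + cons s.z + 2 * errZ P s))
    (MS := meanSpread P L κ b₁ b₂ ε s)
    hκ ht0.le htκ ha.le (sq_nonneg _) haκ (by positivity) (div_le_self ha.le hN) (sq_nonneg _)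
    (by
      calc κ ^ 2 * (ρ * a * e) ^ 2 = (ρ * a * e * κ) ^ 2 := by ring
        _ ≤ (1 / 500) ^ 2 := by gcongr
        _ = _ := by norm_num)
    (by positivity)
    (by
      have h1 : 0 < 1 + (σ / L) ^ 2 := by positivity
      have h2 : ρ ≤ 1 := h.ρ_lt.le
      have h3 : ρ * a * e * κ * (a * κ * (1000 * (1 + (σ / L) ^ 2))) ≤ 1 / 500 * 1 := by gcongr
      have h4 : κ ^ 2 * (ρ ^ 2 * a ^ 2 * e) * (1 + (σ / L) ^ 2) =
          ρ * (ρ * a * e * κ * (a * κ * (1 + (σ / L) ^ 2))) := by ring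
      rw [h4]
      have h5 : 0 ≤ ρ * a * e * κ * (a * κ * (1 + (σ / L) ^ 2)) := by positivity
      calc _ ≤ 1 * (ρ * a * e * κ * (a * κ * (1 + (σ / L) ^ 2))) := by gcongr
        _ ≤ _ := by linarith)
    (by
      have h1 : a * e ≤ 2 := by
        -- Since `e = 1 + ρ e`, the bounds on `a` and on `ρ a e` control `a e`, although `a` alone
        -- does not compensate `1 / (1 - ρ)`.
        have h2 : a * e = a + ρ * a * e := by linear_combination a * hee
        have h3 : ρ * a * e ≤ ρ * a * e * κ := le_mul_of_one_le_right (by positivity) hκ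
        have := h.a_le_one
        linarith
      calc (ρ * a * e) ^ 2 * a = ρ ^ 2 * a ^ 2 * e * (a * e) := by ring
        _ ≤ ρ ^ 2 * a ^ 2 * e * 2 := by gcongr
        _ = _ := by ring)
    (sq_nonneg _) (sq_nonneg _) (sq_nonneg _) (errY_nonneg P s) (errZ_nonneg P s)
    (errH_nonneg P L s) (sizeH_nonneg L s) (add_nonneg (cons_nonneg _) (cons_nonneg _))
    (cons_nonneg _) rfl rfl
  have hd2 := mul_le_mul_of_nonneg_left hd h.r_pos.le
  refine le_trans (le_of_eq ?_) (add_le_add_right (hd2.trans_eq ?_) _)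
  · rw [lyapunov, ← he, hdiv, ht]
    generalize meanSpread P L κ b₁ b₂ ε s = MS
    generalize errY P s = Py
    generalize errZ P s = Pz
    generalize errH P L s = Ph
    generalize sizeH L s = H
    generalize sizeG P L s = G
    generalize cons s.x = dx
    generalize cons s.y = dy
    generalize cons s.z = dz
    generalize cons s.h / L ^ 2 = dh
    have e1 : (t * a) ^ 2 / a = t ^ 2 * a := by field_simp
    have e2 : a / κ / 2 * κ = a / 2 := by field_simp
    rw [e1]
    generalize a / κ / 2 = c at e2
    have e3 : a ^ 2 / (N : ℝ) = a * (a / N) := by ring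
    rw [e3]
    generalize a / (N : ℝ) = ν
    -- With weight `e`, a contraction by `ρ` yields the decrement `(1 - ρ) e = 1`; `e2` does the
    -- same for the rate `a / (2κ)` of ȳ and z̄.
    linear_combination (-20000 * κ ^ 2 * (t * a) * (κ ^ 4 * (dx + dy) + dz)) * hee
      - (16 * t * Pz + 3000 * κ ^ 4 * t * Py) * e2
  · rw [stepError, ← he]

end Lyapunov

end DSOBA

end

noncomputable section

namespace DSOBA

/-! ### Measurability of states, iterates and the Lyapunov function -/

section StateSpace

variable {N d p : ℕ}

/-- The state as a tuple. -/
def State.toTuple (s : State N d p) :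
    (Fin N → Vec d) × (Fin N → Vec p) × (Fin N → Vec p) × (Fin N → Vec d) :=
  (s.x, s.y, s.z, s.h)

instance : MeasurableSpace (State N d p) := MeasurableSpace.comap State.toTuple inferInstance

theorem measurable_toTuple : Measurable (State.toTuple : State N d p → _) := comap_measurable _

theorem State.measurable_x : Measurable (State.x : State N d p → _) := measurable_toTuple.fst

theorem State.measurable_y : Measurable (State.y : State N d p → _) := measurable_toTuple.snd.fst

theorem State.measurable_z : Measurable (State.z : State N d p → _) :=
  measurable_toTuple.snd.snd.fst

theorem State.measurable_h : Measurable (State.h : State N d p → _) :=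
  measurable_toTuple.snd.snd.snd

theorem measurable_state {A : Type*} [MeasurableSpace A] {s : A → State N d p}
    (hx : ∀ i, Measurable fun a => (s a).x i) (hy : ∀ i, Measurable fun a => (s a).y i)
    (hz : ∀ i, Measurable fun a => (s a).z i) (hh : ∀ i, Measurable fun a => (s a).h i) :
    Measurable s :=
  measurable_comap_iff.2 ((measurable_pi_lambda _ hx).prodMk ((measurable_pi_lambda _ hy).prodMk
    ((measurable_pi_lambda _ hz).prodMk (measurable_pi_lambda _ hh))))

theorem measurable_avg {n : ℕ} : Measurable (avg : (Fin N → Vec n) → Vec n) := by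
  unfold avg
  fun_prop

theorem measurable_spread {n : ℕ} : Measurable (spread : (Fin N → Vec n) → ℝ) := by
  unfold spread
  have := measurable_avg (N := N) (n := n)
  fun_prop

theorem measurable_cons {n : ℕ} : Measurable (cons : (Fin N → Vec n) → ℝ) :=
  measurable_spread.div_const _

end StateSpace

section Measurability

variable {N d p : ℕ} {Ξ Z A : Type*} [MeasurableSpace Ξ] [MeasurableSpace Z] [MeasurableSpace A]
  {P : Problem N d p Ξ Z} {σ : ℝ}

theorem Stochastic.measurable_pH (h : Stochastic P σ) (v : Variant) {δ : A → ℝ} {ζ : A → Z}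
    {x : A → Vec d} {y z : A → Vec p} (hδ : Measurable δ) (hζ : Measurable ζ) (hx : Measurable x)
    (hy : Measurable y) (hz : Measurable z) :
    Measurable fun a => pH P v (δ a) (ζ a) (x a) (y a) (z a) := by
  cases v with
  | SO => exact measurable_hess22 h.meas_G h.diff_G h.diff_grad_G hx hy hz hζ
  | FO =>
    have h1 := measurable_grad2 h.meas_G h.diff_G hx (hy.add (hδ.smul hz)) hζ
    have h2 := measurable_grad2 h.meas_G h.diff_G hx (hy.sub (hδ.smul hz)) hζ
    exact ((hδ.const_mul 2).inv).smul (h1.sub h2)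

theorem Stochastic.measurable_pJ (h : Stochastic P σ) (v : Variant) {δ : A → ℝ} {ζ : A → Z}
    {x : A → Vec d} {y z : A → Vec p} (hδ : Measurable δ) (hζ : Measurable ζ) (hx : Measurable x)
    (hy : Measurable y) (hz : Measurable z) :
    Measurable fun a => pJ P v (δ a) (ζ a) (x a) (y a) (z a) := by
  cases v with
  | SO => exact measurable_hess12 h.meas_G h.diff_G h.diff_grad_G hx hy hz hζ
  | FO =>
    have h1 := measurable_grad1 h.meas_G h.diff_G hx (hy.add (hδ.smul hz)) hζ
    have h2 := measurable_grad1 h.meas_G h.diff_G hx (hy.sub (hδ.smul hz)) hζ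
    exact ((hδ.const_mul 2).inv).smul (h1.sub h2)

theorem Stochastic.measurable_next (h : Stochastic P σ) (v : Variant)
    (W : Matrix (Fin N) (Fin N) ℝ) (τ α β γ θ : ℝ) {δ : A → ℝ} {s : A → State N d p}
    {w : A → Fin N → Ξ × Z} (hδ : Measurable δ) (hs : Measurable s) (hw : Measurable w) :
    Measurable fun a => next P v W τ α β γ θ (δ a) (s a) (w a) := by
  have hx i : Measurable fun a => (s a).x i := (measurable_pi_apply i).comp
    (State.measurable_x.comp hs)
  have hy i : Measurable fun a => (s a).y i := (measurable_pi_apply i).comp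
    (State.measurable_y.comp hs)
  have hz i : Measurable fun a => (s a).z i := (measurable_pi_apply i).comp
    (State.measurable_z.comp hs)
  have hh i : Measurable fun a => (s a).h i := (measurable_pi_apply i).comp
    (State.measurable_h.comp hs)
  have hξ i : Measurable fun a => (w a i).1 := ((measurable_pi_apply i).comp hw).fst
  have hζ i : Measurable fun a => (w a i).2 := ((measurable_pi_apply i).comp hw).snd
  have hg j : Measurable fun a => grad2 (P.Gat (w a j).2) ((s a).x j) ((s a).y j) :=
    measurable_grad2 h.meas_G h.diff_G (hx j) (hy j) (hζ j)
  have hf2 j : Measurable fun a => grad2 (P.Fat (w a j).1) ((s a).x j) ((s a).y j) :=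
    measurable_grad2 h.meas_F h.diff_F (hx j) (hy j) (hξ j)
  have hf1 j : Measurable fun a => grad1 (P.Fat (w a j).1) ((s a).x j) ((s a).y j) :=
    measurable_grad1 h.meas_F h.diff_F (hx j) (hy j) (hξ j)
  have hH j := h.measurable_pH v hδ (hζ j) (hx j) (hy j) (hz j)
  have hJ j := h.measurable_pJ v hδ (hζ j) (hx j) (hy j) (hz j)
  refine measurable_state (fun i => ?_) (fun i => ?_) (fun i => ?_) fun i => ?_ <;>
    simp only [next, step] <;> fun_prop

variable {L κ : ℝ}

theorem continuous_of_norm_sub_le {n m : ℕ} {φ : Vec n → Vec m} {C : ℝ}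
    (h : ∀ x x', ‖φ x - φ x'‖ ≤ C * ‖x - x'‖) : Continuous φ :=
  (LipschitzWith.of_dist_le' fun x y => by simpa only [dist_eq_norm] using h x y).continuous

theorem Regular.differentiable_phi (h : Regular P L κ) : Differentiable ℝ P.Phi :=
  fun x => (h.hasGradientAt_phi x).differentiableAt

theorem Regular.measurable_sizeG (h : Regular P L κ) : Measurable (sizeG P L) := by
  have h1 := (continuous_of_norm_sub_le h.hyperGrad_lip).measurable.comp
    (measurable_avg.comp (State.measurable_x (N := N) (d := d) (p := p)))
  exact (h1.norm.pow_const 2).div_const _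

theorem Regular.measurable_lyapunov (h : Regular P L κ) (ρ a t Φ₀ : ℝ) :
    Measurable (lyapunov P L κ ρ a t Φ₀) := by
  have mx := measurable_avg.comp (State.measurable_x (N := N) (d := d) (p := p))
  have my := measurable_avg.comp (State.measurable_y (N := N) (d := d) (p := p))
  have mz := measurable_avg.comp (State.measurable_z (N := N) (d := d) (p := p))
  have mh := measurable_avg.comp (State.measurable_h (N := N) (d := d) (p := p))
  have cx := measurable_cons.comp (State.measurable_x (N := N) (d := d) (p := p))
  have cy := measurable_cons.comp (State.measurable_y (N := N) (d := d) (p := p))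
  have cz := measurable_cons.comp (State.measurable_z (N := N) (d := d) (p := p))
  have ch := measurable_cons.comp (State.measurable_h (N := N) (d := d) (p := p))
  have mP := h.differentiable_phi.continuous.measurable.comp mx
  have mY : Measurable (errY P) :=
    ((my.sub ((continuous_of_norm_sub_le h.ystar_lip).measurable.comp mx)).norm).pow_const 2
  have mZ : Measurable (errZ P) :=
    ((mz.sub ((continuous_of_norm_sub_le h.zstar_lip).measurable.comp mx)).norm).pow_const 2
  have mH : Measurable (errH P L) :=
    (((mh.sub ((continuous_of_norm_sub_le h.hyperGrad_lip).measurable.comp mx)).norm).pow_const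
      2).div_const _
  exact ((((((mP.sub_const _).div_const _).add (mH.const_mul _)).add (mZ.const_mul _)).add
    (mY.const_mul _)).add ((((cx.add cy).const_mul _).add cz).const_mul _)).add
    ((ch.div_const _).const_mul _)

theorem Regular.lyapunov_nonneg (h : Regular P L κ) {ρ a t Φ₀ : ℝ} (hρ : ρ < 1) (ha : 0 ≤ a)
    (ht : 0 ≤ t) (hΦ : ∀ x, Φ₀ ≤ P.Phi x) (s : State N d p) : 0 ≤ lyapunov P L κ ρ a t Φ₀ s := by
  have hL := h.L_pos
  have hκ := h.κ_pos
  have hρ' : 0 < 1 - ρ := by linarith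
  have h1 := sub_nonneg.2 (hΦ (avg s.x))
  have h2 := errH_nonneg P L s
  have h3 := errZ_nonneg P s
  have h4 := errY_nonneg P s
  have h5 := cons_nonneg s.x
  have h6 := cons_nonneg s.y
  have h7 := cons_nonneg s.z
  have h8 := cons_nonneg s.h
  rw [lyapunov]
  positivity

end Measurability

/-! ### Independence of fresh samples from the past -/

section Samples

variable {N d p : ℕ} {Ξ Z Ω : Type*} [MeasurableSpace Ξ] [MeasurableSpace Z] [mΩ : MeasurableSpace Ω]
  {Pr : Measure Ω} {P : Problem N d p Ξ Z} {ξ : ℕ → Fin N → Ω → Ξ} {ζ : ℕ → Fin N → Ω → Z}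

/-- All samples of iteration `t`. -/
def samples (ξ : ℕ → Fin N → Ω → Ξ) (ζ : ℕ → Fin N → Ω → Z) (t : ℕ) (ω : Ω) : Fin N → Ξ × Z :=
  fun i => (ξ t i ω, ζ t i ω)

theorem Sampling.measurable_samples (h : Sampling Pr P ξ ζ) (t : ℕ) :
    Measurable (samples ξ ζ t) :=
  measurable_pi_lambda _ fun i => (h.meas_ξ t i).prodMk (h.meas_ζ t i)

theorem Sampling.past_le (h : Sampling Pr P ξ ζ) (t : ℕ) : past ξ ζ t ≤ mΩ :=
  iSup₂_le fun s _ => iSup_le fun i => ((h.meas_ξ s i).prodMk (h.meas_ζ s i)).comap_le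

omit mΩ in
theorem past_mono {s t : ℕ} (hst : s ≤ t) : past ξ ζ s ≤ past ξ ζ t :=
  iSup₂_le fun u hu => le_iSup₂_of_le u (hu.trans_le hst) le_rfl

omit mΩ in
theorem measurable_samples_past (t : ℕ) : Measurable[past ξ ζ (t + 1)] (samples ξ ζ t) := by
  refine @measurable_pi_lambda _ _ _ (past ξ ζ (t + 1)) _ _ fun i => ?_
  refine measurable_iff_comap_le.2 ?_
  exact le_iSup₂_of_le t (Nat.lt_succ_self t) (le_iSup_of_le i le_rfl)

theorem Sampling.map_samples [IsProbabilityMeasure Pr] (h : Sampling Pr P ξ ζ) (t : ℕ) :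
    Pr.map (samples ξ ζ t) = sampleLaw P := by
  have h1 : iIndepFun (fun (i : Fin N) ω => (ξ t i ω, ζ t i ω)) Pr :=
    h.indep.precomp (g := fun i => (t, i)) fun i j hij => (Prod.mk.inj hij).2
  have h2 := (iIndepFun_iff_map_fun_eq_pi_map
    fun i => ((h.meas_ξ t i).prodMk (h.meas_ζ t i)).aemeasurable).1 h1
  exact h2.trans (congrArg Measure.pi (funext fun i => h.law t i))

/-- The indices with time `< t` and those with time `t` are disjoint blocks of one independent
family. -/
theorem Sampling.indep_past (h : Sampling Pr P ξ ζ) (t : ℕ) :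
    Indep (past ξ ζ t) (MeasurableSpace.comap (samples ξ ζ t) inferInstance) Pr := by
  let m : ℕ × Fin N → MeasurableSpace Ω := fun k =>
    MeasurableSpace.comap (fun ω => (ξ k.1 k.2 ω, ζ k.1 k.2 ω)) inferInstance
  have hm : iIndep m Pr := h.indep
  have h1 := indep_iSup_of_disjoint (m := m)
    (fun k => ((h.meas_ξ k.1 k.2).prodMk (h.meas_ζ k.1 k.2)).comap_le) hm
    (S := {k | k.1 < t}) (T := {k | k.1 = t})
    (Set.disjoint_left.2 fun k hk hk' => (ne_of_lt hk) hk')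
  refine indep_of_indep_of_le_left (indep_of_indep_of_le_right h1 ?_) ?_
  · refine measurable_iff_comap_le.1 (@measurable_pi_lambda _ _ _ (_) _ _ fun i => ?_)
    exact measurable_iff_comap_le.2 (le_iSup₂_of_le (f := fun k (_ : k ∈ {k : ℕ × Fin N | k.1 = t})
      => m k) (t, i) rfl le_rfl)
  · exact iSup₂_le fun s hs => iSup_le fun i =>
      le_iSup₂_of_le (f := fun k (_ : k ∈ {k : ℕ × Fin N | k.1 < t}) => m k) (s, i) hs le_rfl

/-- The expectation over the samples of one iteration can be taken first. -/
theorem Sampling.lintegral_samples [IsProbabilityMeasure Pr] [IsProbabilityMeasure (sampleLaw P)]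
    (h : Sampling Pr P ξ ζ) (t : ℕ)
    {B : Type*} [MeasurableSpace B] {b : Ω → B} (hb : Measurable[past ξ ζ t] b)
    {Ψ : B × (Fin N → Ξ × Z) → ENNReal} (hΨ : Measurable Ψ) :
    ∫⁻ ω, Ψ (b ω, samples ξ ζ t ω) ∂Pr = ∫⁻ ω, ∫⁻ w, Ψ (b ω, w) ∂sampleLaw P ∂Pr := by
  have hb' : Measurable b := hb.mono (h.past_le t) le_rfl
  have hi : IndepFun b (samples ξ ζ t) Pr :=
    indep_of_indep_of_le_left (h.indep_past t) (measurable_iff_comap_le.1 hb)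
  have hmap := (indepFun_iff_map_prod_eq_prod_map_map hb'.aemeasurable
    (h.measurable_samples t).aemeasurable).1 hi
  rw [h.map_samples t] at hmap
  rw [← lintegral_map (f := Ψ) hΨ (hb'.prodMk (h.measurable_samples t)), hmap,
    lintegral_prod _ hΨ.aemeasurable, lintegral_map hΨ.lintegral_prod_right' hb']

end Samples

/-- In `[0, ∞]` the recursion needs only measurability, so integrability of the Lyapunov function
along the run never has to be shown. The additive `b` carries the negative drift to the left side.
-/
theorem MeanLE.lintegral_add_le {S : Type*} [MeasurableSpace S] {D : Measure S} {f : S → ℝ}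
    {c b : ℝ} (h : MeanLE D f c) (hf : ∀ w, 0 ≤ f w) (hb : 0 ≤ b) :
    ∫⁻ w, ENNReal.ofReal (f w) ∂D + ENNReal.ofReal b ≤ ENNReal.ofReal (c + b) := by
  obtain ⟨U, hU, hfU, hUc⟩ := h
  have hU0 : ∀ w, 0 ≤ U w := fun w => (hf w).trans (hfU w)
  have hc : 0 ≤ c := (integral_nonneg hU0).trans hUc
  rw [ENNReal.ofReal_add hc hb]
  gcongr
  calc ∫⁻ w, ENNReal.ofReal (f w) ∂D ≤ ∫⁻ w, ENNReal.ofReal (U w) ∂D :=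
        lintegral_mono fun w => ENNReal.ofReal_le_ofReal (hfU w)
    _ = ENNReal.ofReal (∫ w, U w ∂D) :=
        (ofReal_integral_eq_lintegral_ofReal hU (ae_of_all _ hU0)).symm
    _ ≤ _ := ENNReal.ofReal_le_ofReal hUc

/-! ### Summation of the descent along a run -/

section Recursion

variable {N d p : ℕ} {Ξ Z Ω : Type*} [MeasurableSpace Ξ] [MeasurableSpace Z] [mΩ : MeasurableSpace Ω]
  {Pr : Measure Ω} [IsProbabilityMeasure Pr] {P : Problem N d p Ξ Z} {v : Variant}
  {W : Matrix (Fin N) (Fin N) ℝ} {ξ : ℕ → Fin N → Ω → Ξ} {ζ : ℕ → Fin N → Ω → Z}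
  {L κ σ ρ b₁ b₂ ε a r t τ α Φ₀ : ℝ} {δ : ℕ → Ω → ℝ} {X : ℕ → Ω → State N d p}
  {s₀ : State N d p} {T : ℕ}

omit mΩ in
theorem Stochastic.measurable_iterate {β γ θ : ℝ} (h : Stochastic P σ) (h0 : ∀ ω, X 0 ω = s₀)
    (hX : ∀ k ω, X (k + 1) ω = next P v W τ α β γ θ (δ k ω) (X k ω) (samples ξ ζ k ω))
    (hδ : ∀ k < T, Measurable[past ξ ζ k] (δ k)) {k : ℕ} (hk : k ≤ T) :
    Measurable[past ξ ζ k] (X k) := by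
  induction k with
  | zero => rw [show X 0 = fun _ => s₀ from funext h0]; exact measurable_const
  | succ k ih =>
    rw [show X (k + 1) = _ from funext (hX k)]
    have hle : past ξ ζ k ≤ past ξ ζ (k + 1) := past_mono (Nat.le_succ k)
    exact @Stochastic.measurable_next _ _ _ _ _ _ _ _ (past ξ ζ (k + 1)) _ _ h v W τ α β γ θ _ _ _
      ((hδ k hk).mono hle le_rfl) ((ih (Nat.le_of_succ_le hk)).mono hle le_rfl)
      (measurable_samples_past k)

/-- Summing the one-step descent of the Lyapunov function along a run. -/
theorem sum_sizeG_le (hreg : Regular P L κ) (hstoch : Stochastic P σ) (hsam : Sampling Pr P ξ ζ)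
    (hρ : ρ < 1) (ha : 0 < a) (hr : 0 < r) (ht : r = t * a)
    (htκ : κ ^ 4 * t ≤ 1 / 500) (haκ : a * κ * (1000 * (1 + (σ / L) ^ 2)) ≤ 1)
    (hρa : ρ * a * (1 - ρ)⁻¹ * κ ≤ 1 / 500) (hΦ : ∀ x, Φ₀ ≤ P.Phi x)
    (h0 : ∀ ω, X 0 ω = s₀)
    (hX : ∀ k ω, X (k + 1) ω =
      next P v W τ α (a / L) (a / L) a (δ k ω) (X k ω) (samples ξ ζ k ω))
    (hδ : ∀ k < T, Measurable[past ξ ζ k] (δ k))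
    (hstep : ∀ k < T, ∀ᵐ ω ∂Pr,
      StepSetting P v W L κ σ ρ b₁ b₂ ε a r τ α (δ k ω) (X k ω)) :
    (∀ k < T, Integrable (fun ω => sizeG P L (X k ω)) Pr) ∧
      ∑ k ∈ Finset.range T, ∫ ω, sizeG P L (X k ω) ∂Pr ≤
        2 / r * lyapunov P L κ ρ a t Φ₀ s₀ + 2 * T * stepError N L κ σ ρ b₁ b₂ ε a := by
  have hprob : IsProbabilityMeasure (sampleLaw P) := by
    have := hstoch.prob_f
    have := hstoch.prob_g
    rw [sampleLaw]
    infer_instance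
  have ht0 : 0 ≤ t := by
    rw [ht] at hr
    exact (pos_of_mul_pos_left hr ha.le).le
  have hL := hreg.L_pos
  have hκ := hreg.κ_pos
  have hρ' : 0 < 1 - ρ := by linarith
  set V : State N d p → ℝ := lyapunov P L κ ρ a t Φ₀ with hV
  have hV0 : ∀ s, 0 ≤ V s := hreg.lyapunov_nonneg hρ ha.le ht0 hΦ
  have hVm : Measurable V := hreg.measurable_lyapunov _ _ _ _
  set e := stepError N L κ σ ρ b₁ b₂ ε a with he
  have he0 : 0 ≤ e := by
    rw [he, stepError]
    positivity
  have hm : ∀ k ≤ T, Measurable (X k) := fun k hk =>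
    (hstoch.measurable_iterate h0 hX hδ hk).mono (hsam.past_le k) le_rfl
  have hGm : ∀ k ≤ T, Measurable fun ω => sizeG P L (X k ω) := fun k hk =>
    hreg.measurable_sizeG.comp (hm k hk)
  -- The state and `δ k` are functions of the past, so the fresh samples can be integrated first and
  -- the one-step descent applied for almost every past.
  have step : ∀ k < T, ∫⁻ ω, ENNReal.ofReal (V (X (k + 1) ω)) ∂Pr
      + ∫⁻ ω, ENNReal.ofReal (r / 2 * sizeG P L (X k ω)) ∂Pr ≤
      ∫⁻ ω, ENNReal.ofReal (V (X k ω)) ∂Pr + ENNReal.ofReal (r * e) := by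
    intro k hk
    have hb : Measurable[past ξ ζ k] fun ω => (X k ω, δ k ω) :=
      (hstoch.measurable_iterate h0 hX hδ hk.le).prodMk (hδ k hk)
    have hΨ : Measurable fun q : (State N d p × ℝ) × (Fin N → Ξ × Z) =>
        ENNReal.ofReal (V (next P v W τ α (a / L) (a / L) a q.1.2 q.1.1 q.2)) :=
      (hVm.comp (hstoch.measurable_next v W τ α _ _ _ measurable_fst.snd measurable_fst.fst
        measurable_snd)).ennreal_ofReal
    have h1 := hsam.lintegral_samples k hb hΨ
    simp only [← hX] at h1
    rw [h1, ← lintegral_add_right _ ((hGm k hk.le).const_mul _).ennreal_ofReal]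
    calc _ ≤ ∫⁻ ω, (ENNReal.ofReal (V (X k ω)) + ENNReal.ofReal (r * e)) ∂Pr := by
          refine lintegral_mono_ae ?_
          filter_upwards [hstep k hk] with ω hω
          have h2 := (hω.lyapunov_next ht htκ haκ hρa Φ₀).lintegral_add_le (fun w => hV0 _)
            (b := r / 2 * sizeG P L (X k ω))
            (mul_nonneg (by positivity) (sizeG_nonneg _ _ _))
          refine h2.trans ?_
          rw [← ENNReal.ofReal_add (hV0 _) (by positivity)]
          exact ENNReal.ofReal_le_ofReal (le_of_eq (by ring))
      _ = _ := by rw [lintegral_add_right _ measurable_const]; simp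
  have total : ∀ k ≤ T, ∫⁻ ω, ENNReal.ofReal (V (X k ω)) ∂Pr
      + ∑ i ∈ Finset.range k, ∫⁻ ω, ENNReal.ofReal (r / 2 * sizeG P L (X i ω)) ∂Pr ≤
      ENNReal.ofReal (V s₀) + k * ENNReal.ofReal (r * e) := by
    intro k hk
    induction k with
    | zero => simp [h0]
    | succ k ih =>
      rw [Finset.sum_range_succ, add_comm (Finset.sum _ _), ← add_assoc]
      refine (add_le_add_left (step k hk) _).trans ?_
      rw [add_right_comm]
      refine (add_le_add_left (ih (Nat.le_of_succ_le hk)) _).trans (le_of_eq ?_)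
      push_cast
      ring
  have hfin : ENNReal.ofReal (V s₀) + T * ENNReal.ofReal (r * e) =
      ENNReal.ofReal (V s₀ + T * (r * e)) := by
    rw [ENNReal.ofReal_add (hV0 _) (by positivity), ENNReal.ofReal_mul (Nat.cast_nonneg T),
      ENNReal.ofReal_natCast]
  have hsum : ∑ i ∈ Finset.range T, ∫⁻ ω, ENNReal.ofReal (r / 2 * sizeG P L (X i ω)) ∂Pr ≤
      ENNReal.ofReal (V s₀ + T * (r * e)) := by
    rw [← hfin]
    exact le_add_self.trans (total T le_rfl)
  -- Integrability is a result of the summed bound: each term is part of a finite sum.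
  have hint : ∀ k < T, Integrable (fun ω => r / 2 * sizeG P L (X k ω)) Pr := by
    intro k hk
    refine ⟨((hGm k hk.le).const_mul _).aestronglyMeasurable, ?_⟩
    rw [hasFiniteIntegral_iff_ofReal (ae_of_all _ fun ω =>
      mul_nonneg (by positivity) (sizeG_nonneg _ _ _))]
    exact ((Finset.single_le_sum (f := fun i =>
      ∫⁻ ω, ENNReal.ofReal (r / 2 * sizeG P L (X i ω)) ∂Pr) (fun _ _ => zero_le)
      (Finset.mem_range.2 hk)).trans hsum).trans_lt ENNReal.ofReal_lt_top
  have hint' : ∀ k < T, Integrable (fun ω => sizeG P L (X k ω)) Pr := by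
    intro k hk
    have := (hint k hk).const_mul (2 / r)
    refine this.congr (ae_of_all _ fun ω => ?_)
    field_simp
  refine ⟨hint', ?_⟩
  have h3 : r / 2 * ∑ k ∈ Finset.range T, ∫ ω, sizeG P L (X k ω) ∂Pr ≤ V s₀ + T * (r * e) := by
    rw [← ENNReal.ofReal_le_ofReal_iff (add_nonneg (hV0 _) (by positivity))]
    refine le_trans (le_of_eq ?_) hsum
    rw [Finset.mul_sum, ENNReal.ofReal_sum_of_nonneg fun k _ => mul_nonneg (by positivity)
      (integral_nonneg fun ω => sizeG_nonneg _ _ _)]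
    refine Finset.sum_congr rfl fun k hk => ?_
    rw [← integral_const_mul, ofReal_integral_eq_lintegral_ofReal (hint k (Finset.mem_range.1 hk))
      (ae_of_all _ fun ω => mul_nonneg (by positivity) (sizeG_nonneg _ _ _))]
  calc _ = 2 / r * (r / 2 * ∑ k ∈ Finset.range T, ∫ ω, sizeG P L (X k ω) ∂Pr) := by field_simp
    _ ≤ 2 / r * (V s₀ + T * (r * e)) := by gcongr
    _ = _ := by field_simp

end Recursion

end DSOBA

end

noncomputable section

namespace DSOBA

/-! ### Choice of the step size and the resulting rate -/

section CubeRoot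

/-- The cube root of a nonnegative real number. -/
def cbrt (x : ℝ) : ℝ := x ^ (1 / 3 : ℝ)

variable {x : ℝ}

theorem cbrt_nonneg (hx : 0 ≤ x) : 0 ≤ cbrt x := Real.rpow_nonneg hx _

theorem cbrt_pos (hx : 0 < x) : 0 < cbrt x := Real.rpow_pos_of_pos hx _

theorem one_le_cbrt (hx : 1 ≤ x) : 1 ≤ cbrt x := Real.one_le_rpow hx (by norm_num)

theorem cbrt_pow (hx : 0 ≤ x) (n : ℕ) : cbrt x ^ n = x ^ (n / 3 : ℝ) := by
  rw [cbrt, ← Real.rpow_mul_natCast hx]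
  congr 1
  ring

theorem cbrt_pow_three (hx : 0 ≤ x) : cbrt x ^ 3 = x := by
  rw [cbrt_pow hx]
  norm_num

end CubeRoot

/-- The inverse of the normalized step size. -/
def stepDenom (N T : ℕ) (K κ ρ b₁ b₂ : ℝ) : ℝ :=
  √((T : ℝ) / N) + cbrt T * cbrt ρ ^ 2 * κ / cbrt (1 - ρ)
    + cbrt T * cbrt ρ ^ 2 * (cbrt b₁ ^ 2 * cbrt κ + cbrt b₂ ^ 2 * κ) / cbrt (1 - ρ) ^ 2
    + K * (κ + ρ * κ / (1 - ρ))

section StepSize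

variable {N T : ℕ} {K κ ρ b₁ b₂ : ℝ}

theorem rateBound_eq (hκ : 0 ≤ κ) (hρ : 0 ≤ ρ) (hρ1 : ρ < 1) (hb₁ : 0 ≤ b₁) (hb₂ : 0 ≤ b₂) :
    rateBound N T κ ρ b₁ b₂ = κ ^ 5 / √(N * T)
      + cbrt ρ ^ 2 * κ ^ 6 / (cbrt (1 - ρ) * cbrt T ^ 2)
      + cbrt ρ ^ 2 * (cbrt b₁ ^ 2 * cbrt κ ^ 16 + cbrt b₂ ^ 2 * κ ^ 6)
          / (cbrt (1 - ρ) ^ 2 * cbrt T ^ 2)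
      + ρ * κ ^ 6 / ((1 - ρ) * T) + κ ^ 4 / ((1 - ρ) * (N * T)) + κ ^ 13 / T
      + κ ^ 7 / (N * T) := by
  rw [rateBound, cbrt_pow hρ, cbrt_pow hb₁, cbrt_pow hb₂, cbrt_pow hκ, cbrt_pow (Nat.cast_nonneg T),
    cbrt_pow (sub_nonneg.2 hρ1.le)]
  norm_num [cbrt]

theorem stepDenom_terms (hN : 1 ≤ N) (hT : 1 ≤ T) (hK : 0 ≤ K) (hκ : 0 < κ) (hρ : 0 ≤ ρ)
    (hρ1 : ρ < 1) (hb₁ : 0 ≤ b₁) (hb₂ : 0 ≤ b₂) :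
    0 < √((T : ℝ) / N) ∧ 0 ≤ cbrt T * cbrt ρ ^ 2 * κ / cbrt (1 - ρ) ∧
      0 ≤ cbrt T * cbrt ρ ^ 2 * (cbrt b₁ ^ 2 * cbrt κ) / cbrt (1 - ρ) ^ 2 ∧
      0 ≤ cbrt T * cbrt ρ ^ 2 * (cbrt b₂ ^ 2 * κ) / cbrt (1 - ρ) ^ 2 ∧
      0 ≤ K * κ ∧ 0 ≤ K * (ρ * κ / (1 - ρ)) := by
  have hN' : (0 : ℝ) < N := by exact_mod_cast hN
  have hT' : (0 : ℝ) < T := by exact_mod_cast hT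
  have hq : 0 < 1 - ρ := by linarith
  have h1 := cbrt_nonneg hT'.le
  have h2 := cbrt_nonneg hρ
  have h3 := cbrt_pos hq
  have h4 := cbrt_nonneg hb₁
  have h5 := cbrt_nonneg hb₂
  have h6 := cbrt_nonneg hκ.le
  refine ⟨?_, ?_, ?_, ?_, ?_, ?_⟩ <;> positivity

theorem stepDenom_eq : stepDenom N T K κ ρ b₁ b₂ =
    √((T : ℝ) / N) + cbrt T * cbrt ρ ^ 2 * κ / cbrt (1 - ρ)
    + cbrt T * cbrt ρ ^ 2 * (cbrt b₁ ^ 2 * cbrt κ) / cbrt (1 - ρ) ^ 2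
    + cbrt T * cbrt ρ ^ 2 * (cbrt b₂ ^ 2 * κ) / cbrt (1 - ρ) ^ 2
    + K * κ + K * (ρ * κ / (1 - ρ)) := by
  rw [stepDenom]
  ring

theorem sqrt_le_stepDenom (hN : 1 ≤ N) (hT : 1 ≤ T) (hK : 0 ≤ K) (hκ : 0 < κ) (hρ : 0 ≤ ρ)
    (hρ1 : ρ < 1) (hb₁ : 0 ≤ b₁) (hb₂ : 0 ≤ b₂) :
    √((T : ℝ) / N) ≤ stepDenom N T K κ ρ b₁ b₂ := by
  obtain ⟨h1, h2, h3, h4, h5, h6⟩ := stepDenom_terms hN hT hK hκ hρ hρ1 hb₁ hb₂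
  rw [stepDenom_eq]
  linarith

theorem stepDenom_pos (hN : 1 ≤ N) (hT : 1 ≤ T) (hK : 0 ≤ K) (hκ : 0 < κ) (hρ : 0 ≤ ρ)
    (hρ1 : ρ < 1) (hb₁ : 0 ≤ b₁) (hb₂ : 0 ≤ b₂) : 0 < stepDenom N T K κ ρ b₁ b₂ :=
  (stepDenom_terms hN hT hK hκ hρ hρ1 hb₁ hb₂).1.trans_le
    (sqrt_le_stepDenom hN hT hK hκ hρ hρ1 hb₁ hb₂)

/-- The square root dominates the denominator for large `T`. -/
theorem exists_stepDenom_le (hN : 1 ≤ N) (hK : 0 ≤ K) (hκ : 0 < κ) (hρ : 0 ≤ ρ)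
    (hρ1 : ρ < 1) :
    ∃ T₀ : ℕ, ∀ T : ℕ, 1 ≤ T → T₀ ≤ T → stepDenom N T K κ ρ b₁ b₂ ≤ 2 * √((T : ℝ) / N) := by
  have hN' : (0 : ℝ) < N := by exact_mod_cast hN
  have hq : 0 < 1 - ρ := by linarith
  set A := cbrt ρ ^ 2 * κ / cbrt (1 - ρ)
    + cbrt ρ ^ 2 * (cbrt b₁ ^ 2 * cbrt κ + cbrt b₂ ^ 2 * κ) / cbrt (1 - ρ) ^ 2 with hA
  set B := K * (κ + ρ * κ / (1 - ρ)) with hB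
  have hB0 : 0 ≤ B := by positivity
  have hDE : ∀ T : ℕ, stepDenom N T K κ ρ b₁ b₂ = √((T : ℝ) / N) + (cbrt T * A + B) := by
    intro T
    rw [stepDenom, hA]
    ring
  -- With `s = T^(1/6)` the cube root of `T` is `s²` and its square root is `s³`. Hence `s² A + B ≤
  -- s³ / √N` as soon as `s ≥ (A + B) √N`.
  refine ⟨⌈((A + B) * √N) ^ 6⌉₊, fun T hT hTT => ?_⟩
  have hT' : (1 : ℝ) ≤ T := by exact_mod_cast hT
  have hT0 : (0 : ℝ) ≤ T := by linarith
  set s := (T : ℝ) ^ (1 / 6 : ℝ) with hs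
  have hs1 : 1 ≤ s := Real.one_le_rpow hT' (by norm_num)
  have e1 : s ^ 2 = cbrt T := by
    rw [hs, cbrt, ← Real.rpow_mul_natCast hT0]
    norm_num
  have e2 : s ^ 3 = √T := by
    rw [hs, Real.sqrt_eq_rpow, ← Real.rpow_mul_natCast hT0]
    norm_num
  have e3 : s ^ 6 = T := by
    rw [hs, ← Real.rpow_mul_natCast hT0]
    norm_num
  have h1 : (A + B) * √N ≤ s := by
    have h2 : ((A + B) * √N) ^ 6 ≤ s ^ 6 := by
      rw [e3]
      exact (Nat.le_ceil _).trans (by exact_mod_cast hTT)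
    exact le_of_pow_le_pow_left₀ (by norm_num) (by linarith) h2
  have h3 : cbrt T * A + B ≤ √((T : ℝ) / N) := by
    rw [Real.sqrt_div hT0, le_div_iff₀ (Real.sqrt_pos.2 hN'), ← e1, ← e2]
    calc (s ^ 2 * A + B) * √N ≤ (s ^ 2 * A + s ^ 2 * B) * √N := by
          gcongr
          exact le_mul_of_one_le_left hB0 (one_le_pow₀ hs1)
      _ = s ^ 2 * ((A + B) * √N) := by ring
      _ ≤ s ^ 2 * s := by gcongr
      _ = s ^ 3 := by ring
  rw [hDE]
  linarith

/-- The first three groups of the denominator reproduce terms of the rate exactly. The stability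
part gives `κ⁶ / T`, which is below `κ¹³ / T`, and the term with `ρ κ⁶`, both with the factor `K`.
-/
theorem initial_rate_le (hN : 1 ≤ N) (hT : 1 ≤ T) (hK : 1 ≤ K) (hκ : 1 ≤ κ) (hρ : 0 ≤ ρ)
    (hρ1 : ρ < 1) (hb₁ : 0 ≤ b₁) (hb₂ : 0 ≤ b₂) :
    κ ^ 5 * stepDenom N T K κ ρ b₁ b₂ / T ≤ K * rateBound N T κ ρ b₁ b₂ := by
  have hN' : (0 : ℝ) < N := by exact_mod_cast hN
  have hT' : (0 : ℝ) < T := by exact_mod_cast hT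
  have hκ0 : 0 < κ := by linarith
  have hq : 0 < 1 - ρ := by linarith
  have hs := cbrt_pos hT'
  have hp := cbrt_nonneg hρ
  have hq' := cbrt_pos hq
  have h4 := cbrt_nonneg hb₁
  have h5 := cbrt_nonneg hb₂
  have hk := one_le_cbrt hκ
  have hk3 := cbrt_pow_three hκ0.le
  have hs3 := cbrt_pow_three hT'.le
  rw [rateBound_eq hκ0.le hρ hρ1 hb₁ hb₂, stepDenom]
  have e1 : κ ^ 5 * √((T : ℝ) / N) / T = κ ^ 5 / √(N * T) := by
    rw [Real.sqrt_div hT'.le, Real.sqrt_mul hN'.le]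
    have h1 := Real.sqrt_pos.2 hN'
    have h2 := Real.sqrt_pos.2 hT'
    have h3 := Real.sq_sqrt hT'.le
    field_simp
    rw [h3]
  have e2 : κ ^ 5 * (cbrt T * cbrt ρ ^ 2 * κ / cbrt (1 - ρ)) / T =
      cbrt ρ ^ 2 * κ ^ 6 / (cbrt (1 - ρ) * cbrt T ^ 2) := by
    generalize cbrt (T : ℝ) = s at *
    rw [← hs3]
    field_simp
  have e3 : κ ^ 5 * (cbrt T * cbrt ρ ^ 2 * (cbrt b₁ ^ 2 * cbrt κ + cbrt b₂ ^ 2 * κ) /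
      cbrt (1 - ρ) ^ 2) / T = cbrt ρ ^ 2 * (cbrt b₁ ^ 2 * cbrt κ ^ 16 + cbrt b₂ ^ 2 * κ ^ 6)
          / (cbrt (1 - ρ) ^ 2 * cbrt T ^ 2) := by
    have h16 : cbrt κ ^ 16 = κ ^ 5 * cbrt κ := by
      calc cbrt κ ^ 16 = (cbrt κ ^ 3) ^ 5 * cbrt κ := by ring
        _ = _ := by rw [hk3]
    rw [h16]
    generalize cbrt (T : ℝ) = s at *
    rw [← hs3]
    field_simp
  have e4 : κ ^ 5 * (κ + ρ * κ / (1 - ρ)) / T ≤ κ ^ 13 / T + ρ * κ ^ 6 / ((1 - ρ) * T) := by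
    have h1 : κ ^ 6 / T ≤ κ ^ 13 / T := by
      gcongr
      norm_num
    have h2 : κ ^ 5 * (κ + ρ * κ / (1 - ρ)) / T = κ ^ 6 / T + ρ * κ ^ 6 / ((1 - ρ) * T) := by
      field_simp
    linarith
  have p1 : 0 ≤ κ ^ 5 / √(N * T) := by positivity
  have p2 : 0 ≤ cbrt ρ ^ 2 * κ ^ 6 / (cbrt (1 - ρ) * cbrt T ^ 2) := by positivity
  have p3 : 0 ≤ cbrt ρ ^ 2 * (cbrt b₁ ^ 2 * cbrt κ ^ 16 + cbrt b₂ ^ 2 * κ ^ 6)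
          / (cbrt (1 - ρ) ^ 2 * cbrt T ^ 2) := by positivity
  have p5 : 0 ≤ κ ^ 4 / ((1 - ρ) * (N * T)) := by positivity
  have p7 : 0 ≤ κ ^ 7 / (N * T) := by positivity
  calc _ = κ ^ 5 * √((T : ℝ) / N) / T + κ ^ 5 * (cbrt T * cbrt ρ ^ 2 * κ / cbrt (1 - ρ)) / T
        + κ ^ 5 * (cbrt T * cbrt ρ ^ 2 * (cbrt b₁ ^ 2 * cbrt κ + cbrt b₂ ^ 2 * κ) /
          cbrt (1 - ρ) ^ 2) / T + K * (κ ^ 5 * (κ + ρ * κ / (1 - ρ)) / T) := by ring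
    _ ≤ K * (κ ^ 5 / √(N * T)) + K * (cbrt ρ ^ 2 * κ ^ 6 / (cbrt (1 - ρ) * cbrt T ^ 2))
        + K * (cbrt ρ ^ 2 * (cbrt b₁ ^ 2 * cbrt κ ^ 16 + cbrt b₂ ^ 2 * κ ^ 6)
          / (cbrt (1 - ρ) ^ 2 * cbrt T ^ 2))
        + K * (κ ^ 13 / T + ρ * κ ^ 6 / ((1 - ρ) * T)) := by
        rw [e1, e2, e3]
        refine add_le_add (add_le_add (add_le_add ?_ ?_) ?_) ?_
        · exact le_mul_of_one_le_left p1 hK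
        · exact le_mul_of_one_le_left p2 hK
        · exact le_mul_of_one_le_left p3 hK
        · gcongr
    _ ≤ _ := by
        have := mul_nonneg (zero_le_one.trans hK) (add_nonneg p5 p7)
        linarith

/-- Each growing summand `x` of the denominator satisfies `a x ≤ 1` and is designed for one error.
The square root balances the averaged noise; each cube-root summand occurs squared in its error
term, and replacing `(a x)²` by `1` leaves a term of the rate. The accuracy `ε = 1 / √T` contributes
`κ² / T`. -/
theorem stepError_le (L σ : ℝ) (hN : 1 ≤ N) (hT : 1 ≤ T) (hK : 1 ≤ K) (hκ : 1 ≤ κ) (hρ : 0 ≤ ρ)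
    (hρ1 : ρ < 1) (hb₁ : 0 ≤ b₁) (hb₂ : 0 ≤ b₂) :
    stepError N L κ σ ρ b₁ b₂ (√T)⁻¹ (stepDenom N T K κ ρ b₁ b₂)⁻¹ ≤
      300000 * (2 * (σ / L) ^ 2 + 1 / L ^ 2 + 1) * rateBound N T κ ρ b₁ b₂ := by
  have hN' : (0 : ℝ) < N := by exact_mod_cast hN
  have hT' : (0 : ℝ) < T := by exact_mod_cast hT
  have hκ0 : 0 < κ := by linarith
  have hq : 0 < 1 - ρ := by linarith
  have hs := cbrt_pos hT'
  have hp := cbrt_nonneg hρ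
  have hq' := cbrt_pos hq
  have h4 := cbrt_nonneg hb₁
  have h5 := cbrt_nonneg hb₂
  have hk := one_le_cbrt hκ
  have hk0 := cbrt_pos hκ0
  have hk3 := cbrt_pow_three hκ0.le
  have hq3 := cbrt_pow_three hq.le
  have hp3 := cbrt_pow_three hρ
  have hb13 := cbrt_pow_three hb₁
  have hb23 := cbrt_pow_three hb₂
  obtain ⟨d1, d2, d3, d4, d5, d6⟩ := stepDenom_terms hN hT (zero_le_one.trans hK) hκ0 hρ hρ1 hb₁ hb₂
  have hD := stepDenom_pos hN hT (zero_le_one.trans hK) hκ0 hρ hρ1 hb₁ hb₂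
  have hDe := stepDenom_eq (N := N) (T := T) (K := K) (κ := κ) (ρ := ρ) (b₁ := b₁) (b₂ := b₂)
  set D := stepDenom N T K κ ρ b₁ b₂ with hDdef
  have ha : 0 < D⁻¹ := inv_pos.2 hD
  have bound : ∀ x : ℝ, 0 ≤ x → x ≤ D → (D⁻¹ * x) ^ 2 ≤ 1 := fun x hx hxD => by
    refine pow_le_one₀ (by positivity) ?_
    rw [inv_mul_le_iff₀ hD, mul_one]
    exact hxD
  have c2 := bound _ d2 (by linarith)
  have c3 := bound _ d3 (by linarith)
  have c4 := bound _ d4 (by linarith)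
  have c1 : D⁻¹ * √((T : ℝ) / N) ≤ 1 := by
    rw [inv_mul_le_iff₀ hD, mul_one]
    linarith
  generalize D⁻¹ = a at *
  rw [rateBound_eq hκ0.le hρ hρ1 hb₁ hb₂, stepError]
  set r1 := κ ^ 5 / √(N * T) with hr1
  set r2 := cbrt ρ ^ 2 * κ ^ 6 / (cbrt (1 - ρ) * cbrt T ^ 2) with hr2
  set r3 := cbrt ρ ^ 2 * (cbrt b₁ ^ 2 * cbrt κ ^ 16 + cbrt b₂ ^ 2 * κ ^ 6)
          / (cbrt (1 - ρ) ^ 2 * cbrt T ^ 2) with hr3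
  set r4 := ρ * κ ^ 6 / ((1 - ρ) * T)
  set r5 := κ ^ 4 / ((1 - ρ) * (N * T))
  set r6 := κ ^ 13 / (T : ℝ) with hr6
  set r7 := κ ^ 7 / (N * T : ℝ)
  have p1 : 0 ≤ r1 := by positivity
  have p2 : 0 ≤ r2 := by positivity
  have p3 : 0 ≤ r3 := by positivity
  have p4 : 0 ≤ r4 := by positivity
  have p5 : 0 ≤ r5 := by positivity
  have p6 : 0 ≤ r6 := by positivity
  have p7 : 0 ≤ r7 := by positivity
  have E1 : κ ^ 5 * (a / N) ≤ r1 := by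
    have h1 := Real.sqrt_pos.2 hN'
    have h2 := Real.sqrt_pos.2 hT'
    have h3 := Real.sq_sqrt hN'.le
    have h6 : a / N ≤ 1 / √(N * T) := by
      rw [Real.sqrt_div hT'.le] at c1
      rw [Real.sqrt_mul hN'.le, div_le_div_iff₀ hN' (by positivity)]
      calc a * (√N * √T) = a * (√T / √N) * (√N ^ 2) := by field_simp
        _ ≤ 1 * √N ^ 2 := by gcongr
        _ = 1 * N := by rw [h3]
    calc _ ≤ κ ^ 5 * (1 / √(N * T)) := by gcongr
      _ = _ := by rw [hr1]; ring
  -- Working with `q³ = 1 - ρ` and `p³ = ρ` makes the fractional powers polynomial, so the factor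
  -- `(a x)²` can be split off algebraically.
  have E2 : κ ^ 6 * (ρ ^ 2 * a ^ 2 * (1 - ρ)⁻¹) ≤ r2 := by
    generalize cbrt (1 - ρ) = q at *
    generalize cbrt ρ = p at *
    rw [← hq3, ← hp3]
    calc κ ^ 6 * ((p ^ 3) ^ 2 * a ^ 2 * (q ^ 3)⁻¹) =
        p ^ 2 * κ ^ 4 / (q * cbrt T ^ 2) * (a * (cbrt T * p ^ 2 * κ / q)) ^ 2 := by field_simp
      _ ≤ p ^ 2 * κ ^ 4 / (q * cbrt T ^ 2) * 1 := by gcongr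
      _ ≤ r2 := by
        rw [mul_one, hr2]
        gcongr
        norm_num
  have E3 : (ρ * a * (1 - ρ)⁻¹) ^ 2 * (κ ^ 2 * b₁ ^ 2 + κ ^ 6 * b₂ ^ 2) ≤ r3 := by
    have f1 : (ρ * a * (1 - ρ)⁻¹) ^ 2 * (κ ^ 2 * b₁ ^ 2) ≤
        cbrt ρ ^ 2 * (cbrt b₁ ^ 2 * cbrt κ ^ 16) / (cbrt (1 - ρ) ^ 2 * cbrt T ^ 2) := by
      generalize cbrt (1 - ρ) = q at *
      generalize cbrt ρ = p at *
      generalize cbrt b₁ = c at *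
      generalize cbrt κ = k at *
      rw [← hq3, ← hp3, ← hb13, ← hk3]
      calc (p ^ 3 * a * (q ^ 3)⁻¹) ^ 2 * ((k ^ 3) ^ 2 * (c ^ 3) ^ 2) =
          p ^ 2 * (c ^ 2 * k ^ 4) / (q ^ 2 * cbrt T ^ 2)
            * (a * (cbrt T * p ^ 2 * (c ^ 2 * k) / q ^ 2)) ^ 2 := by field_simp
        _ ≤ p ^ 2 * (c ^ 2 * k ^ 4) / (q ^ 2 * cbrt T ^ 2) * 1 := by gcongr
        _ ≤ _ := by
          rw [mul_one]
          gcongr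
          norm_num
    have f2 : (ρ * a * (1 - ρ)⁻¹) ^ 2 * (κ ^ 6 * b₂ ^ 2) ≤
        cbrt ρ ^ 2 * (cbrt b₂ ^ 2 * κ ^ 6) / (cbrt (1 - ρ) ^ 2 * cbrt T ^ 2) := by
      generalize cbrt (1 - ρ) = q at *
      generalize cbrt ρ = p at *
      generalize cbrt b₂ = c at *
      rw [← hq3, ← hp3, ← hb23]
      calc (p ^ 3 * a * (q ^ 3)⁻¹) ^ 2 * (κ ^ 6 * (c ^ 3) ^ 2) =
          p ^ 2 * (c ^ 2 * κ ^ 4) / (q ^ 2 * cbrt T ^ 2)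
            * (a * (cbrt T * p ^ 2 * (c ^ 2 * κ) / q ^ 2)) ^ 2 := by field_simp
        _ ≤ p ^ 2 * (c ^ 2 * κ ^ 4) / (q ^ 2 * cbrt T ^ 2) * 1 := by gcongr
        _ ≤ _ := by
          rw [mul_one]
          gcongr
          norm_num
    rw [mul_add]
    refine (add_le_add f1 f2).trans (le_of_eq ?_)
    rw [hr3]
    ring
  have E4 : κ ^ 2 * ((√(T : ℝ))⁻¹) ^ 2 ≤ r6 := by
    rw [inv_pow, Real.sq_sqrt hT'.le, ← div_eq_mul_inv, hr6]
    gcongr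
    norm_num
  calc _ = 300000 * ((σ / L) ^ 2 * (κ ^ 5 * (a / N))
        + (σ / L) ^ 2 * (κ ^ 6 * (ρ ^ 2 * a ^ 2 * (1 - ρ)⁻¹))
        + 1 / L ^ 2 * ((ρ * a * (1 - ρ)⁻¹) ^ 2 * (κ ^ 2 * b₁ ^ 2 + κ ^ 6 * b₂ ^ 2))
        + κ ^ 2 * ((√(T : ℝ))⁻¹) ^ 2) := by ring
    _ ≤ 300000 * ((σ / L) ^ 2 * (r1 + r2 + r3 + r4 + r5 + r6 + r7)
        + (σ / L) ^ 2 * (r1 + r2 + r3 + r4 + r5 + r6 + r7)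
        + 1 / L ^ 2 * (r1 + r2 + r3 + r4 + r5 + r6 + r7)
        + (r1 + r2 + r3 + r4 + r5 + r6 + r7)) := by
        gcongr
        all_goals linarith
    _ = _ := by ring

theorem consensus_le_rateBound (hκ : 0 ≤ κ) (hρ : 0 ≤ ρ) (hρ1 : ρ < 1) (hb₁ : 0 ≤ b₁)
    (hb₂ : 0 ≤ b₂) : κ ^ 4 / ((1 - ρ) * (N * T)) ≤ rateBound N T κ ρ b₁ b₂ := by
  have hq : 0 < 1 - ρ := by linarith
  rw [rateBound]
  refine le_of_sub_nonneg ?_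
  rw [show ∀ u v w x y z₁ z₂ : ℝ, u + v + w + x + y + z₁ + z₂ - y = u + v + w + x + z₁ + z₂ by
    intros; ring]
  positivity

end StepSize

end DSOBA

end

noncomputable section

namespace DSOBA

/-! ### Initial value and the main theorem -/

section Main

variable {N d p : ℕ} {Ξ Z : Type*} [MeasurableSpace Ξ] [MeasurableSpace Z]

/-- A factor `t` is extracted so that division by `r = t a` leaves only `1 / a`. The consensus terms
retain `a / (1 - ρ)`, whose `a` cancels, and lead to the term `κ⁴ / ((1 - ρ) N T)`. -/
theorem initial_lyapunov_le {P : Problem N d p Ξ Z} {L κ ρ a t R m : ℝ} {s₀ : State N d p}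
    (hreg : Regular P L κ) (hinit : InitBound P s₀ κ R) (hρ : 0 ≤ ρ) (hρ1 : ρ < 1) (ha : 0 ≤ a)
    (hm : 0 < m) (hmt : m ≤ κ ^ 4 * t) (htκ : κ ^ 4 * t ≤ 1) (hρa : ρ * a * (1 - ρ)⁻¹ ≤ 1) :
    lyapunov P L κ ρ a t (P.Phi (avg s₀.x) - R) s₀ ≤
      t * (R * (1 / (L * m) + 1 / L ^ 2 + 3016) * κ ^ 5
        + 20000 * R * (1 + 1 / L ^ 2) * (κ ^ 4 * (a * (1 - ρ)⁻¹ / N))) := by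
  have hL := hreg.L_pos
  have hκ := hreg.one_le_κ
  have hκ0 := hreg.κ_pos
  have hN : (0 : ℝ) < N := by exact_mod_cast hreg.nodes
  have hR : 0 ≤ R := (sq_nonneg _).trans hinit.y_err
  have ht : 0 < t := pos_of_mul_pos_right (hm.trans_le hmt) (by positivity)
  have hq : 0 < 1 - ρ := by linarith
  set e := (1 - ρ)⁻¹ with he
  have he0 : 0 < e := inv_pos.2 hq
  have k45 : κ ^ 4 ≤ κ ^ 5 := pow_le_pow_right₀ hκ (by norm_num)
  have k15 : κ ≤ κ ^ 5 := le_self_pow₀ hκ (by norm_num)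
  have k05 : 1 ≤ κ ^ 5 := one_le_pow₀ hκ
  -- The optimality gap carries no factor `t`; the lower bound `m ≤ κ⁴ t`, that is the lower bound
  -- on `τ`, supplies one.
  have h1 : (P.Phi (avg s₀.x) - (P.Phi (avg s₀.x) - R)) / L ≤ t * (R * (1 / (L * m)) * κ ^ 5) := by
    rw [sub_sub_cancel]
    calc R / L = R * (1 / (L * m)) * m := by field_simp
      _ ≤ R * (1 / (L * m)) * (κ ^ 5 * t) := by
          refine mul_le_mul_of_nonneg_left (hmt.trans ?_) (by positivity)
          gcongr
      _ = _ := by ring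
  have h2 : t * errH P L s₀ ≤ t * (R * (1 / L ^ 2) * κ ^ 5) := by
    have h3 := hinit.h_err
    rw [hreg.gradient_phi] at h3
    have h4 : errH P L s₀ ≤ R * (1 / L ^ 2) := by
      rw [errH, mul_one_div]
      gcongr
    exact mul_le_mul_of_nonneg_left (h4.trans (le_mul_of_one_le_right (by positivity) k05)) ht.le
  have h3 : 16 * κ * t * errZ P s₀ ≤ t * (R * 16 * κ ^ 5) := by
    calc _ ≤ 16 * κ ^ 5 * t * R := by
          gcongr
          · exact errZ_nonneg P s₀
          · exact hinit.z_err
      _ = _ := by ring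
  have h4 : 3000 * κ ^ 5 * t * errY P s₀ ≤ t * (R * 3000 * κ ^ 5) := by
    calc _ ≤ 3000 * κ ^ 5 * t * R := by
          gcongr
          exact hinit.y_err
      _ = _ := by ring
  have h5 : 20000 * κ ^ 2 * (t * a) * e * (κ ^ 4 * (cons s₀.x + cons s₀.y) + cons s₀.z) ≤
      t * (20000 * R * (κ ^ 4 * (a * e / N))) := by
    have h6 : κ ^ 4 * (cons s₀.x + cons s₀.y) + cons s₀.z ≤ κ ^ 2 * R / N := by
      rw [cons, cons, cons, le_div_iff₀ hN]
      have h7 : spread s₀.z ≤ κ ^ 2 * spread s₀.z :=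
        le_mul_of_one_le_left (spread_nonneg _) (one_le_pow₀ hκ)
      have h8 := mul_le_mul_of_nonneg_left hinit.consensus (sq_nonneg κ)
      field_simp
      linarith
    calc _ ≤ 20000 * κ ^ 2 * (t * a) * e * (κ ^ 2 * R / N) := by gcongr
      _ = _ := by ring
  have h6 : 20000 * κ ^ 6 * t ^ 3 * (ρ * a * e) ^ 2 * (cons s₀.h / L ^ 2) ≤
      t * (20000 * R * (1 / L ^ 2) * (κ ^ 4 * (a * e / N))) := by
    have h7 : κ ^ 6 * t ^ 2 ≤ 1 := by
      calc κ ^ 6 * t ^ 2 ≤ κ ^ 8 * t ^ 2 := by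
            gcongr
            norm_num
        _ = (κ ^ 4 * t) ^ 2 := by ring
        _ ≤ 1 := pow_le_one₀ (by positivity) htκ
    have h8 : (ρ * a * e) ^ 2 ≤ κ ^ 4 * (a * e) := by
      calc (ρ * a * e) ^ 2 = (ρ * a * e) * (ρ * (a * e)) := by ring
        _ ≤ 1 * (1 * (a * e)) := by gcongr
        _ ≤ κ ^ 4 * (a * e) := by
            rw [one_mul]
            have : 1 ≤ κ ^ 4 := one_le_pow₀ hκ
            gcongr
    have h9 : cons s₀.h / L ^ 2 ≤ R * (1 / L ^ 2) / N := by
      have := hinit.h_consensus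
      rw [cons, mul_one_div, div_right_comm]
      gcongr
    have h10 := cons_nonneg s₀.h
    calc _ = t * (20000 * (κ ^ 6 * t ^ 2) * (ρ * a * e) ^ 2 * (cons s₀.h / L ^ 2)) := by ring
      _ ≤ t * (20000 * 1 * (κ ^ 4 * (a * e)) * (R * (1 / L ^ 2) / N)) := by gcongr
      _ = _ := by ring
  rw [lyapunov, ← he]
  linarith

/-- The constant of the convergence rate. -/
def rateConst (L σ R m : ℝ) : ℝ :=
  L ^ 2 * (2 * (|R| * (1 / (L * m) + 1 / L ^ 2 + 3016) * (1000 * (1 + (σ / L) ^ 2))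
      + 20000 * |R| * (1 + 1 / L ^ 2))
    + 2 * (300000 * (2 * (σ / L) ^ 2 + 1 / L ^ 2 + 1)))

/-- The absolute value of `R` keeps the constant positive for negative `R` as well, where no start
satisfies the initial bounds. -/
theorem rateConst_pos {L m : ℝ} (σ R : ℝ) (hL : 0 < L) (hm : 0 < m) : 0 < rateConst L σ R m := by
  rw [rateConst]
  positivity

variable {Ω : Type*} [MeasurableSpace Ω] {Pr : Measure Ω} [IsProbabilityMeasure Pr]
  {P : Problem N d p Ξ Z} {v : Variant} {W : Matrix (Fin N) (Fin N) ℝ}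
  {ξ : ℕ → Fin N → Ω → Ξ} {ζ : ℕ → Fin N → Ω → Z} {L κ σ ρ b₁ b₂ t a τ α R m : ℝ}
  {δ : ℕ → Ω → ℝ} {X : ℕ → Ω → State N d p} {s₀ : State N d p} {T : ℕ}

/-- The convergence rate, for the normalized step size `a` and the rate `t` of the upper level. -/
theorem average_gradient_le (hreg : Regular P L κ) (hdiss : Dissimilarity P b₁ b₂)
    (hstoch : Stochastic P σ) (hmix : Mixing W ρ) (hsam : Sampling Pr P ξ ζ)
    (hinit : InitBound P s₀ κ R) (hρ : 0 ≤ ρ) (hρ1 : ρ < 1) (hb₁ : 0 ≤ b₁) (hb₂ : 0 ≤ b₂)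
    (hT : 1 ≤ T) (hm : 0 < m) (hmt : m ≤ κ ^ 4 * t) (htκ : κ ^ 4 * t ≤ 1 / 500)
    (ha : a = (stepDenom N T (1000 * (1 + (σ / L) ^ 2)) κ ρ b₁ b₂)⁻¹)
    (hrate : τ * α = t * a / L) (h0 : ∀ ω, X 0 ω = s₀)
    (hX : ∀ k ω, X (k + 1) ω =
      next P v W τ α (a / L) (a / L) a (δ k ω) (X k ω) (samples ξ ζ k ω))
    (hδ : ∀ k < T, Measurable[past ξ ζ k] (δ k))
    (hdiff : v = .FO → ∀ k < T, ∀ᵐ ω ∂Pr, 0 < δ k ω ∧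
      ∀ i, δ k ω * ‖(X k ω).z i‖ ^ 2 ≤ (√(T : ℝ))⁻¹) :
    (∀ k < T, Integrable (fun ω => ‖gradient P.Phi (avg (X k ω).x)‖ ^ 2) Pr) ∧
      1 / (T : ℝ) * ∑ k ∈ Finset.range T, ∫ ω, ‖gradient P.Phi (avg (X k ω).x)‖ ^ 2 ∂Pr ≤
        rateConst L σ R m * rateBound N T κ ρ b₁ b₂ := by
  have hL := hreg.L_pos
  have hκ := hreg.one_le_κ
  have hκ0 := hreg.κ_pos
  have hN := hreg.nodes
  have hN' : (0 : ℝ) < N := by exact_mod_cast hN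
  have hT' : (0 : ℝ) < T := by exact_mod_cast hT
  have hR : 0 ≤ R := (sq_nonneg _).trans hinit.y_err
  have ht : 0 < t := pos_of_mul_pos_right (hm.trans_le hmt) (by positivity)
  have hq : 0 < 1 - ρ := by linarith
  set K := 1000 * (1 + (σ / L) ^ 2) with hK
  have hK1000 : 1000 ≤ K := by
    have := sq_nonneg (σ / L)
    linarith
  have hK1 : 1 ≤ K := by linarith
  have hK0 : 0 ≤ K := by linarith
  obtain ⟨d1, d2, d3, d4, d5, d6⟩ := stepDenom_terms (T := T) hN hT hK0 hκ0 hρ hρ1 hb₁ hb₂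
  have hD := stepDenom_pos hN hT hK0 hκ0 hρ hρ1 hb₁ hb₂
  have hDe := stepDenom_eq (N := N) (T := T) (K := K) (κ := κ) (ρ := ρ) (b₁ := b₁) (b₂ := b₂)
  have hinitRate := initial_rate_le hN hT hK1 hκ hρ hρ1 hb₁ hb₂
  have herr := stepError_le L σ hN hT hK1 hκ hρ hρ1 hb₁ hb₂
  rw [← ha] at herr
  have hcons := consensus_le_rateBound (N := N) (T := T) hκ0.le hρ hρ1 hb₁ hb₂
  set D := stepDenom N T K κ ρ b₁ b₂
  set B := rateBound N T κ ρ b₁ b₂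
  have ha0 : 0 < a := by rw [ha]; exact inv_pos.2 hD
  have hbound : ∀ x, x ≤ D → a * x ≤ 1 := fun x hx => by
    rw [ha, inv_mul_le_iff₀ hD, mul_one]
    exact hx
  have haK : a * κ * K ≤ 1 := by
    have := hbound (K * κ) (by linarith)
    linarith
  have haκ : a * κ ≤ 1 := (le_mul_of_one_le_right (by positivity) hK1).trans haK
  have hρa : ρ * a * (1 - ρ)⁻¹ * κ ≤ 1 / 500 := by
    have h1 := hbound (K * (ρ * κ / (1 - ρ))) (by linarith)
    have h2 : a * (K * (ρ * κ / (1 - ρ))) = K * (ρ * a * (1 - ρ)⁻¹ * κ) := by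
      rw [div_eq_mul_inv]; ring
    have h3 : 0 ≤ ρ * a * (1 - ρ)⁻¹ * κ := by positivity
    have h4 : 1000 * (ρ * a * (1 - ρ)⁻¹ * κ) ≤ K * (ρ * a * (1 - ρ)⁻¹ * κ) := by gcongr
    linarith
  have hρa1 : ρ * a * (1 - ρ)⁻¹ ≤ 1 := by
    have : ρ * a * (1 - ρ)⁻¹ ≤ ρ * a * (1 - ρ)⁻¹ * κ := le_mul_of_one_le_right (by positivity) hκ
    linarith
  have hstep : ∀ k < T, ∀ᵐ ω ∂Pr,
      StepSetting P v W L κ σ ρ b₁ b₂ (√(T : ℝ))⁻¹ a (t * a) τ α (δ k ω) (X k ω) := by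
    intro k hk
    have h1 : ∀ᵐ ω ∂Pr, v = .FO → 0 < δ k ω ∧
        ∀ i, δ k ω * ‖(X k ω).z i‖ ^ 2 ≤ (√(T : ℝ))⁻¹ := by
      by_cases hv : v = .FO
      · filter_upwards [hdiff hv k hk] with ω hω _ using hω
      · exact ae_of_all _ fun ω h => absurd h hv
    filter_upwards [h1] with ω hω
    exact ⟨hreg, hdiss, hstoch, hmix, hρ, hρ1, by positivity, ha0, haκ, by positivity, hrate, hω⟩
  -- The level `Φ(x̄⁽⁰⁾) - R` replaces the infimum of Φ: it is a lower bound, and the initial gap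
  -- above it is exactly `R`.
  have hΦ : ∀ x, P.Phi (avg s₀.x) - R ≤ P.Phi x := fun x => by linarith [hinit.gap x]
  obtain ⟨hint, hsum⟩ := sum_sizeG_le hreg hstoch hsam hρ1 ha0 (mul_pos ht ha0) rfl htκ haK hρa hΦ
    h0 hX hδ hstep
  have hG : ∀ k ω, ‖gradient P.Phi (avg (X k ω).x)‖ ^ 2 = L ^ 2 * sizeG P L (X k ω) := by
    intro k ω
    rw [hreg.gradient_phi, sizeG]
    field_simp
  simp only [hG, integral_const_mul, ← Finset.mul_sum]
  refine ⟨fun k hk => (hint k hk).const_mul _, ?_⟩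
  have hlyap := initial_lyapunov_le hreg hinit hρ hρ1 ha0.le hm hmt (htκ.trans (by norm_num)) hρa1
  set C₁ := R * (1 / (L * m) + 1 / L ^ 2 + 3016) with hC₁
  set C₂ := 20000 * R * (1 + 1 / L ^ 2) with hC₂
  have hC₁0 : 0 ≤ C₁ := by positivity
  have hC₂0 : 0 ≤ C₂ := by positivity
  have hV : 1 / (T : ℝ) * (2 / (t * a) * lyapunov P L κ ρ a t (P.Phi (avg s₀.x) - R) s₀) ≤
      2 * (C₁ * K + C₂) * B := by
    calc _ ≤ 1 / (T : ℝ) * (2 / (t * a) * (t * (C₁ * κ ^ 5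
          + C₂ * (κ ^ 4 * (a * (1 - ρ)⁻¹ / N))))) := by gcongr
      _ = 2 * (C₁ * (κ ^ 5 * D / T) + C₂ * (κ ^ 4 / ((1 - ρ) * (N * T)))) := by
          have h1 : D = a⁻¹ := by rw [ha, inv_inv]
          rw [h1]
          field_simp
      _ ≤ 2 * (C₁ * (K * B) + C₂ * B) := by gcongr
      _ = _ := by ring
  have hE : 1 / (T : ℝ) * (2 * T * stepError N L κ σ ρ b₁ b₂ (√(T : ℝ))⁻¹ a) ≤
      2 * (300000 * (2 * (σ / L) ^ 2 + 1 / L ^ 2 + 1)) * B := by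
    calc _ = 2 * stepError N L κ σ ρ b₁ b₂ (√(T : ℝ))⁻¹ a := by field_simp
      _ ≤ _ := by linarith
  have h1 := mul_le_mul_of_nonneg_left hsum (show (0 : ℝ) ≤ 1 / T by positivity)
  rw [mul_add] at h1
  rw [rateConst, abs_of_nonneg hR, ← hC₁, ← hC₂, ← hK]
  calc _ = L ^ 2 * (1 / (T : ℝ) * ∑ k ∈ Finset.range T, ∫ ω, sizeG P L (X k ω) ∂Pr) := by ring
    _ ≤ L ^ 2 * (2 * (C₁ * K + C₂) * B
        + 2 * (300000 * (2 * (σ / L) ^ 2 + 1 / L ^ 2 + 1)) * B) := by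
        gcongr
        exact h1.trans (add_le_add hV hE)
    _ = _ := by ring

end Main

end DSOBA

end

theorem theorem1 (L σ R τlo τhi : ℝ) (hL : 0 < L) (hσ : 0 ≤ σ) (hτlo : 0 < τlo)
    (hτ : τlo ≤ τhi) :
    ∃ c₁ c₂ c₃ aLo aHi C : ℝ,
      0 < c₁ ∧ 0 < c₂ ∧ 0 < c₃ ∧ 0 < aLo ∧ 0 < aHi ∧ 0 < C ∧
      ∀ (N : ℕ) (Lf Lgradf Lgradg Lhessg μ ρ b₁ b₂ : ℝ), 1 ≤ N →
        0 < Lf → 0 < Lgradf → 0 < Lgradg → 0 < Lhessg → 0 < μ →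
        max (max Lf Lgradf) (max Lgradg Lhessg) = L →
        0 ≤ ρ → ρ < 1 → 0 ≤ b₁ → 0 ≤ b₂ →
        ∃ T₀ : ℕ, ∀ T : ℕ, 1 ≤ T →
          ∃ α ε : ℝ, 0 < α ∧ 0 < ε ∧
            α ≤ aHi * √((N : ℝ) / T) ∧ (T₀ ≤ T → aLo * √((N : ℝ) / T) ≤ α) ∧
            ∀ (d p : ℕ) (Ξ Z Ω : Type*) [MeasurableSpace Ξ] [MeasurableSpace Z]
              [MeasurableSpace Ω] (Pr : MeasureTheory.Measure Ω)
              [MeasureTheory.IsProbabilityMeasure Pr]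
              (P : DSOBA.Problem N d p Ξ Z) (W : Matrix (Fin N) (Fin N) ℝ)
              (s₀ : DSOBA.State N d p) (ξ : ℕ → Fin N → Ω → Ξ) (ζ : ℕ → Fin N → Ω → Z)
              (τ : ℝ) (v : DSOBA.Variant) (δ : ℕ → Ω → ℝ)
              (κ : ℝ) (X : ℕ → Ω → DSOBA.State N d p),
              1 ≤ p →
              κ = DSOBA.condNumber Lf Lgradf Lgradg Lhessg μ →
              DSOBA.Smooth P Lf Lgradf Lgradg Lhessg μ →
              DSOBA.Dissimilarity P b₁ b₂ →
              DSOBA.Stochastic P σ →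
              DSOBA.Mixing W ρ →
              DSOBA.Sampling Pr P ξ ζ →
              DSOBA.InitBound P s₀ κ R →
              τlo / κ ^ 4 ≤ τ → τ ≤ τhi / κ ^ 4 →
              (∀ t ω, X t ω = DSOBA.iterates P v W τ (fun _ => α) (fun _ => c₁ * α)
                (fun _ => c₂ * α) (fun _ => c₃ * α) (fun s => δ s ω)
                (fun s i => ξ s i ω) (fun s i => ζ s i ω) s₀ t) →
              (v = DSOBA.Variant.FO → ∀ t < T, Measurable[DSOBA.past ξ ζ t] (δ t) ∧
                ∀ᵐ ω ∂Pr, 0 < δ t ω ∧ ∀ i, δ t ω * ‖(X t ω).z i‖ ^ 2 ≤ ε) →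
              Differentiable ℝ P.Phi ∧
              (∀ t < T, MeasureTheory.Integrable
                (fun ω => ‖gradient P.Phi (DSOBA.avg (X t ω).x)‖ ^ 2) Pr) ∧
              1 / (T : ℝ) * ∑ t ∈ Finset.range T,
                  ∫ ω, ‖gradient P.Phi (DSOBA.avg (X t ω).x)‖ ^ 2 ∂Pr
                ≤ C * DSOBA.rateBound N T κ ρ b₁ b₂ := by
  have hτhi : 0 < τhi := hτlo.trans_le hτ
  -- With `α = a / c` and `t = L τ / c`, the window for `τ` becomes `τlo / (500 τhi) ≤ κ⁴ t ≤ 1 /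
  -- 500`. The step size does not depend on `τ` itself.
  set c := 500 * L * τhi with hc
  have hc0 : 0 < c := by positivity
  have hm : 0 < L * τlo / c := by positivity
  set K := 1000 * (1 + (σ / L) ^ 2) with hK
  have hK0 : 0 ≤ K := by positivity
  -- These ratios give `β = γ = a / L` and `θ = a`. As `a` is at most `√(N / T)`, and at least half
  -- of it for large `T`, the bounds on `α` have constants `1 / c` and `1 / (2 c)`.
  refine ⟨c / L, c / L, c, (2 * c)⁻¹, c⁻¹, DSOBA.rateConst L σ R (L * τlo / c), by positivity,
    by positivity, hc0, by positivity, by positivity, DSOBA.rateConst_pos σ R hL hm, ?_⟩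
  intro N Lf Lgradf Lgradg Lhessg μ ρ b₁ b₂ hN _ _ _ _ hμ hLmax hρ hρ1 hb₁ hb₂
  have hκ0 : 0 < L / μ := by positivity
  obtain ⟨T₀, hT₀⟩ := DSOBA.exists_stepDenom_le (b₁ := b₁) (b₂ := b₂) hN hK0 hκ0 hρ hρ1
  refine ⟨T₀, fun T hT => ?_⟩
  have hT' : (0 : ℝ) < T := by exact_mod_cast hT
  have hD := DSOBA.stepDenom_pos hN hT hK0 hκ0 hρ hρ1 hb₁ hb₂
  have hD1 := DSOBA.sqrt_le_stepDenom hN hT hK0 hκ0 hρ hρ1 hb₁ hb₂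
  have hsq := (DSOBA.stepDenom_terms hN hT hK0 hκ0 hρ hρ1 hb₁ hb₂).1
  have hD2 := hT₀ T hT
  have hinv : √((N : ℝ) / T) = (√((T : ℝ) / N))⁻¹ := by rw [← Real.sqrt_inv, inv_div]
  obtain ⟨a, ha⟩ : ∃ a, a = (DSOBA.stepDenom N T K (L / μ) ρ b₁ b₂)⁻¹ := ⟨_, rfl⟩
  have ha0 : 0 < a := by rw [ha]; exact inv_pos.2 hD
  refine ⟨a / c, (√(T : ℝ))⁻¹, by positivity, by positivity, ?_, fun hTT => ?_, ?_⟩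
  · rw [hinv, ha, div_eq_inv_mul]
    gcongr
  · have h1 := inv_anti₀ hD (hD2 hTT)
    rw [hinv, ha]
    calc (2 * c)⁻¹ * (√((T : ℝ) / N))⁻¹ = (2 * √((T : ℝ) / N))⁻¹ / c := by field_simp
      _ ≤ _ := by gcongr
  intro d p Ξ Z Ω _ _ _ Pr _ P W s₀ ξ ζ τ v δ κ X hp hκ hsmooth hdiss hstoch hmix hsam hinit hτ1 hτ2
    hX hδ
  have hκe : κ = L / μ := by rw [hκ, DSOBA.condNumber, hLmax]
  have hreg : DSOBA.Regular P L κ := hκe ▸ hsmooth.regular hN hp hμ hL hLmax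
  rw [← hκe] at ha
  refine ⟨hreg.differentiable_phi, ?_⟩
  have hκ4 : 0 < κ ^ 4 := pow_pos hreg.κ_pos 4
  rw [div_le_iff₀ hκ4] at hτ1
  rw [le_div_iff₀ hκ4] at hτ2
  have h0 : ∀ ω, X 0 ω = s₀ := fun ω => hX 0 ω
  have hc1 : c / L * (a / c) = a / L := by field_simp
  have hc3 : c * (a / c) = a := by field_simp
  have hrec : ∀ k ω, X (k + 1) ω = DSOBA.next P v W τ (a / c) (a / L) (a / L) a (δ k ω) (X k ω)
      (DSOBA.samples ξ ζ k ω) := by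
    intro k ω
    rw [hX (k + 1) ω, hX k ω, hc1, hc3]
    rfl
  have hmt : L * τlo / c ≤ κ ^ 4 * (L * τ / c) := by
    rw [mul_div_assoc', div_le_div_iff_of_pos_right hc0]
    nlinarith
  have htκ : κ ^ 4 * (L * τ / c) ≤ 1 / 500 := by
    rw [mul_div_assoc', div_le_iff₀ hc0, hc]
    nlinarith
  have hrate : τ * (a / c) = L * τ / c * a / L := by field_simp
  cases v with
  | SO =>
    -- The second-order variant ignores `δ`, about which nothing is then known; the constant `1` is
    -- measurable and gives the same iterates.
    exact DSOBA.average_gradient_le (v := .SO) (δ := fun _ _ => 1) hreg hdiss hstoch hmix hsam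
      hinit hρ hρ1 hb₁ hb₂ hT hm hmt htκ ha hrate h0 hrec (fun _ _ => measurable_const)
      (fun h => by cases h)
  | FO =>
    exact DSOBA.average_gradient_le (v := .FO) (δ := δ) hreg hdiss hstoch hmix hsam
      hinit hρ hρ1 hb₁ hb₂ hT hm hmt htκ ha hrate h0 hrec (fun k hk => (hδ rfl k hk).1)
      (fun _ k hk => (hδ rfl k hk).2)
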